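/- Let $\Sigma$ be a compact connected smooth surface with a smooth Riemannian metric $g_0$ of constant Gaussian curvature. Let $p_1,\dots,p_{\lambda_1}\in\Sigma$ be finitely many points and $D_1,\dots,D_{\lambda_2}\subset\Sigma$ finitely many pairwise disjoint closed disks with smooth boundary that contain none of the points $p_i$, and put $\mathcal M:=\Sigma\setminus\big(\bigcup_i\{p_i\}\cup\bigcup_j D_j\big)$. Let $\widehat G$ be a Green's function of $(\mathcal M,g_0)$ with pole $\hat y\in\mathcal M$: a function that is smooth and harmonic in $\mathcal M\setminus\{\hat y\}$, locally integrable in $\mathcal M$, and satisfies $\Delta_{g_0}\widehat G=-\delta_{\hat y}$ in $\mathcal M$ in the sense of distributions. A point $p_i$ is called a removable singularity if $\widehat G$ extends to a (smooth) solution of $\Delta_{g_0}\widehat G=0$ in a neighborhood of $p_i$ in $\Sigma$; extend $\widehat G$ and $\nabla_{g_0}\widehat G$ to all removable singularities, and let $\Omega$ be the union of $\mathcal M\setminus\{\hat y\}$ and the set of removable singularities. Let $z\in\Omega$ be a zero of $\nabla_{g_0}\widehat G$. Then: (i) the Taylor expansion of $\widehat G-\widehat G(z)$ at $z$ has a nonzero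 homogeneous term; the degree $m$ of the lowest one is the same in all smooth local coordinates, and $m\ge 2$; (ii) $z$ is an isolated zero of $\nabla_{g_0}\widehat G$; (iii) $z$ has arbitrarily small open neighborhoods $U$ in $\Sigma$ such that both $U\cap W^s(z)$ and $U\cap W^u(z)$ are homeomorphic to $\{\zeta\in\mathbb C:\zeta^m\in[0,1)\}$, where the stable set $W^s(z)$ (respectively, the unstable set $W^u(z)$) consists of the points of $\Omega$ whose trajectory under $\nabla_{g_0}\widehat G$ in $\Omega$ is defined for all times $t\ge0$ (respectively, $t\le0$) and has $\omega$-limit (respectively, $\alpha$-limit) set $\{z\}$; (iv) the index of the vector field $\nabla_{g_0}\widehat G$ at $z$ is $1-m$. -/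

import Mathlib

open Set Filter Topology Manifold ContDiff MeasureTheory

noncomputable section

/-- The coordinate plane `ℝ²`. -/
abbrev Plane : Type := EuclideanSpace ℝ (Fin 2)

/-- The coordinate vector `∂/∂uᵢ` of the plane. -/
def basisVec (i : Fin 2) : Plane := EuclideanSpace.single i 1

/-- The partial derivative `∂f/∂uᵢ` at `u`. -/
def pderiv (i : Fin 2) (f : Plane → ℝ) (u : Plane) : ℝ := fderiv ℝ f u (basisVec i)

/-- The point of the unit circle with angle `θ`. -/
def circlePt (θ : ℝ) : Plane := !₂[Real.cos θ, Real.sin θ]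

/-- `c : ℝ → ℝ²` (restricted to `[0, 2π]`) avoids the origin and its angle, followed continuously,
increases by `2πn`. -/
def HasWindingNumber (c : ℝ → Plane) (n : ℤ) : Prop :=
  (∀ θ, c θ ≠ 0) ∧ ∃ φ : ℝ → ℝ, Continuous φ ∧ (∀ θ, c θ = ‖c θ‖ • circlePt (φ θ)) ∧
    φ (2 * Real.pi) - φ 0 = 2 * Real.pi * n

/-- The set `{ζ ∈ ℂ : ζ ^ m ∈ [0, 1)}`. -/
def starSet (m : ℕ) : Set ℂ := {ζ | ∃ t : ℝ, 0 ≤ t ∧ t < 1 ∧ ζ ^ m = (t : ℂ)}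

section Surface

variable {S : Type*} [TopologicalSpace S] [ChartedSpace Plane S]

/-- The smooth charts of the surface: all charts compatible with its smooth structure. -/
def smoothCharts (S : Type*) [TopologicalSpace S] [ChartedSpace Plane S] :
    Set (OpenPartialHomeomorph S Plane) :=
  IsManifold.maximalAtlas (𝓡 2) ∞ S

/-- A smooth Riemannian metric on the surface. -/
abbrev SurfaceMetric (S : Type*) [TopologicalSpace S] [ChartedSpace Plane S]
    [IsManifold (𝓡 2) ∞ S] : Type _ :=
  Bundle.ContMDiffRiemannianMetric (𝓡 2) ∞ Plane (fun x : S => TangentSpace (𝓡 2) x)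

/-- A closed disk with smooth boundary. -/
def IsSmoothClosedDisk (D : Set S) : Prop :=
  ∃ e ∈ smoothCharts S, Metric.closedBall (0 : Plane) 1 ⊆ e.target ∧
    D = e.symm '' Metric.closedBall (0 : Plane) 1

/-- The surface with finitely many points and finitely many disks deleted. -/
def puncturedSurface (P : Finset S) {l : ℕ} (D : Fin l → Set S) : Set S :=
  ((P : Set S) ∪ ⋃ j, D j)ᶜ

/-- The vector field `X` in the coordinates of the chart `e`. -/
def coordField (X : (x : S) → TangentSpace (𝓡 2) x) (e : OpenPartialHomeomorph S Plane)
    (u : Plane) : Plane :=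
  mfderiv (𝓡 2) (𝓡 2) e (e.symm u) (X (e.symm u))

/-- The index at `z` of the vector field `X`, computed in the chart `e`, is `n`: this is the
winding number of `X` along all sufficiently small circles around `z`. -/
def HasIndexInChart (X : (x : S) → TangentSpace (𝓡 2) x) (e : OpenPartialHomeomorph S Plane)
    (z : S) (n : ℤ) : Prop :=
  ∀ᶠ r : ℝ in 𝓝[>] 0,
    HasWindingNumber (fun θ => coordField X e (e z + r • circlePt θ)) n

/-- The homogeneous term of degree `k` in the Taylor expansion of `f - f z` at `z`, in the
coordinates `v = u - e z` given by the chart `e`. -/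
def taylorTerm (f : S → ℝ) (e : OpenPartialHomeomorph S Plane) (z : S) (k : ℕ) (v : Plane) : ℝ :=
  (k.factorial : ℝ)⁻¹ *
    iteratedFDeriv ℝ k (fun u => f (e.symm u) - f z) (e z) (fun _ => v)

/-- `m` is the degree of the lowest nonzero homogeneous term in the Taylor expansion of
`f - f z` at `z`, in the chart `e`. -/
def IsLowestDegree (f : S → ℝ) (e : OpenPartialHomeomorph S Plane) (z : S) (m : ℕ) : Prop :=
  IsLeast {k : ℕ | ∃ v, taylorTerm f e z k v ≠ 0} m

/-- The ω-limit set of a curve. -/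
def omegaLimitSet (γ : ℝ → S) : Set S := ⋂ T : ℝ, closure (γ '' Ici T)

/-- The α-limit set of a curve. -/
def alphaLimitSet (γ : ℝ → S) : Set S := ⋂ T : ℝ, closure (γ '' Iic T)

section Dynamics

variable [IsManifold (𝓡 2) ∞ S]

/-- The stable set of `z` for the vector field `X` on `W`: the points whose forward trajectory
in `W` exists for all times `t ≥ 0` and has ω-limit set `{z}`. -/
def stableSet (X : (x : S) → TangentSpace (𝓡 2) x) (W : Set S) (z : S) : Set S :=
  {x | ∃ γ : ℝ → S, γ 0 = x ∧ (∀ t ∈ Ici (0 : ℝ), γ t ∈ W) ∧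
    IsMIntegralCurveOn γ X (Ici 0) ∧ omegaLimitSet γ = {z}}

/-- The unstable set of `z` for the vector field `X` on `W`: the points whose backward trajectory
in `W` exists for all times `t ≤ 0` and has α-limit set `{z}`. -/
def unstableSet (X : (x : S) → TangentSpace (𝓡 2) x) (W : Set S) (z : S) : Set S :=
  {x | ∃ γ : ℝ → S, γ 0 = x ∧ (∀ t ∈ Iic (0 : ℝ), γ t ∈ W) ∧
    IsMIntegralCurveOn γ X (Iic 0) ∧ alphaLimitSet γ = {z}}

end Dynamics

variable [IsManifold (𝓡 2) ∞ S]

/-- The matrix `gᵢⱼ` of the metric in the coordinates of the chart `e`. -/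
def metricMatrix (g : SurfaceMetric S) (e : OpenPartialHomeomorph S Plane) (u : Plane) :
    Matrix (Fin 2) (Fin 2) ℝ :=
  Matrix.of fun i j => g.inner (e.symm u)
    (mfderiv (𝓡 2) (𝓡 2) e.symm u (basisVec i)) (mfderiv (𝓡 2) (𝓡 2) e.symm u (basisVec j))

/-- The area density `√(det gᵢⱼ)` in the coordinates of the chart `e`. -/
def areaDensity (g : SurfaceMetric S) (e : OpenPartialHomeomorph S Plane) (u : Plane) : ℝ :=
  Real.sqrt (metricMatrix g e u).det

/-- The Christoffel symbol `Γᵏᵢⱼ` of the metric in the coordinates of the chart `e`. -/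
def christoffel (g : SurfaceMetric S) (e : OpenPartialHomeomorph S Plane) (k i j : Fin 2)
    (u : Plane) : ℝ :=
  (1 / 2) * ∑ l, (metricMatrix g e u)⁻¹ k l *
    (pderiv i (fun w => metricMatrix g e w j l) u + pderiv j (fun w => metricMatrix g e w i l) u
      - pderiv l (fun w => metricMatrix g e w i j) u)

/-- The component `R^a_bmn = ∂ₘ Γ^a_nb - ∂ₙ Γ^a_mb + ∑ᵣ (Γ^a_mr Γ^r_nb - Γ^a_nr Γ^r_mb)` of the
Riemann curvature tensor in the coordinates of the chart `e`. -/
def riemannTensor (g : SurfaceMetric S) (e : OpenPartialHomeomorph S Plane) (a b m n : Fin 2)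
    (u : Plane) : ℝ :=
  pderiv m (christoffel g e a n b) u - pderiv n (christoffel g e a m b) u +
    ∑ r, (christoffel g e a m r u * christoffel g e r n b u
      - christoffel g e a n r u * christoffel g e r m b u)

/-- The Gaussian curvature `R₀₁₀₁ / det gᵢⱼ` at the point with coordinates `u` in the chart `e`. -/
def gaussCurvature (g : SurfaceMetric S) (e : OpenPartialHomeomorph S Plane) (u : Plane) : ℝ :=
  (∑ a, metricMatrix g e u 0 a * riemannTensor g e a 1 0 1 u) / (metricMatrix g e u).det

/-- The metric has constant Gaussian curvature. -/
def HasConstantCurvature (g : SurfaceMetric S) : Prop :=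
  ∃ K : ℝ, ∀ e ∈ smoothCharts S, ∀ u ∈ e.target, gaussCurvature g e u = K

/-- The Laplace–Beltrami operator `(1/√det g) ∑ᵢ ∂ᵢ(√det g ∑ⱼ gⁱʲ ∂ⱼh)` in the coordinates of
the chart `e`, applied to a function `h` of these coordinates. -/
def laplaceBeltrami (g : SurfaceMetric S) (e : OpenPartialHomeomorph S Plane) (h : Plane → ℝ)
    (u : Plane) : ℝ :=
  (areaDensity g e u)⁻¹ * ∑ i, pderiv i
    (fun w => areaDensity g e w * ∑ j, (metricMatrix g e w)⁻¹ i j * pderiv j h w) u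

/-- `f` is smooth and harmonic (`Δ f = 0`) on the open set `U`. -/
def HarmonicOnSurface (g : SurfaceMetric S) (f : S → ℝ) (U : Set S) : Prop :=
  ContMDiffOn (𝓡 2) 𝓘(ℝ, ℝ) ∞ f U ∧
    ∀ e ∈ smoothCharts S, ∀ u ∈ e.target, e.symm u ∈ U →
      laplaceBeltrami g e (fun w => f (e.symm w)) u = 0

/-- `f` is smooth and harmonic in a neighborhood of `p`. -/
def HarmonicNear (g : SurfaceMetric S) (f : S → ℝ) (p : S) : Prop :=
  ∃ U : Set S, IsOpen U ∧ p ∈ U ∧ HarmonicOnSurface g f U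

open Classical in
/-- `G` (restricted to `M \ {y}`) is a Green's function of the open set `M` with pole `y ∈ M`:
it is smooth and harmonic in `M \ {y}`, locally integrable in `M`, and satisfies
`Δ G = -δ_y` in `M` in the sense of distributions, that is, `∫ G Δψ dA = -ψ(y)` for all test
functions `ψ` supported in the domain of a chart. -/
structure IsGreenFunction (g : SurfaceMetric S) (M : Set S) (y : S) (G : S → ℝ) : Prop where
  pole_mem : y ∈ M
  harmonic : HarmonicOnSurface g G (M \ {y})
  locallyIntegrable : ∀ e ∈ smoothCharts S, e.source ⊆ M →
    LocallyIntegrableOn (fun u => G (e.symm u)) e.target volume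
  distributional : ∀ e ∈ smoothCharts S, e.source ⊆ M → ∀ ψ : Plane → ℝ, ContDiff ℝ ∞ ψ →
    HasCompactSupport ψ → tsupport ψ ⊆ e.target →
      ∫ u, G (e.symm u) * laplaceBeltrami g e ψ u * areaDensity g e u =
        -(if y ∈ e.source then ψ (e y) else 0)

/-- `p` is a removable singularity of `G`: near `p`, `G` extends across `p` to a (smooth)
harmonic function. -/
def IsRemovable (g : SurfaceMetric S) (G : S → ℝ) (p : S) : Prop :=
  ∃ H : S → ℝ, HarmonicNear g H p ∧ ∀ᶠ x in 𝓝[≠] p, H x = G x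

open Classical in
/-- The function `G` with its values at the points of `P` replaced by its limits there; at the
removable singularities in `P` this is the harmonic extension of `G`. -/
def extendAcross (P : Finset S) (G : S → ℝ) (x : S) : ℝ :=
  if x ∈ P then limUnder (𝓝[≠] x) G else G x

/-- The domain of the extended gradient field: `M` without the pole `y`, together with the
removable singularities among the points of `P`. -/
def fieldDomain (g : SurfaceMetric S) (M : Set S) (P : Finset S) (y : S) (G : S → ℝ) : Set S :=
  (M \ {y}) ∪ {p | p ∈ P ∧ IsRemovable g G p}

/-- The Riemannian gradient: the vector `v` with `g(v, w) = df(w)` for all `w`. -/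
def gradientField (g : SurfaceMetric S) (f : S → ℝ) (x : S) : TangentSpace (𝓡 2) x :=
  ContinuousLinearMap.inverse (g.inner x) (mfderiv (𝓡 2) 𝓘(ℝ, ℝ) f x)

theorem isInvertible_of_pos (A : Plane →L[ℝ] Plane →L[ℝ] ℝ) (hA : ∀ v, v ≠ 0 → 0 < A v v) :
    A.IsInvertible := by
  have hinj : Function.Injective A.toLinearMap := by
    refine (injective_iff_map_eq_zero _).2 fun v hv => ?_
    by_contra hne
    have h1 := hA v hne
    have h2 : A v = 0 := hv
    rw [h2] at h1
    simp at h1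
  have hrank : Module.finrank ℝ Plane = Module.finrank ℝ (Plane →L[ℝ] ℝ) := by
    rw [← LinearEquiv.finrank_eq (LinearMap.toContinuousLinearMap (E := Plane) (F' := ℝ) (𝕜 := ℝ))]
    exact (Subspace.dual_finrank_eq (K := ℝ) (V := Plane)).symm
  refine ⟨(LinearEquiv.ofInjectiveOfFinrankEq A.toLinearMap hinj hrank).toContinuousLinearEquiv, ?_⟩
  ext v w
  rfl

/-- The defining property of the gradient. -/
theorem inner_gradientField (g : SurfaceMetric S) (f : S → ℝ) (x : S)
    (w : TangentSpace (𝓡 2) x) :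
    g.inner x (gradientField g f x) w = mfderiv (𝓡 2) 𝓘(ℝ, ℝ) f x w := by
  have h : ContinuousLinearMap.IsInvertible (g.inner x) :=
    isInvertible_of_pos (g.inner x) (fun v hv => g.pos x v hv)
  have h2 := h.self_apply_inverse (y := mfderiv (𝓡 2) 𝓘(ℝ, ℝ) f x)
  exact congrArg (fun L : TangentSpace (𝓡 2) x →L[ℝ] ℝ => L w) h2

end Surface

end

/-! In suitable coordinates a nonconstant harmonic function on a surface is, up to a constant, `Re
(w ^ m)` near any point, and its gradient field is a positive multiple of that of `Re (w ^ m)`,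
namely of `conj w ^ (m - 1)`. All four claims are read off from this model: degree `m`, an isolated
zero when `m ≥ 2`, `m` incoming and `m` outgoing rays, and angle turning `1 - m` times.

The coordinate is built as follows. In a chart the Laplace equation reads `div (A ∇f) = 0`, where
`A` is `√(det g)` times the inverse metric; in dimension two `det A = 1`. A conjugate function `h`
turns `f` into `F = f + i h`, which satisfies a Beltrami equation whose coefficient depends only on
`A`. A local homeomorphic solution `w` of the same equation is an isothermal coordinate, and `F ∘
w⁻¹` is holomorphic (`IsDivFormHarmonic.exists_isothermal`). Taking an `m`-th root of its leading
factor gives `PowerNormalForm`. The Beltrami equation is solved in `exists_hasFDerivAt_beltrami` by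
a Neumann series on the Fourier side: for coefficients that are Fourier transforms of `L¹` functions
the Beurling transform is a multiplier of modulus at most one, so no singular integrals are needed,
only smallness of an `L¹` norm, which is arranged by localizing near a zero of the coefficient.

For the stable set, `Im (w ^ m)` is a first integral, so a trajectory converging to `z` inside the
chart lies on a ray where `w ^ m` is real, and monotonicity of `f` selects the rays where it is
nonpositive. The same monotonicity, now along the whole trajectory, prevents excursions out of the
chart (`GradientChart.mem_rays_of_mem_stableSet`). Conversely, each such ray is a trajectory,
obtained from a scalar equation. Time reversal and rotation of `w` by an `m`-th root of `-1` give
the unstable set.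

It remains to see that the Green's function is nowhere locally constant. The surface without the
points, the disks and the pole is connected, so by unique continuation local constancy would make it
constant there; but the integral of the Laplacian of a test function vanishes, which contradicts the
point mass at the pole (`IsGreenFunction.not_eventually_const`). -/

open scoped FourierTransform ComplexConjugate Convolution

noncomputable section

/-! ### The Beltrami equation by Fourier analysis -/

/-- The real-linear map `v ↦ a v + b v̄` of the complex plane. -/
def wirtinger (a b : ℂ) : ℂ →L[ℝ] ℂ :=
  a • (ContinuousLinearMap.id ℝ ℂ) + b • (Complex.conjCLE : ℂ →L[ℝ] ℂ)

@[simp] theorem wirtinger_apply (a b v : ℂ) : wirtinger a b v = a * v + b * conj v := by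
  simp [wirtinger]

theorem norm_wirtinger_le (a b : ℂ) : ‖wirtinger a b‖ ≤ ‖a‖ + ‖b‖ := by
  refine ContinuousLinearMap.opNorm_le_bound _ (by positivity) fun v => ?_
  rw [wirtinger_apply, add_mul]
  refine (norm_add_le _ _).trans ?_
  simp

theorem continuous_wirtinger : Continuous fun p : ℂ × ℂ => wirtinger p.1 p.2 := by
  unfold wirtinger
  fun_prop

theorem wirtinger_comp (a b c d : ℂ) :
    (wirtinger a b).comp (wirtinger c d) =
      wirtinger (a * c + b * conj d) (a * d + b * conj c) := by
  ext v
  simp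
  ring

/-- The multiplier of the Beurling transform. -/
def beurlingSymbol (ξ : ℂ) : ℂ := conj ξ / ξ

theorem norm_beurlingSymbol_le (ξ : ℂ) : ‖beurlingSymbol ξ‖ ≤ 1 := by
  unfold beurlingSymbol
  rw [norm_div, RCLike.norm_conj]
  exact div_self_le_one _

theorem measurable_beurlingSymbol : Measurable beurlingSymbol := by
  unfold beurlingSymbol
  exact (Complex.continuous_conj.measurable).div measurable_id

theorem integrable_beurlingSymbol_mul {Q : ℂ → ℂ} (hQ : Integrable Q) :
    Integrable fun ξ => beurlingSymbol ξ * Q ξ :=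
  hQ.bdd_mul measurable_beurlingSymbol.aestronglyMeasurable
    (Eventually.of_forall norm_beurlingSymbol_le)

/-- A primitive whose antiholomorphic derivative is the Fourier transform of `Q`. -/
def cauchyPotential (Q : ℂ → ℂ) (x : ℂ) : ℂ :=
  ∫ ξ : ℂ, (Complex.exp (((-2 * Real.pi * inner ℝ ξ x : ℝ) : ℂ) * Complex.I) - 1) *
    (Q ξ / (-Real.pi * Complex.I * ξ))

/-- Differentiating the phase in direction `v` brings down `-π i (ξ̄ v + ξ v̄)`. Division by `-π i
ξ` leaves `Q` as the coefficient of `v̄` and `(ξ̄ / ξ) Q` as that of `v`, so the Beurling transform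
appears only as a bounded multiplier. -/
theorem hasFDerivAt_cauchyPotential {Q : ℂ → ℂ} (hQ : Integrable Q) (x : ℂ) :
    HasFDerivAt (cauchyPotential Q)
      (wirtinger (𝓕 (fun ξ => beurlingSymbol ξ * Q ξ) x) (𝓕 Q x)) x := by
  set E : ℂ → ℂ → ℂ := fun x ξ =>
    Complex.exp (((-2 * Real.pi * inner ℝ ξ x : ℝ) : ℂ) * Complex.I) with hE
  have hEn : ∀ x ξ, ‖E x ξ‖ = 1 := fun x ξ => Complex.norm_exp_ofReal_mul_I _
  have hEc : ∀ x, Continuous (E x) := fun x => by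
    simp only [hE]
    fun_prop
  have hσ := integrable_beurlingSymbol_mul hQ
  have i1 : ∀ x, Integrable fun ξ => E x ξ * Q ξ := fun x =>
    hQ.bdd_mul (hEc x).aestronglyMeasurable (Eventually.of_forall fun ξ => (hEn x ξ).le)
  have i2 : ∀ x, Integrable fun ξ => E x ξ * (beurlingSymbol ξ * Q ξ) := fun x =>
    hσ.bdd_mul (hEc x).aestronglyMeasurable (Eventually.of_forall fun ξ => (hEn x ξ).le)
  have hne : ∀ᵐ ξ : ℂ, ξ ≠ 0 := by
    simp [ae_iff]
  have hmeas : ∀ x, AEStronglyMeasurable (fun ξ : ℂ => (E x ξ - 1) *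
      (Q ξ / (-Real.pi * Complex.I * ξ))) volume := fun x => by
    refine AEStronglyMeasurable.mul ((hEc x).sub continuous_const).aestronglyMeasurable ?_
    exact (hQ.aestronglyMeasurable.aemeasurable.div
      (by fun_prop : Measurable fun ξ : ℂ => -Real.pi * Complex.I * ξ).aemeasurable).aestronglyMeasurable
  have hint : (∫ ξ, wirtinger (E x ξ * (beurlingSymbol ξ * Q ξ)) (E x ξ * Q ξ)) =
      wirtinger (𝓕 (fun ξ => beurlingSymbol ξ * Q ξ) x) (𝓕 Q x) := by
    unfold wirtinger
    rw [integral_add ((i2 x).smul_const _) ((i1 x).smul_const _), integral_smul_const,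
      integral_smul_const, Real.fourier_eq', Real.fourier_eq']
    rfl
  rw [← hint]
  refine hasFDerivAt_integral_of_dominated_of_fderiv_le (𝕜 := ℝ) (s := univ)
    (bound := fun ξ => 2 * ‖Q ξ‖)
    (F := fun x ξ => (E x ξ - 1) * (Q ξ / (-Real.pi * Complex.I * ξ)))
    (F' := fun x ξ => wirtinger (E x ξ * (beurlingSymbol ξ * Q ξ)) (E x ξ * Q ξ))
    univ_mem (Eventually.of_forall hmeas) ?_ ?_ ?_ ?_ ?_
  -- The subtracted `1` compensates the pole at `ξ = 0`: the difference of exponentials is at most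
  -- `2π ‖ξ‖ ‖x‖`.
  · refine (hQ.norm.const_mul (2 * ‖x‖)).mono' (hmeas x) ?_
    filter_upwards [hne] with ξ hξ
    have h1 : ‖E x ξ - 1‖ ≤ 2 * Real.pi * (‖ξ‖ * ‖x‖) := by
      have := Real.norm_exp_I_mul_ofReal_sub_one_le (x := -2 * Real.pi * inner ℝ ξ x)
      rw [mul_comm] at this
      refine this.trans ?_
      rw [norm_mul, norm_mul]
      simp only [Real.norm_eq_abs, abs_neg, abs_two, abs_of_pos Real.pi_pos]
      gcongr
      exact abs_real_inner_le_norm ξ x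
    have h2 : 0 < ‖ξ‖ := norm_pos_iff.2 hξ
    have h3 : ‖Q ξ / (-Real.pi * Complex.I * ξ)‖ = ‖Q ξ‖ / (Real.pi * ‖ξ‖) := by
      simp [abs_of_pos Real.pi_pos]
    rw [norm_mul, h3]
    calc _ ≤ 2 * Real.pi * (‖ξ‖ * ‖x‖) * (‖Q ξ‖ / (Real.pi * ‖ξ‖)) := by gcongr
      _ = 2 * ‖x‖ * ‖Q ξ‖ := by
        have := Real.pi_pos
        field_simp
  · unfold wirtinger
    exact ((i2 x).smul_const _).aestronglyMeasurable.add ((i1 x).smul_const _).aestronglyMeasurable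
  · refine Eventually.of_forall fun ξ x _ => (norm_wirtinger_le _ _).trans ?_
    rw [norm_mul, norm_mul, norm_mul, hEn]
    have := norm_beurlingSymbol_le ξ
    nlinarith [norm_nonneg (Q ξ)]
  · exact hQ.norm.const_mul 2
  · filter_upwards [hne] with ξ hξ x _
    have h1 : HasFDerivAt (fun x => ((-2 * Real.pi * inner ℝ ξ x : ℝ) : ℂ) * Complex.I)
        (Complex.I • (Complex.ofRealCLM.comp ((-2 * Real.pi) • innerSL ℝ ξ))) x :=
      (Complex.ofRealCLM.comp ((-2 * Real.pi) • innerSL ℝ ξ)).hasFDerivAt.mul_const Complex.I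
    have h2 := (h1.cexp.sub_const 1).mul_const (Q ξ / (-Real.pi * Complex.I * ξ))
    refine h2.congr_fderiv (ContinuousLinearMap.ext fun v => ?_)
    have h3 : ((inner ℝ ξ v : ℝ) : ℂ) = (conj ξ * v + ξ * conj v) / 2 := by
      apply Complex.ext <;> simp [Complex.inner] <;> ring
    have hpi : (Real.pi : ℂ) ≠ 0 := by exact_mod_cast Real.pi_ne_zero
    have h4 : (Complex.ofRealCLM.comp ((-2 * Real.pi) • innerSL ℝ ξ)) v =
        -2 * Real.pi * ((conj ξ * v + ξ * conj v) / 2) := by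
      rw [← h3]
      push_cast [ContinuousLinearMap.comp_apply, smul_apply,
        Complex.ofRealCLM_apply, innerSL_apply_apply, smul_eq_mul]
      rfl
    simp only [smul_apply, h4, wirtinger_apply, beurlingSymbol, smul_eq_mul, hE]
    field_simp

theorem integral_norm_convolution_mul_le {f g : ℂ → ℂ} (hf : Integrable f) (hg : Integrable g) :
    ∫ x, ‖(f ⋆[ContinuousLinearMap.mul ℂ ℂ] g) x‖ ≤ (∫ x, ‖f x‖) * ∫ x, ‖g x‖ := by
  have h := integral_convolution (L := ContinuousLinearMap.mul ℝ ℝ) (μ := (volume : Measure ℂ))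
    (ν := volume) hf.norm hg.norm
  rw [ContinuousLinearMap.mul_apply'] at h
  rw [← h]
  refine integral_mono (hf.integrable_convolution _ hg).norm
    (hf.norm.integrable_convolution _ hg.norm) fun x => ?_
  simp only [convolution_def, ContinuousLinearMap.mul_apply']
  refine (norm_integral_le_integral_norm _).trans_eq ?_
  simp

theorem continuous_fourier_of_integrable {Q : ℂ → ℂ} (hQ : Integrable Q) : Continuous (𝓕 Q) :=
  VectorFourier.fourierIntegral_continuous Real.continuous_fourierChar continuous_inner hQ

theorem norm_fourier_le_integral_norm (Q : ℂ → ℂ) (x : ℂ) : ‖𝓕 Q x‖ ≤ ∫ ξ, ‖Q ξ‖ :=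
  VectorFourier.norm_fourierIntegral_le_integral_norm _ _ _ _ _

/-- The densities in the Neumann series of the Beltrami equation. -/
def beltramiIterate (M : ℂ → ℂ) : ℕ → ℂ → ℂ
  | 0 => M
  | n + 1 => M ⋆[ContinuousLinearMap.mul ℂ ℂ] fun ξ => beurlingSymbol ξ * beltramiIterate M n ξ

theorem integrable_beltramiIterate {M : ℂ → ℂ} (hM : Integrable M) (n : ℕ) :
    Integrable (beltramiIterate M n) := by
  induction n with
  | zero => exact hM
  | succ n ih => exact hM.integrable_convolution _ (integrable_beurlingSymbol_mul ih)

theorem integral_norm_beurlingSymbol_mul_le {Q : ℂ → ℂ} (hQ : Integrable Q) :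
    ∫ ξ, ‖beurlingSymbol ξ * Q ξ‖ ≤ ∫ ξ, ‖Q ξ‖ := by
  refine integral_mono (integrable_beurlingSymbol_mul hQ).norm hQ.norm fun ξ => ?_
  simp only [norm_mul]
  exact mul_le_of_le_one_left (norm_nonneg _) (norm_beurlingSymbol_le ξ)

theorem integral_norm_beltramiIterate_le {M : ℂ → ℂ} (hM : Integrable M) {δ : ℝ}
    (hδ : ∫ ξ, ‖M ξ‖ ≤ δ) (n : ℕ) : ∫ ξ, ‖beltramiIterate M n ξ‖ ≤ δ ^ (n + 1) := by
  have hδ0 : 0 ≤ δ := (integral_nonneg fun _ => norm_nonneg _).trans hδ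
  induction n with
  | zero => simpa [beltramiIterate] using hδ
  | succ n ih =>
    have hi := integrable_beltramiIterate hM n
    refine (integral_norm_convolution_mul_le hM (integrable_beurlingSymbol_mul hi)).trans ?_
    rw [pow_succ' δ (n + 1)]
    exact mul_le_mul hδ ((integral_norm_beurlingSymbol_mul_le hi).trans ih)
      (integral_nonneg fun _ => norm_nonneg _) hδ0

/-- With `Q₀ = M` and `Qₙ₊₁ = M ⋆ (σ Qₙ)`, `σ` the Beurling symbol, the function `w = x + ∑
(potential of Qₙ)` has `∂̄w = ∑ 𝓕 Qₙ` and `∂w = 1 + ∑ 𝓕 (σ Qₙ)`. Since `𝓕` turns convolutions into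
products, `∂̄w = 𝓕 M · ∂w`. The `L¹` norms decay geometrically. -/
theorem exists_beltrami_of_integral_norm_le {M : ℂ → ℂ} (hM : Integrable M) {δ : ℝ}
    (hδ : ∫ ξ, ‖M ξ‖ ≤ δ) (hδ2 : δ < 1 / 2) :
    ∃ w p q : ℂ → ℂ, Continuous p ∧ Continuous q ∧
      (∀ x, HasFDerivAt w (wirtinger (q x) (p x)) x) ∧ (∀ x, p x = 𝓕 M x * q x) ∧
      ∀ x, q x ≠ 0 := by
  have hδ0 : 0 ≤ δ := (integral_nonneg fun _ => norm_nonneg _).trans hδ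
  have hi := integrable_beltramiIterate hM
  set Q := beltramiIterate M with hQ
  set S : ℕ → ℂ → ℂ := fun n ξ => beurlingSymbol ξ * Q n ξ with hS
  have hSi : ∀ n, Integrable (S n) := fun n => integrable_beurlingSymbol_mul (hi n)
  have bQ : ∀ n x, ‖𝓕 (Q n) x‖ ≤ δ ^ (n + 1) := fun n x =>
    (norm_fourier_le_integral_norm _ x).trans (integral_norm_beltramiIterate_le hM hδ n)
  have bS : ∀ n x, ‖𝓕 (S n) x‖ ≤ δ ^ (n + 1) := fun n x =>
    (norm_fourier_le_integral_norm _ x).trans ((integral_norm_beurlingSymbol_mul_le (hi n)).trans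
      (integral_norm_beltramiIterate_le hM hδ n))
  have hgeo : HasSum (fun n : ℕ => δ ^ (n + 1)) (δ * (1 - δ)⁻¹) := by
    simpa [pow_succ'] using (hasSum_geometric_of_lt_one hδ0 (by linarith)).mul_left δ
  have sQ : ∀ x, Summable fun n => 𝓕 (Q n) x := fun x =>
    Summable.of_norm_bounded hgeo.summable fun n => bQ n x
  have sS : ∀ x, Summable fun n => 𝓕 (S n) x := fun x =>
    Summable.of_norm_bounded hgeo.summable fun n => bS n x
  refine ⟨fun x => x + ∑' n, cauchyPotential (Q n) x, fun x => ∑' n, 𝓕 (Q n) x,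
    fun x => 1 + ∑' n, 𝓕 (S n) x, ?_, ?_, ?_, ?_, ?_⟩
  · exact continuous_tsum (fun n => continuous_fourier_of_integrable (hi n)) hgeo.summable bQ
  · exact continuous_const.add
      (continuous_tsum (fun n => continuous_fourier_of_integrable (hSi n)) hgeo.summable bS)
  · intro x
    have h := hasFDerivAt_tsum (𝕜 := ℝ) (f := fun n x => cauchyPotential (Q n) x)
      (f' := fun n x => wirtinger (𝓕 (S n) x) (𝓕 (Q n) x)) (u := fun n => 2 * δ ^ (n + 1))
      (x₀ := 0) (hgeo.summable.mul_left 2) (fun n x => hasFDerivAt_cauchyPotential (hi n) x)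
      (fun n x => (norm_wirtinger_le _ _).trans (by linarith [bQ n x, bS n x]))
      (by simp [cauchyPotential]) x
    refine ((hasFDerivAt_id x).add h).congr_fderiv ?_
    have h2 : ∑' n, wirtinger (𝓕 (S n) x) (𝓕 (Q n) x) =
        wirtinger (∑' n, 𝓕 (S n) x) (∑' n, 𝓕 (Q n) x) := by
      refine HasSum.tsum_eq ?_
      exact ((sS x).hasSum.smul_const _).add ((sQ x).hasSum.smul_const _)
    rw [h2]
    ext1 v
    simp
    ring
  · intro x
    beta_reduce
    -- Splitting off the term `Q₀ = M` matches the constant `1` in `q`; the shifted terms match one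
    -- by one.
    rw [(sQ x).tsum_eq_zero_add, mul_add, mul_one, ← tsum_mul_left]
    congr 1
    refine tsum_congr fun n => ?_
    exact Real.fourier_mul_convolution_eq hM (hSi n) x
  · intro x h0
    -- The geometric bound `δ / (1 - δ)` is below `1` precisely because `δ < 1 / 2`.
    have h1 : ‖∑' n, 𝓕 (S n) x‖ ≤ δ * (1 - δ)⁻¹ :=
      tsum_of_norm_bounded hgeo fun n => bS n x
    have h2 : ∑' n, 𝓕 (S n) x = -1 := by linear_combination h0
    rw [h2, norm_neg, norm_one, ← div_eq_mul_inv, le_div_iff₀ (by linarith)] at h1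
    linarith

/-- Dominated convergence: a Schwartz function decays like `(1 + ‖x‖) ^ (-3)`, which is integrable
in real dimension two, and a translation by less than `1` costs only a constant factor. -/
theorem tendsto_integral_norm_translate_sub (φ : SchwartzMap ℂ ℂ) :
    Tendsto (fun τ : ℂ => ∫ ξ, ‖φ (ξ - τ) - φ ξ‖) (𝓝 0) (𝓝 0) := by
  obtain ⟨C, hC⟩ : ∃ C, ∀ x, ‖φ x‖ ≤ C * (1 + ‖x‖) ^ (-(3 : ℝ)) := by
    refine ⟨2 ^ 3 * ((Finset.Iic (3, 0)).sup fun m => SchwartzMap.seminorm ℝ m.1 m.2) φ,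
      fun x => ?_⟩
    have h := SchwartzMap.one_add_le_sup_seminorm_apply (𝕜 := ℝ) (m := (3, 0)) (k := 3) (n := 0)
      le_rfl le_rfl φ x
    rw [norm_iteratedFDeriv_zero] at h
    have hx : 0 < 1 + ‖x‖ := by positivity
    rw [Real.rpow_neg hx.le, ← div_eq_mul_inv, le_div_iff₀ (by positivity), mul_comm]
    exact_mod_cast h
  have hC0 : 0 ≤ C := by
    have := (norm_nonneg _).trans (hC 0)
    simpa using this
  have hint : Integrable fun x : ℂ => (1 + ‖x‖) ^ (-(3 : ℝ)) :=
    integrable_one_add_norm (by simp [Complex.finrank_real_complex]; norm_num)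
  have h := tendsto_integral_filter_of_dominated_convergence (μ := (volume : Measure ℂ))
    (F := fun τ ξ => ‖φ (ξ - τ) - φ ξ‖) (f := fun _ => (0 : ℝ)) (l := 𝓝 (0 : ℂ))
    (fun ξ => 9 * C * (1 + ‖ξ‖) ^ (-(3 : ℝ))) ?_ ?_ (hint.const_mul _) ?_
  · simpa using h
  · refine Eventually.of_forall fun τ => Continuous.aestronglyMeasurable ?_
    have := φ.continuous
    fun_prop
  · filter_upwards [Metric.ball_mem_nhds (0 : ℂ) one_pos] with τ hτ
    refine Eventually.of_forall fun ξ => ?_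
    rw [norm_norm]
    have hτ1 : ‖τ‖ < 1 := by simpa using hτ
    -- The factor is `8 = 2 ^ 3`; adding the untranslated term gives the `9` of the dominating
    -- function.
    have h1 : (1 + ‖ξ - τ‖) ^ (-(3 : ℝ)) ≤ 8 * (1 + ‖ξ‖) ^ (-(3 : ℝ)) := by
      have h2 : 1 + ‖ξ‖ ≤ 2 * (1 + ‖ξ - τ‖) := by
        have := norm_sub_norm_le ξ τ
        have := norm_nonneg (ξ - τ)
        linarith
      have h3 : (1 + ‖ξ‖) ^ 3 ≤ 8 * (1 + ‖ξ - τ‖) ^ 3 := by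
        calc _ ≤ (2 * (1 + ‖ξ - τ‖)) ^ 3 := by gcongr
          _ = _ := by ring
      rw [Real.rpow_neg (by positivity), Real.rpow_neg (by positivity), ← div_eq_mul_inv,
        inv_eq_one_div, div_le_div_iff₀ (by positivity) (by positivity), one_mul]
      exact_mod_cast h3
    calc ‖φ (ξ - τ) - φ ξ‖ ≤ ‖φ (ξ - τ)‖ + ‖φ ξ‖ := norm_sub_le _ _
      _ ≤ C * (1 + ‖ξ - τ‖) ^ (-(3 : ℝ)) + C * (1 + ‖ξ‖) ^ (-(3 : ℝ)) := add_le_add (hC _) (hC _)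
      _ ≤ C * (8 * (1 + ‖ξ‖) ^ (-(3 : ℝ))) + C * (1 + ‖ξ‖) ^ (-(3 : ℝ)) := by gcongr
      _ = _ := by ring
  · refine Eventually.of_forall fun ξ => ?_
    have : Continuous fun τ => ‖φ (ξ - τ) - φ ξ‖ := by
      have := φ.continuous
      fun_prop
    simpa using this.tendsto 0

theorem fourier_smul_comp_smul (φ : ℂ → ℂ) {ε : ℝ} (hε : 0 < ε) (x : ℂ) :
    𝓕 (fun ξ : ℂ => (ε ^ 2 : ℝ) • φ (ε • ξ)) x = 𝓕 φ (ε⁻¹ • x) := by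
  rw [Real.fourier_eq', Real.fourier_eq']
  have h := Measure.integral_comp_smul (volume : Measure ℂ)
    (fun u : ℂ => Complex.exp (((-2 * Real.pi * inner ℝ u (ε⁻¹ • x) : ℝ) : ℂ) * Complex.I) • φ u) ε
  have hab : |((ε ^ 2)⁻¹ : ℝ)| = (ε ^ 2)⁻¹ := abs_of_pos (by positivity)
  rw [Complex.finrank_real_complex, hab] at h
  have h2 : ∫ u : ℂ, Complex.exp (((-2 * Real.pi * inner ℝ u (ε⁻¹ • x) : ℝ) : ℂ) * Complex.I) • φ u
      = (ε ^ 2 : ℝ) • ((ε ^ 2)⁻¹ : ℝ) • ∫ u : ℂ,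
        Complex.exp (((-2 * Real.pi * inner ℝ u (ε⁻¹ • x) : ℝ) : ℂ) * Complex.I) • φ u := by
    rw [smul_smul, mul_inv_cancel₀ (by positivity), one_smul]
  rw [h2, ← h, ← integral_smul]
  refine integral_congr_ae (Eventually.of_forall fun ξ => ?_)
  have h3 : inner ℝ (ε • ξ) (ε⁻¹ • x) = inner ℝ ξ x := by
    rw [real_inner_smul_left, real_inner_smul_right]
    field_simp
  simp only [h3]
  rw [smul_comm]

theorem exists_schwartzMap_fourier_eventuallyEq_one :
    ∃ φ : SchwartzMap ℂ ℂ, 𝓕 (φ : ℂ → ℂ) =ᶠ[𝓝 0] 1 := by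
  let b : ContDiffBump (0 : ℂ) := ⟨1, 2, one_pos, one_lt_two⟩
  have h1 : HasCompactSupport fun x : ℂ => (b x : ℂ) :=
    b.hasCompactSupport.comp_left (g := fun t : ℝ => (t : ℂ)) (by simp)
  have h2 : ContDiff ℝ ∞ fun x : ℂ => (b x : ℂ) := Complex.ofRealCLM.contDiff.comp b.contDiff
  refine ⟨𝓕⁻ (h1.toSchwartzMap h2), ?_⟩
  rw [← SchwartzMap.fourier_coe, FourierTransform.fourier_fourierInv_eq]
  filter_upwards [b.eventuallyEq_one] with x hx
  simp [hx]

theorem integrable_sub_translate {m φ : ℂ → ℂ} (hm : Integrable m) (hφ : Integrable φ) :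
    Integrable (fun p : ℂ × ℂ => m p.2 * (φ (p.1 - p.2) - φ p.1)) (volume.prod volume) := by
  have h1 := hm.convolution_integrand (ContinuousLinearMap.mul ℝ ℂ) hφ
  have h2 := (hφ.mul_prod hm)
  refine (h1.sub h2).congr (Eventually.of_forall fun p => ?_)
  simp
  ring

/-- As `m` has mean zero, `φ (ξ - η)` may be replaced by `φ (ξ - η) - φ ξ` in the convolution. This
gain makes slowly varying `φ` give small convolutions. -/
theorem integral_norm_convolution_le_of_integral_eq_zero {m φ : ℂ → ℂ} (hm : Integrable m)
    (hφ : Integrable φ) (h0 : ∫ η, m η = 0) :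
    ∫ ξ, ‖(m ⋆[ContinuousLinearMap.mul ℂ ℂ] φ) ξ‖ ≤
      ∫ η, ‖m η‖ * ∫ ξ, ‖φ (ξ - η) - φ ξ‖ := by
  have hi := (integrable_sub_translate hm hφ).norm
  have h1 : ∀ᵐ ξ : ℂ, ‖(m ⋆[ContinuousLinearMap.mul ℂ ℂ] φ) ξ‖ ≤
      ∫ η, ‖m η * (φ (ξ - η) - φ ξ)‖ := by
    filter_upwards [hm.ae_convolution_exists (ContinuousLinearMap.mul ℂ ℂ) hφ] with ξ hξ
    have h2 : (m ⋆[ContinuousLinearMap.mul ℂ ℂ] φ) ξ = ∫ η, m η * (φ (ξ - η) - φ ξ) := by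
      simp only [mul_sub]
      have hξ' : Integrable fun η => m η * φ (ξ - η) := hξ
      rw [integral_sub hξ' (hm.mul_const _), integral_mul_const, h0, zero_mul, sub_zero]
      rfl
    rw [h2]
    exact norm_integral_le_integral_norm _
  calc _ ≤ ∫ ξ, ∫ η, ‖m η * (φ (ξ - η) - φ ξ)‖ :=
        integral_mono_ae (hm.integrable_convolution _ hφ).norm hi.integral_prod_left h1
    _ = ∫ η, ∫ ξ, ‖m η * (φ (ξ - η) - φ ξ)‖ := integral_integral_swap hi
    _ = _ := by
      refine integral_congr_ae (Eventually.of_forall fun η => ?_)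
      simp only [norm_mul, integral_const_mul]

/-- Localization makes the `L¹` norm on the Fourier side small. Let `m` be the inverse transform of
`μ` and multiply `μ` by the cutoff `𝓕 φ (x / ε)`, which is `1` near `0`; on the Fourier side this
convolves `m` with `ε² φ (ε ·)`. Since `∫ m = μ 0 = 0`, the norm is at most `∫ ‖m η‖ h (ε η)`, where
`h` is the `L¹` modulus of continuity of `φ`, and this tends to `0` with `ε`. -/
theorem exists_integrable_fourier_eventuallyEq (μ : SchwartzMap ℂ ℂ) (h0 : μ 0 = 0) {δ : ℝ}
    (hδ : 0 < δ) : ∃ M : ℂ → ℂ, Integrable M ∧ ∫ ξ, ‖M ξ‖ ≤ δ ∧ 𝓕 M =ᶠ[𝓝 0] μ := by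
  obtain ⟨φ, hφ⟩ := exists_schwartzMap_fourier_eventuallyEq_one
  set m : SchwartzMap ℂ ℂ := 𝓕⁻ μ with hm
  have hmμ : 𝓕 (m : ℂ → ℂ) = μ := by
    rw [← SchwartzMap.fourier_coe, hm, FourierTransform.fourier_fourierInv_eq]
  have hm0 : ∫ η, m η = 0 := by
    have h : 𝓕 (m : ℂ → ℂ) 0 = 0 := by rw [hmμ, h0]
    rw [Real.fourier_eq'] at h
    simpa using h
  set h : ℂ → ℝ := fun τ => ∫ ξ, ‖φ (ξ - τ) - φ ξ‖ with hh
  have hsm : StronglyMeasurable h := by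
    refine StronglyMeasurable.integral_prod_right (f := fun τ ξ : ℂ => ‖φ (ξ - τ) - φ ξ‖) ?_
    refine Continuous.stronglyMeasurable ?_
    have := φ.continuous
    fun_prop
  have hbd : ∀ τ, ‖h τ‖ ≤ 2 * ∫ ξ, ‖φ ξ‖ := fun τ => by
    have hi := φ.integrable (μ := volume)
    rw [Real.norm_of_nonneg (integral_nonneg fun _ => norm_nonneg _)]
    calc _ ≤ ∫ ξ, (‖φ (ξ - τ)‖ + ‖φ ξ‖) :=
          integral_mono ((hi.comp_sub_right τ).sub hi).norm
            ((hi.comp_sub_right τ).norm.add hi.norm) fun ξ => norm_sub_le _ _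
      _ = _ := by
        rw [integral_add (hi.comp_sub_right τ).norm hi.norm,
          integral_sub_right_eq_self (fun ξ => ‖φ ξ‖) τ, two_mul]
  have hlim : Tendsto (fun ε : ℝ => ∫ η, ‖m η‖ * h (ε • η)) (𝓝 0) (𝓝 0) := by
    have := tendsto_integral_filter_of_dominated_convergence (μ := (volume : Measure ℂ))
      (F := fun (ε : ℝ) η => ‖m η‖ * h (ε • η)) (f := fun _ => (0 : ℝ)) (l := 𝓝 (0 : ℝ))
      (fun η => ‖m η‖ * (2 * ∫ ξ, ‖φ ξ‖)) ?_ ?_ ?_ ?_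
    · simpa using this
    · refine Eventually.of_forall fun ε => ?_
      exact (m.continuous.norm.stronglyMeasurable.mul
        (hsm.comp_measurable (measurable_const_smul ε))).aestronglyMeasurable
    · refine Eventually.of_forall fun ε => Eventually.of_forall fun η => ?_
      rw [norm_mul, norm_norm]
      exact mul_le_mul_of_nonneg_left (hbd _) (norm_nonneg _)
    · exact (m.integrable (μ := volume)).norm.mul_const _
    · refine Eventually.of_forall fun η => ?_
      have h1 : Tendsto (fun ε : ℝ => ε • η) (𝓝 0) (𝓝 0) := by
        simpa using (by fun_prop : Continuous fun ε : ℝ => ε • η).tendsto 0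
      simpa using ((tendsto_integral_norm_translate_sub φ).comp h1).const_mul ‖m η‖
  obtain ⟨ε, hε, hεδ⟩ : ∃ ε : ℝ, 0 < ε ∧ ∫ η, ‖m η‖ * h (ε • η) < δ := by
    have h1 := (hlim.eventually (gt_mem_nhds hδ)).filter_mono
      (nhdsWithin_le_nhds (s := Ioi (0 : ℝ)))
    obtain ⟨ε, h2, h3⟩ := (h1.and self_mem_nhdsWithin).exists
    exact ⟨ε, h3, h2⟩
  set φε : ℂ → ℂ := fun ξ => (ε ^ 2 : ℝ) • φ (ε • ξ) with hφε
  have hi : Integrable φε :=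
    ((φ.integrable (μ := volume)).comp_smul hε.ne').smul (ε ^ 2 : ℝ)
  have hmi : Integrable m := m.integrable
  refine ⟨m ⋆[ContinuousLinearMap.mul ℂ ℂ] φε, hmi.integrable_convolution _ hi, ?_, ?_⟩
  · refine (integral_norm_convolution_le_of_integral_eq_zero hmi hi hm0).trans (le_of_eq_of_le ?_ hεδ.le)
    refine integral_congr_ae (Eventually.of_forall fun η => ?_)
    simp only [hφε, hh]
    congr 1
    -- The dilation preserves `L¹` norms, so translating the dilated function by `η` amounts to
    -- translating `φ` by `ε η`.
    have h1 := Measure.integral_comp_smul (volume : Measure ℂ)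
      (fun u : ℂ => ‖φ (u - ε • η) - φ u‖) ε
    have hab : |((ε ^ 2)⁻¹ : ℝ)| = (ε ^ 2)⁻¹ := abs_of_pos (by positivity)
    rw [Complex.finrank_real_complex, hab, smul_eq_mul, inv_mul_eq_div,
      eq_div_iff (by positivity), mul_comm, ← integral_const_mul] at h1
    rw [← h1]
    refine integral_congr_ae (Eventually.of_forall fun ξ => ?_)
    simp only [← smul_sub, norm_smul, Real.norm_eq_abs, abs_of_pos (pow_pos hε 2)]
  · have h1 : Tendsto (fun x : ℂ => ε⁻¹ • x) (𝓝 0) (𝓝 0) := by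
      simpa using (continuous_const_smul ε⁻¹ : Continuous fun x : ℂ => ε⁻¹ • x).tendsto 0
    filter_upwards [h1.eventually hφ] with x hx
    rw [Real.fourier_mul_convolution_eq hmi hi, hφε, fourier_smul_comp_smul _ hε, hx, hmμ]
    simp

theorem exists_schwartzMap_eventuallyEq {f : ℂ → ℂ} {N : Set ℂ} (hN : IsOpen N) (h0 : 0 ∈ N)
    (hf : ContDiffOn ℝ ∞ f N) : ∃ φ : SchwartzMap ℂ ℂ, φ =ᶠ[𝓝 0] f := by
  obtain ⟨ε, hε, hεN⟩ := Metric.isOpen_iff.1 hN 0 h0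
  let b : ContDiffBump (0 : ℂ) := ⟨ε / 4, ε / 2, by positivity, by linarith⟩
  have h1 : HasCompactSupport fun x : ℂ => b x • f x := b.hasCompactSupport.smul_right
  have h2 : ContDiff ℝ ∞ fun x : ℂ => b x • f x := by
    refine contMDiff_iff_contDiff.1 (contMDiff_of_tsupport fun x hx => ContDiffAt.contMDiffAt ?_)
    have hx' : x ∈ tsupport b := tsupport_smul_subset_left (b : ℂ → ℝ) f hx
    rw [b.tsupport_eq] at hx'
    have hxN : x ∈ N := hεN (Metric.closedBall_subset_ball (by show ε / 2 < ε; linarith) hx')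
    exact b.contDiff.contDiffAt.smul (hf.contDiffAt (hN.mem_nhds hxN))
  refine ⟨h1.toSchwartzMap h2, ?_⟩
  filter_upwards [b.eventuallyEq_one] with x hx
  simp [hx]

/-- Local solvability of the Beltrami equation with smooth coefficient. -/
theorem exists_hasFDerivAt_beltrami {μ : ℂ → ℂ} {N : Set ℂ} (hN : IsOpen N)
    (hμ : ContDiffOn ℝ ∞ μ N) {u₀ : ℂ} (hu : u₀ ∈ N) (h1 : ‖μ u₀‖ < 1) :
    ∃ w α : ℂ → ℂ, Continuous α ∧
      ∀ᶠ u in 𝓝 u₀, HasFDerivAt w (wirtinger (α u) (μ u * α u)) u ∧ α u ≠ 0 := by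
  set c := μ u₀ with hc
  have hcc : (1 - c * conj c) ≠ 0 := by
    rw [Complex.mul_conj, sub_ne_zero]
    intro h
    have h2 : Complex.normSq c = 1 := by exact_mod_cast h.symm
    rw [Complex.normSq_eq_norm_sq] at h2
    nlinarith [norm_nonneg c]
  -- The map `L` below solves the equation with constant coefficient `c = μ u₀`, and `T` is its
  -- inverse. In the coordinate `L` the coefficient becomes `(μ - c) / (1 - μ c̄)`, up to `T`, and
  -- vanishes at the center, as the localization requires.
  set T : ℂ → ℂ := fun ζ => u₀ + wirtinger (1 - c * conj c)⁻¹ (-c * (1 - c * conj c)⁻¹) ζ with hT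
  set L : ℂ → ℂ := fun u => wirtinger 1 c (u - u₀) with hL
  have hTs : ContDiff ℝ ∞ T := contDiff_const.add (ContinuousLinearMap.contDiff _)
  have hTL : ∀ u, T (L u) = u := fun u => by
    have hr : conj (1 - c * conj c) = 1 - c * conj c := by simp [mul_comm]
    simp only [hT, hL, wirtinger_apply, map_add, map_mul, one_mul, Complex.conj_conj]
    field_simp
    ring
  have hT0 : T 0 = u₀ := by simp [hT]
  have hLc : Continuous L := (ContinuousLinearMap.continuous _).comp (by fun_prop)
  have hL0 : L u₀ = 0 := by simp [hL]
  set N' : Set ℂ := N ∩ {u | 1 - μ u * conj c ≠ 0} with hN'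
  have hN'o : IsOpen N' :=
    (continuousOn_const.sub (hμ.continuousOn.mul continuousOn_const)).isOpen_inter_preimage hN
      isOpen_ne
  have hν : ContDiffOn ℝ ∞ (fun u => (μ u - c) / (1 - μ u * conj c)) N' := by
    have hμ' := hμ.mono (inter_subset_left : N' ⊆ N)
    simp only [div_eq_mul_inv]
    exact (hμ'.sub contDiffOn_const).mul
      ((contDiffOn_const.sub (hμ'.mul contDiffOn_const)).inv fun u hu => hu.2)
  obtain ⟨φ, hφ⟩ := exists_schwartzMap_eventuallyEq (hN'o.preimage hTs.continuous)
    (by rw [mem_preimage, hT0]; exact ⟨hu, hcc⟩) (hν.comp hTs.contDiffOn fun _ h => h)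
  have hφ0 : φ 0 = 0 := by
    rw [hφ.self_of_nhds]
    simp [hT0, hc]
  -- Any bound below `1 / 2` would do in place of `1 / 4`.
  obtain ⟨M, hMi, hMδ, hM⟩ := exists_integrable_fourier_eventuallyEq φ hφ0
    (show (0 : ℝ) < 1 / 4 by norm_num)
  obtain ⟨w, p, q, hp, hq, hw, hpq, hq0⟩ :=
    exists_beltrami_of_integral_norm_le hMi hMδ (by norm_num)
  refine ⟨w ∘ L, fun u => q (L u) + p (L u) * conj c, by fun_prop, ?_⟩
  have hLt : Tendsto L (𝓝 u₀) (𝓝 0) := by simpa [hL0] using hLc.tendsto u₀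
  filter_upwards [hLt.eventually (hM.trans hφ), hN'o.mem_nhds ⟨hu, hcc⟩] with u h2 h3
  rw [Function.comp_apply, hTL] at h2
  have h4 : 1 - μ u * conj c ≠ 0 := h3.2
  have h5 : p (L u) = (μ u - c) / (1 - μ u * conj c) * q (L u) := by rw [hpq, h2]
  have hLd : HasFDerivAt L (wirtinger 1 c) u := by
    exact ((wirtinger 1 c).hasFDerivAt (x := u - u₀)).comp u
      ((hasFDerivAt_id u).sub_const u₀)
  constructor
  · refine ((hw (L u)).comp u hLd).congr_fderiv ?_
    rw [wirtinger_comp, h5]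
    congr 1
    · simp
    · simp
      field_simp
      ring
  · rw [h5]
    have h6 : q (L u) + (μ u - c) / (1 - μ u * conj c) * q (L u) * conj c =
        (1 - c * conj c) / (1 - μ u * conj c) * q (L u) := by
      field_simp
      ring
    rw [h6]
    exact mul_ne_zero (div_ne_zero hcc h4) (hq0 _)

theorem mul_conj_sub_ne_zero {α β : ℂ} (h : ‖β‖ < ‖α‖) : α * conj α - β * conj β ≠ 0 := by
  rw [Complex.mul_conj, Complex.mul_conj, Complex.normSq_eq_norm_sq, Complex.normSq_eq_norm_sq]
  intro h0
  have h1 : ‖α‖ ^ 2 - ‖β‖ ^ 2 = 0 := by exact_mod_cast h0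
  nlinarith [norm_nonneg β]

/-- An orientation preserving real-linear map `v ↦ α v + β v̄` as an equivalence. -/
def wirtingerEquiv (α β : ℂ) (h : ‖β‖ < ‖α‖) : ℂ ≃L[ℝ] ℂ :=
  ContinuousLinearEquiv.equivOfInverse (wirtinger α β)
    (wirtinger (conj α / (α * conj α - β * conj β)) (-β / (α * conj α - β * conj β)))
    (fun v => by
      have h2 := mul_conj_sub_ne_zero h
      simp only [wirtinger_apply, map_add, map_mul, Complex.conj_conj, div_mul_eq_mul_div]
      rw [← add_div, ← add_div, ← add_div, div_eq_iff h2]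
      ring)
    (fun v => by
      have := mul_conj_sub_ne_zero h
      have h2 : conj α * α - conj β * β ≠ 0 := by rwa [mul_comm, mul_comm (conj β)]
      simp only [wirtinger_apply, map_add, map_mul, map_div₀, map_sub, map_neg, Complex.conj_conj]
      rw [mul_comm (conj α) α, mul_comm (conj β) β]
      field_simp
      ring)

@[simp] theorem coe_wirtingerEquiv (α β : ℂ) (h : ‖β‖ < ‖α‖) :
    (wirtingerEquiv α β h : ℂ →L[ℝ] ℂ) = wirtinger α β := rfl

/-- A ball as target is convex, so holomorphic functions on it obey the identity theorem and are
constant if their derivative vanishes. -/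
theorem OpenPartialHomeomorph.exists_restr_target_eq_ball {X : Type*} [TopologicalSpace X]
    (e : OpenPartialHomeomorph X ℂ) {x : X} (hx : x ∈ e.source) (h0 : e x = 0) {O : Set X}
    (hO : IsOpen O) (hxO : x ∈ O) :
    ∃ e' : OpenPartialHomeomorph X ℂ, (e' : X → ℂ) = e ∧ (e'.symm : ℂ → X) = e.symm ∧
      x ∈ e'.source ∧ e'.source ⊆ e.source ∩ O ∧ ∃ R > 0, e'.target = Metric.ball 0 R := by
  set e₁ := e.restrOpen O hO with he₁
  have hs : e₁.source = e.source ∩ O := e.restrOpen_source O hO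
  have hx₁ : x ∈ e₁.source := by rw [hs]; exact ⟨hx, hxO⟩
  have h1 : (0 : ℂ) ∈ e₁.target := by
    have := e₁.map_source hx₁
    rwa [show e₁ x = 0 from h0] at this
  obtain ⟨R, hR, hRt⟩ := Metric.isOpen_iff.1 e₁.open_target 0 h1
  refine ⟨(e₁.symm.restrOpen (Metric.ball 0 R) Metric.isOpen_ball).symm, rfl, rfl, ?_, ?_, R, hR, ?_⟩
  · refine (⟨hx₁, ?_⟩ : x ∈ e₁.source ∩ e ⁻¹' Metric.ball 0 R)
    rw [mem_preimage, h0]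
    exact Metric.mem_ball_self hR
  · rw [← hs]
    exact (inter_subset_left : e₁.source ∩ e ⁻¹' Metric.ball 0 R ⊆ e₁.source)
  · rw [OpenPartialHomeomorph.symm_target, OpenPartialHomeomorph.restrOpen_source]
    exact inter_eq_right.2 hRt

/-! ### Isothermal coordinates for the divergence form equation -/

/-- Here `(p, q)` is the gradient of `f`, and `F = f + i g` has `dg = -(b p + d q) dx + (a p + b q)
dy`. Then `A = ∂F`, and `det = 1` is what makes `∂̄F` equal to `μ A` with `μ` independent of `p` and
`q`. The three identities compute `∂F/∂x`, `∂F/∂y` and the flux. -/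
theorem conjugate_differential_identities {a b d p q : ℝ} (hdet : a * d - b * b = 1)
    (hpos : 0 < 2 + a + d) :
    let A : ℂ := (((1 + a) * p + b * q : ℝ) - ((b * p + (1 + d) * q : ℝ) : ℂ) * Complex.I) / 2
    let μ : ℂ := ((d - a : ℝ) - (2 * b : ℝ) * Complex.I) / (2 + a + d : ℝ)
    A + μ * A = p - (b * p + d * q : ℝ) * Complex.I ∧
    (A - μ * A) * Complex.I = q + (a * p + b * q : ℝ) * Complex.I ∧
    conj A - μ * A = (a * p + b * q : ℝ) + (b * p + d * q : ℝ) * Complex.I := by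
  intro A μ
  have hne : ((2 + a + d : ℝ) : ℂ) ≠ 0 := by exact_mod_cast hpos.ne'
  have hμA : μ * A = (((1 - a) * p - b * q : ℝ) + (((1 - d) * q - b * p : ℝ) : ℂ) * Complex.I) / 2 := by
    simp only [A, μ]
    rw [div_mul_div_comm, div_eq_div_iff (by simpa using hne) two_ne_zero]
    apply Complex.ext
    · simp
      linear_combination (4 * p) * hdet
    · simp
      linear_combination (4 * q) * hdet
  rw [hμA]
  refine ⟨?_, ?_, ?_⟩ <;> apply Complex.ext <;> simp [A, Complex.conj_ofNat] <;> ring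

/-- By `det = 1` the squared norm of the numerator is `(a + d)² - 4`. -/
theorem norm_beltramiCoefficient_lt_one {a b d : ℝ} (hdet : a * d - b * b = 1)
    (hpos : 0 < a + d) :
    ‖((d - a : ℝ) - (2 * b : ℝ) * Complex.I) / ((2 + a + d : ℝ) : ℂ)‖ < 1 := by
  have h2 : 0 < 2 + a + d := by linarith
  rw [norm_div, div_lt_one (by rw [norm_pos_iff]; exact_mod_cast h2.ne')]
  refine lt_of_pow_lt_pow_left₀ 2 (norm_nonneg _) ?_
  rw [← Complex.normSq_eq_norm_sq, ← Complex.normSq_eq_norm_sq, Complex.normSq_apply,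
    Complex.normSq_apply]
  simp
  nlinarith

section

/-- The vector field `A ∇f` of the coefficient matrix `A = !![a, b; b, d]`, as a complex number. -/
def fluxField (a b d f : ℂ → ℝ) (u : ℂ) : ℂ :=
  (a u * fderiv ℝ f u 1 + b u * fderiv ℝ f u Complex.I : ℝ) +
    (b u * fderiv ℝ f u 1 + d u * fderiv ℝ f u Complex.I : ℝ) * Complex.I

/-- `f` solves the elliptic equation `div (A ∇f) = 0` on `N`, with smooth symmetric coefficients
`A = !![a, b; b, d]` of determinant one. -/
structure IsDivFormHarmonic (a b d f : ℂ → ℝ) (N : Set ℂ) : Prop where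
  isOpen : IsOpen N
  smooth_a : ContDiffOn ℝ ∞ a N
  smooth_b : ContDiffOn ℝ ∞ b N
  smooth_d : ContDiffOn ℝ ∞ d N
  smooth : ContDiffOn ℝ ∞ f N
  det : ∀ u ∈ N, a u * d u - b u * b u = 1
  trace_pos : ∀ u ∈ N, 0 < a u + d u
  div_eq_zero : ∀ u ∈ N,
    fderiv ℝ (fun u => a u * fderiv ℝ f u 1 + b u * fderiv ℝ f u Complex.I) u 1 +
    fderiv ℝ (fun u => b u * fderiv ℝ f u 1 + d u * fderiv ℝ f u Complex.I) u Complex.I = 0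

theorem realLinear_apply_eq {E : Type*} [NormedAddCommGroup E] [NormedSpace ℝ E]
    (L : ℂ →L[ℝ] E) (v : ℂ) : L v = v.re • L 1 + v.im • L Complex.I := by
  conv_lhs => rw [← Complex.re_add_im v]
  rw [map_add, ← map_smul, ← map_smul]
  simp

namespace IsDivFormHarmonic

variable {a b d f : ℂ → ℝ} {N : Set ℂ}

theorem contDiffOn_fderiv_apply (h : IsDivFormHarmonic a b d f N) (v : ℂ) :
    ContDiffOn ℝ ∞ (fun u => fderiv ℝ f u v) N :=
  (h.smooth.fderiv_of_isOpen h.isOpen (by simp)).clm_apply contDiffOn_const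

/-- The flux `A ∇f` is divergence free, so the one-form obtained by rotating it is closed, hence
exact on a convex set. -/
theorem exists_conjugate (h : IsDivFormHarmonic a b d f N) {s : Set ℂ} (hs : Convex ℝ s)
    (hso : IsOpen s) (hsN : s ⊆ N) :
    ∃ g : ℂ → ℝ, ∀ u ∈ s, HasFDerivAt g
      (-(b u * fderiv ℝ f u 1 + d u * fderiv ℝ f u Complex.I) • Complex.reCLM +
        (a u * fderiv ℝ f u 1 + b u * fderiv ℝ f u Complex.I) • Complex.imCLM) u := by
  set P : ℂ → ℝ := fun u => a u * fderiv ℝ f u 1 + b u * fderiv ℝ f u Complex.I with hP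
  set Q : ℂ → ℝ := fun u => b u * fderiv ℝ f u 1 + d u * fderiv ℝ f u Complex.I with hQ
  have h1 := h.contDiffOn_fderiv_apply 1
  have h2 := h.contDiffOn_fderiv_apply Complex.I
  have hPd : ∀ u ∈ s, DifferentiableAt ℝ P u := fun u hu =>
    (((h.smooth_a.mul h1).add (h.smooth_b.mul h2)).contDiffAt
      (h.isOpen.mem_nhds (hsN hu))).differentiableAt (by simp)
  have hQd : ∀ u ∈ s, DifferentiableAt ℝ Q u := fun u hu =>
    (((h.smooth_b.mul h1).add (h.smooth_d.mul h2)).contDiffAt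
      (h.isOpen.mem_nhds (hsN hu))).differentiableAt (by simp)
  have hω : ∀ u ∈ s, HasFDerivAt (fun u => -Q u • Complex.reCLM + P u • Complex.imCLM)
      ((-fderiv ℝ Q u).smulRight Complex.reCLM + (fderiv ℝ P u).smulRight Complex.imCLM) u :=
    fun u hu => HasFDerivAt.add (HasFDerivAt.smul_const (hQd u hu).hasFDerivAt.neg Complex.reCLM)
      (HasFDerivAt.smul_const (hPd u hu).hasFDerivAt Complex.imCLM)
  refine hs.exists_forall_hasFDerivAt_of_fderiv_symmetric hso
    (fun u hu => (hω u hu).differentiableAt.differentiableWithinAt) fun u hu x y => ?_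
  have h0 := h.div_eq_zero u (hsN hu)
  rw [(hω u hu).fderiv]
  simp only [add_apply, ContinuousLinearMap.smulRight_apply, neg_apply, smul_apply,
    Complex.reCLM_apply, Complex.imCLM_apply, smul_eq_mul]
  rw [realLinear_apply_eq (fderiv ℝ Q u) x, realLinear_apply_eq (fderiv ℝ Q u) y,
    realLinear_apply_eq (fderiv ℝ P u) x, realLinear_apply_eq (fderiv ℝ P u) y]
  simp only [smul_eq_mul]
  linear_combination (x.re * y.im - x.im * y.re) * h0

/-- The Beltrami coefficient of the complex structure in which `f` is harmonic. -/
def beltramiCoefficient (a b d : ℂ → ℝ) (u : ℂ) : ℂ :=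
  ((d u - a u : ℝ) - (2 * b u : ℝ) * Complex.I) / (2 + a u + d u : ℝ)

theorem contDiffOn_beltramiCoefficient (h : IsDivFormHarmonic a b d f N) :
    ContDiffOn ℝ ∞ (beltramiCoefficient a b d) N := by
  have hre : ∀ g : ℂ → ℝ, ContDiffOn ℝ ∞ g N → ContDiffOn ℝ ∞ (fun u => (g u : ℂ)) N :=
    fun g hg => Complex.ofRealCLM.contDiff.comp_contDiffOn hg
  unfold beltramiCoefficient
  simp only [div_eq_mul_inv]
  refine ContDiffOn.mul ((hre _ (h.smooth_d.sub h.smooth_a)).sub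
    ((hre _ (contDiffOn_const.mul h.smooth_b)).mul contDiffOn_const))
    ((hre _ ((contDiffOn_const.add h.smooth_a).add h.smooth_d)).inv fun u hu => ?_)
  have := h.trace_pos u hu
  have h2 : 0 < 2 + a u + d u := by linarith
  exact_mod_cast h2.ne'

/-- `F` is `f` plus `i` times its conjugate function; it is holomorphic for the complex structure of
the coefficient matrix, and the flux can be recovered from its differential. -/
theorem exists_holomorphic_primitive (h : IsDivFormHarmonic a b d f N) {s : Set ℂ}
    (hs : Convex ℝ s) (hso : IsOpen s) (hsN : s ⊆ N) :
    ∃ F A : ℂ → ℂ, (∀ u, (F u).re = f u) ∧ ∀ u ∈ s,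
      HasFDerivAt F (wirtinger (A u) (beltramiCoefficient a b d u * A u)) u ∧
      fluxField a b d f u = conj (A u) - beltramiCoefficient a b d u * A u := by
  obtain ⟨g, hg⟩ := h.exists_conjugate hs hso hsN
  refine ⟨fun u => f u + g u * Complex.I, fun u => (((1 + a u) * fderiv ℝ f u 1 +
    b u * fderiv ℝ f u Complex.I : ℝ) - ((b u * fderiv ℝ f u 1 +
      (1 + d u) * fderiv ℝ f u Complex.I : ℝ) : ℂ) * Complex.I) / 2, fun u => by simp,
    fun u hu => ?_⟩
  have htr := h.trace_pos u (hsN hu)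
  obtain ⟨e1, e2, e3⟩ := conjugate_differential_identities (p := fderiv ℝ f u 1)
    (q := fderiv ℝ f u Complex.I) (h.det u (hsN hu)) (by linarith)
  have hf : HasFDerivAt f (fderiv ℝ f u) u :=
    ((h.smooth.contDiffAt (h.isOpen.mem_nhds (hsN hu))).differentiableAt (by simp)).hasFDerivAt
  refine ⟨?_, ?_⟩
  · have h1 := (Complex.ofRealCLM.hasFDerivAt.comp u hf).add
      ((Complex.ofRealCLM.hasFDerivAt.comp u (hg u hu)).mul_const Complex.I)
    refine h1.congr_fderiv (ContinuousLinearMap.ext fun v => ?_)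
    rw [realLinear_apply_eq _ v, realLinear_apply_eq (wirtinger _ _) v]
    congr 1
    · refine congrArg (v.re • ·) ?_
      rw [wirtinger_apply]
      refine Eq.trans ?_ (e1.symm.trans (by simp only [beltramiCoefficient, mul_one,
        map_one (starRingEnd ℂ)]))
      simp
      ring
    · refine congrArg (v.im • ·) ?_
      rw [wirtinger_apply, Complex.conj_I]
      refine Eq.trans ?_ (e2.symm.trans (by simp only [beltramiCoefficient]; ring))
      simp
      ring
  · exact e3.symm

/-- Isothermal coordinates for `div (A ∇f) = 0`. -/
theorem exists_isothermal (h : IsDivFormHarmonic a b d f N) {u₀ : ℂ} (hu : u₀ ∈ N) :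
    ∃ (w : OpenPartialHomeomorph ℂ ℂ) (α β Φ : ℂ → ℂ) (R : ℝ), 0 < R ∧ u₀ ∈ w.source ∧
      w.source ⊆ N ∧ w u₀ = 0 ∧ w.target = Metric.ball 0 R ∧
      ContinuousOn α w.source ∧ ContinuousOn β w.source ∧
      DifferentiableOn ℂ Φ (Metric.ball 0 R) ∧ ∀ u ∈ w.source, ‖β u‖ < ‖α u‖ ∧
        HasFDerivAt w (wirtinger (α u) (β u)) u ∧ f u = (Φ (w u)).re ∧
        fluxField a b d f u = conj (deriv Φ (w u) * α u) - deriv Φ (w u) * β u := by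
  set μ := beltramiCoefficient a b d with hμ
  have hμs := h.contDiffOn_beltramiCoefficient
  have hμ1 : ∀ u ∈ N, ‖μ u‖ < 1 := fun u hu =>
    norm_beltramiCoefficient_lt_one (h.det u hu) (h.trace_pos u hu)
  obtain ⟨w₀, α, hα, hw₀⟩ := exists_hasFDerivAt_beltrami h.isOpen hμs hu (hμ1 u₀ hu)
  set w₁ : ℂ → ℂ := fun u => w₀ u - w₀ u₀ with hw₁
  have hlt : ∀ u ∈ N, α u ≠ 0 → ‖μ u * α u‖ < ‖α u‖ := fun u hu h0 => by
    rw [norm_mul]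
    exact mul_lt_of_lt_one_left (norm_pos_iff.2 h0) (hμ1 u hu)
  -- The solution is differentiable nearby with continuous derivative, which is all the inverse
  -- function theorem needs.
  have hstrict : HasStrictFDerivAt w₁ (wirtinger (α u₀) (μ u₀ * α u₀)) u₀ := by
    refine hasStrictFDerivAt_of_hasFDerivAt_of_continuousAt
      (f' := fun u => wirtinger (α u) (μ u * α u)) ?_ ?_
    · filter_upwards [hw₀] with u hu using hu.1.sub_const _
    · exact continuous_wirtinger.continuousAt.comp (hα.continuousAt.prodMk
        ((hμs.continuousOn.continuousAt (h.isOpen.mem_nhds hu)).mul hα.continuousAt))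
  have hα0 : α u₀ ≠ 0 := hw₀.self_of_nhds.2
  rw [← coe_wirtingerEquiv _ _ (hlt u₀ hu hα0)] at hstrict
  obtain ⟨ε, hε, hεN⟩ := Metric.mem_nhds_iff.1 (inter_mem hw₀ (h.isOpen.mem_nhds hu))
  obtain ⟨w, hwc, -, hws, hwO, R, hR, hwt⟩ :=
    (hstrict.toOpenPartialHomeomorph w₁).exists_restr_target_eq_ball
      hstrict.mem_toOpenPartialHomeomorph_source
      (by rw [hstrict.toOpenPartialHomeomorph_coe]; simp [hw₁])
      Metric.isOpen_ball (Metric.mem_ball_self hε)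
  rw [hstrict.toOpenPartialHomeomorph_coe] at hwc
  have hin : ∀ u ∈ w.source, u ∈ Metric.ball u₀ ε := fun u hu => (hwO hu).2
  have hgood : ∀ u ∈ w.source, HasFDerivAt w (wirtinger (α u) (μ u * α u)) u ∧ α u ≠ 0 :=
    fun u hu => by
      have := (hεN (hin u hu)).1
      rw [hwc]
      exact ⟨this.1.sub_const _, this.2⟩
  have hsN : w.source ⊆ N := fun u hu => (hεN (hin u hu)).2
  obtain ⟨F, A, hFf, hF⟩ := h.exists_holomorphic_primitive (convex_ball u₀ ε) Metric.isOpen_ball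
    (fun u hu => (hεN hu).2)
  -- `F` and `w` satisfy the same Beltrami equation, so `dF = (A / α) dw` with a complex factor;
  -- hence `F ∘ w⁻¹` is complex differentiable.
  have hΦ : ∀ ζ ∈ w.target, HasDerivAt (F ∘ w.symm) (A (w.symm ζ) / α (w.symm ζ)) ζ := by
    intro ζ hζ
    have hu := w.map_target hζ
    set u := w.symm ζ with hu'
    have hl := hlt u (hsN hu) (hgood u hu).2
    have h1 : HasFDerivAt w.symm ((wirtingerEquiv _ _ hl).symm : ℂ →L[ℝ] ℂ) ζ :=
      w.hasFDerivAt_symm hζ (hgood u hu).1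
    have h2 := (hF u (hin u hu)).1.comp ζ h1
    refine hasFDerivAt_of_restrictScalars ℝ h2 (ContinuousLinearMap.ext fun v => ?_)
    obtain ⟨v', rfl⟩ := (wirtingerEquiv _ _ hl).surjective v
    have hα' := (hgood u hu).2
    have h3 : (wirtingerEquiv _ _ hl) v' = α u * v' + μ u * α u * conj v' :=
      wirtinger_apply _ _ _
    have h4 : ((wirtinger (A u) (μ u * A u)).comp
        ((wirtingerEquiv _ _ hl).symm : ℂ →L[ℝ] ℂ)) ((wirtingerEquiv _ _ hl) v') =
        A u * v' + μ u * A u * conj v' := by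
      rw [ContinuousLinearMap.comp_apply, ContinuousLinearEquiv.coe_coe,
        ContinuousLinearEquiv.symm_apply_apply, wirtinger_apply]
    rw [h4, ContinuousLinearMap.coe_restrictScalars', ContinuousLinearMap.toSpanSingleton_apply, h3,
      smul_eq_mul]
    field_simp
  refine ⟨w, α, fun u => μ u * α u, F ∘ w.symm, R, hR, hws, hsN, by rw [hwc]; simp [hw₁], hwt,
    hα.continuousOn, (hμs.continuousOn.mono hsN).mul hα.continuousOn,
    fun ζ hζ => (hΦ ζ (hwt ▸ hζ)).differentiableAt.differentiableWithinAt, fun u hu =>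
      ⟨hlt u (hsN hu) (hgood u hu).2, (hgood u hu).1, ?_, ?_⟩⟩
  · rw [Function.comp_apply, w.left_inv hu, hFf]
  · have h1 := hΦ (w u) (w.map_source hu)
    rw [w.left_inv hu] at h1
    have hα' := (hgood u hu).2
    rw [h1.deriv, (hF u (hin u hu)).2, div_mul_cancel₀ _ hα', ← hμ]
    field_simp

end IsDivFormHarmonic

end

section

/-! ### The power normal form -/

/-- A nonconstant holomorphic function is a power of a local coordinate, up to a constant. -/
theorem AnalyticAt.exists_coordinate_pow {Φ : ℂ → ℂ} (hΦ : AnalyticAt ℂ Φ 0)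
    (hne : ¬ ∀ᶠ z in 𝓝 0, Φ z = Φ 0) :
    ∃ (m : ℕ) (ψ : OpenPartialHomeomorph ℂ ℂ), 1 ≤ m ∧ 0 ∈ ψ.source ∧ ψ 0 = 0 ∧
      ContinuousOn (deriv ψ) ψ.source ∧ ∀ z ∈ ψ.source, DifferentiableAt ℂ ψ z ∧ deriv ψ z ≠ 0 ∧
        Φ z = Φ 0 + ψ z ^ m ∧ deriv Φ z = m * ψ z ^ (m - 1) * deriv ψ z := by
  have hΦ' : AnalyticAt ℂ (fun z => Φ z - Φ 0) 0 := hΦ.sub analyticAt_const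
  obtain ⟨m, G, hG, hG0, hΦG⟩ := hΦ'.exists_eventuallyEq_pow_smul_nonzero_iff.2
    (by simpa [sub_eq_zero] using hne)
  have hm : m ≠ 0 := by
    rintro rfl
    have h := hΦG.self_of_nhds
    simp at h
    exact hG0 h.symm
  obtain ⟨c, hc⟩ := IsAlgClosed.exists_pow_nat_eq (G 0) (Nat.pos_of_ne_zero hm)
  have hc0 : c ≠ 0 := by
    rintro rfl
    rw [zero_pow hm] at hc
    exact hG0 hc.symm
  -- An analytic `m`-th root of `G`. Dividing by `G 0` places the argument of the logarithm near
  -- `1`, away from the branch cut.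
  set H : ℂ → ℂ := fun z => c * Complex.exp (Complex.log (G z / G 0) / m) with hH
  have hGd : AnalyticAt ℂ (fun z => G z / G 0) 0 := hG.div analyticAt_const hG0
  have hHan : AnalyticAt ℂ H 0 := by
    refine analyticAt_const.mul (AnalyticAt.cexp ?_)
    refine (hGd.clog ?_).div analyticAt_const (by exact_mod_cast hm)
    simp [hG0]
  have hHpow : ∀ᶠ z in 𝓝 0, H z ^ m = G z := by
    filter_upwards [hG.continuousAt.eventually_ne hG0] with z hz
    have hm' : (m : ℂ) ≠ 0 := by exact_mod_cast hm
    simp only [hH]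
    rw [mul_pow, hc, ← Complex.exp_nat_mul, mul_div_cancel₀ _ hm',
      Complex.exp_log (div_ne_zero hz hG0), mul_div_cancel₀ _ hG0]
  set p : ℂ → ℂ := fun z => z * H z with hp
  have hpan : AnalyticAt ℂ p 0 := analyticAt_id.mul hHan
  have hp0 : p 0 = 0 := by simp [hp]
  have hd : deriv p 0 = H 0 := by
    have h1 := (hasDerivAt_id (0 : ℂ)).mul hHan.differentiableAt.hasDerivAt
    have h2 : deriv p 0 = 1 * H 0 + 0 * deriv H 0 := h1.deriv
    simpa using h2
  have hH0 : H 0 ≠ 0 := mul_ne_zero hc0 (Complex.exp_ne_zero _)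
  have hΦp : ∀ᶠ z in 𝓝 0, Φ z = Φ 0 + p z ^ m := by
    filter_upwards [hΦG, hHpow] with z h1 h2
    have : Φ z = Φ 0 + (Φ z - Φ 0) := by ring
    rw [this, h1, ← h2]
    simp [hp, mul_pow]
  have hev : ∀ᶠ z in 𝓝 0, AnalyticAt ℂ p z ∧ deriv p z ≠ 0 ∧ Φ z = Φ 0 + p z ^ m ∧
      deriv Φ z = m * p z ^ (m - 1) * deriv p z := by
    filter_upwards [hpan.eventually_analyticAt,
      hpan.deriv.continuousAt.eventually_ne (by rw [hd]; exact hH0), hΦp,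
      hΦp.eventually_nhds] with z h1 h2 h3 h4
    refine ⟨h1, h2, h3, ?_⟩
    rw [EventuallyEq.deriv_eq h4]
    exact ((h1.differentiableAt.hasDerivAt.pow m).const_add (Φ 0)).deriv
  obtain ⟨O, hO, hOo, h0O⟩ := eventually_nhds_iff.1 hev
  have hst : HasStrictDerivAt p (deriv p 0) 0 := hpan.hasStrictDerivAt
  have hst' := hst.hasStrictFDerivAt_equiv (by rw [hd]; exact hH0)
  obtain ⟨ψ, hψc, -, hψs, hψO, -⟩ :=
    (hst'.toOpenPartialHomeomorph p).exists_restr_target_eq_ball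
      hst'.mem_toOpenPartialHomeomorph_source
      (by rw [hst'.toOpenPartialHomeomorph_coe, hp0]) hOo h0O
  rw [hst'.toOpenPartialHomeomorph_coe] at hψc
  refine ⟨m, ψ, Nat.pos_of_ne_zero hm, hψs, by rw [hψc, hp0], ?_, fun z hz => ?_⟩
  · rw [hψc]
    exact fun z hz => ((hO z (hψO hz).2).1.deriv.continuousAt).continuousWithinAt
  · rw [hψc]
    obtain ⟨h1, h2⟩ := hO z (hψO hz).2
    exact ⟨h1.differentiableAt, h2⟩

/-- Coordinates `w` centered at `u₀` in which `f` is, up to a constant, the real part of `w ^ m`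
and the vector field `V` is a positive multiple of its gradient. -/
structure PowerNormalForm (f : ℂ → ℝ) (V : ℂ → ℂ) (u₀ : ℂ) (m : ℕ) where
  w : OpenPartialHomeomorph ℂ ℂ
  α : ℂ → ℂ
  β : ℂ → ℂ
  one_le : 1 ≤ m
  mem_source : u₀ ∈ w.source
  map_center : w u₀ = 0
  continuousOn_α : ContinuousOn α w.source
  continuousOn_β : ContinuousOn β w.source
  norm_lt : ∀ u ∈ w.source, ‖β u‖ < ‖α u‖
  hasFDerivAt : ∀ u ∈ w.source, HasFDerivAt w (wirtinger (α u) (β u)) u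
  eq_re : ∀ u ∈ w.source, f u = f u₀ + (w u ^ m).re
  field_eq : ∀ u ∈ w.source,
    V u = conj (m * w u ^ (m - 1) * α u) - m * w u ^ (m - 1) * β u

namespace IsDivFormHarmonic

variable {a b d f : ℂ → ℝ} {N : Set ℂ}

/-- The isothermal coordinate is followed by the holomorphic coordinate in which `Φ` is a pure
power; this multiplies both `α` and `β` by the same derivative and so keeps `‖β‖ < ‖α‖`. -/
theorem exists_powerNormalForm (h : IsDivFormHarmonic a b d f N) {u₀ : ℂ} (hu : u₀ ∈ N)
    (hne : ¬ ∀ᶠ u in 𝓝 u₀, f u = f u₀) :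
    ∃ m, Nonempty (PowerNormalForm f (fluxField a b d f) u₀ m) := by
  obtain ⟨w, α, β, Φ, R, hR, hws, hsN, hw0, hwt, hα, hβ, hΦ, hw⟩ := h.exists_isothermal hu
  have hΦan : AnalyticAt ℂ Φ 0 := hΦ.analyticAt (Metric.ball_mem_nhds 0 hR)
  have hΦne : ¬ ∀ᶠ z in 𝓝 0, Φ z = Φ 0 := by
    intro hc
    have h1 : Tendsto w (𝓝 u₀) (𝓝 0) := hw0 ▸ (w.continuousAt hws)
    refine hne ?_
    filter_upwards [h1.eventually hc, w.open_source.mem_nhds hws] with u h2 h3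
    rw [(hw u h3).2.2.1, (hw u₀ hws).2.2.1, h2, hw0]
  obtain ⟨m, ψ, hm, hψs, hψ0, hψc, hψ⟩ := hΦan.exists_coordinate_pow hΦne
  have hsub : (w.trans ψ).source = w.source ∩ w ⁻¹' ψ.source := w.trans_source ψ
  have hs1 : ∀ u ∈ (w.trans ψ).source, u ∈ w.source := fun u hu => by
    rw [hsub] at hu; exact hu.1
  have hs2 : ∀ u ∈ (w.trans ψ).source, w u ∈ ψ.source := fun u hu => by
    rw [hsub] at hu; exact hu.2
  have hcomp : ContinuousOn (fun u => deriv ψ (w u)) (w.trans ψ).source :=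
    hψc.comp (w.continuousOn.mono hs1) hs2
  refine ⟨m, ⟨⟨w.trans ψ, fun u => deriv ψ (w u) * α u, fun u => deriv ψ (w u) * β u, hm, ?_, ?_,
    hcomp.mul (hα.mono hs1), hcomp.mul (hβ.mono hs1), ?_, ?_, ?_, ?_⟩⟩⟩
  · rw [hsub]
    exact ⟨hws, by rw [mem_preimage, hw0]; exact hψs⟩
  · rw [OpenPartialHomeomorph.coe_trans, Function.comp_apply, hw0, hψ0]
  · intro u hu
    rw [norm_mul, norm_mul]
    exact mul_lt_mul_of_pos_left (hw u (hs1 u hu)).1 (norm_pos_iff.2 (hψ _ (hs2 u hu)).2.1)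
  · intro u hu
    have h1 := ((hψ _ (hs2 u hu)).1.hasDerivAt.hasFDerivAt.restrictScalars ℝ).comp u
      (hw u (hs1 u hu)).2.1
    refine h1.congr_fderiv (ContinuousLinearMap.ext fun v => ?_)
    simp
    ring
  · intro u hu
    rw [(hw u (hs1 u hu)).2.2.1, (hw u₀ hws).2.2.1, hw0, (hψ _ (hs2 u hu)).2.2.1, Complex.add_re]
    rfl
  · intro u hu
    rw [(hw u (hs1 u hu)).2.2.2, (hψ _ (hs2 u hu)).2.2.2, OpenPartialHomeomorph.coe_trans,
      Function.comp_apply]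
    congr 1
    · congr 1
      ring
    · ring

theorem fluxField_eq_zero_of_fderiv_eq_zero {a b d f : ℂ → ℝ} {u : ℂ} (h : fderiv ℝ f u = 0) :
    fluxField a b d f u = 0 := by
  simp [fluxField, h]

/-- Unique continuation. -/
theorem exists_nhds_unique_continuation (h : IsDivFormHarmonic a b d f N) {u₀ : ℂ} (hu : u₀ ∈ N) :
    ∃ O ∈ 𝓝 u₀, ∀ u₁ ∈ O, (∀ᶠ u in 𝓝 u₁, f u = f u₁) → ∀ᶠ u in 𝓝 u₀, f u = f u₀ := by
  obtain ⟨w, α, β, Φ, R, hR, hws, hsN, hw0, hwt, hα, hβ, hΦ, hw⟩ := h.exists_isothermal hu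
  refine ⟨w.source, w.open_source.mem_nhds hws, fun u₁ hu₁ hc => ?_⟩
  have hΦ' : DifferentiableOn ℂ (deriv Φ) (Metric.ball 0 R) := hΦ.deriv Metric.isOpen_ball
  -- The two terms of the flux have norms `‖Φ'‖ ‖α‖` and `‖Φ'‖ ‖β‖`, so they cancel only where `Φ' =
  -- 0`.
  have h0 : ∀ u ∈ w.source, fluxField a b d f u = 0 → deriv Φ (w u) = 0 := fun u hu hV => by
    by_contra hne
    have h1 := (hw u hu).2.2.2
    rw [hV, eq_comm, sub_eq_zero] at h1
    have h2 := congrArg norm h1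
    rw [RCLike.norm_conj, norm_mul, norm_mul] at h2
    exact (hw u hu).1.ne' (mul_left_cancel₀ (norm_ne_zero_iff.2 hne) h2)
  have hV : ∀ᶠ u in 𝓝 u₁, fluxField a b d f u = 0 := by
    filter_upwards [hc.eventually_nhds] with u hu
    refine fluxField_eq_zero_of_fderiv_eq_zero ?_
    have : f =ᶠ[𝓝 u] fun _ => f u₁ := hu
    rw [this.fderiv_eq]
    simp
  have hwu₁ : w u₁ ∈ Metric.ball (0 : ℂ) R := hwt ▸ w.map_source hu₁
  have hd : deriv Φ =ᶠ[𝓝 (w u₁)] 0 := by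
    have h1 : Tendsto w.symm (𝓝 (w u₁)) (𝓝 u₁) := w.tendsto_symm hu₁
    filter_upwards [h1.eventually hV, w.open_target.mem_nhds (w.map_source hu₁)] with ζ h2 h3
    have := h0 _ (w.map_target h3) h2
    rwa [w.right_inv h3] at this
  have hd0 : EqOn (deriv Φ) 0 (Metric.ball 0 R) :=
    (hΦ'.analyticOnNhd Metric.isOpen_ball).eqOn_zero_of_preconnected_of_eventuallyEq_zero
      (convex_ball 0 R).isPreconnected hwu₁ hd
  filter_upwards [w.open_source.mem_nhds hws] with u hu
  rw [(hw u hu).2.2.1, (hw u₀ hws).2.2.1, hw0]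
  congr 1
  exact Metric.isOpen_ball.is_const_of_deriv_eq_zero (convex_ball (0 : ℂ) R).isPreconnected hΦ hd0
    (hwt ▸ w.map_source hu) (Metric.mem_ball_self hR)

end IsDivFormHarmonic

end

section

/-! ### The winding number of the field -/

/-- The identification of the coordinate plane with the complex plane. -/
def planeEquiv : Plane ≃ₗᵢ[ℝ] ℂ := Complex.orthonormalBasisOneI.repr.symm

theorem planeEquiv_apply (v : Plane) : planeEquiv v = v 0 + v 1 * Complex.I := by
  rw [planeEquiv, ← Complex.orthonormalBasisOneI.sum_repr_symm v]
  simp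

theorem planeEquiv_basisVec_zero : planeEquiv (basisVec 0) = 1 := by
  simp [planeEquiv_apply, basisVec]

theorem planeEquiv_basisVec_one : planeEquiv (basisVec 1) = Complex.I := by
  simp [planeEquiv_apply, basisVec]

theorem planeEquiv_circlePt (θ : ℝ) : planeEquiv (circlePt θ) = Complex.exp (θ * Complex.I) := by
  simp [planeEquiv_apply, circlePt, Complex.exp_mul_I]

theorem hasWindingNumber_of_planeEquiv_eq {c : ℝ → Plane} {n : ℤ} {ρ η : ℝ → ℝ}
    (hρ : ∀ θ, 0 < ρ θ) (hη : Continuous η) (hper : η (2 * Real.pi) = η 0)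
    (hc : ∀ θ, planeEquiv (c θ) = ρ θ * Complex.exp ((n * θ + η θ : ℝ) * Complex.I)) :
    HasWindingNumber c n := by
  have hnorm : ∀ θ, ‖c θ‖ = ρ θ := fun θ => by
    rw [← planeEquiv.norm_map, hc, norm_mul, Complex.norm_exp_ofReal_mul_I, mul_one,
      Complex.norm_real, Real.norm_of_nonneg (hρ θ).le]
  refine ⟨fun θ h => ?_, fun θ => n * θ + η θ, by fun_prop, fun θ => ?_, ?_⟩
  · have := hnorm θ
    rw [h, norm_zero] at this
    exact (hρ θ).ne this
  · apply planeEquiv.injective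
    rw [hnorm, map_smul, planeEquiv_circlePt, hc]
    simp
  · beta_reduce
    rw [hper]
    ring

theorem eq_norm_mul_exp_arg (z : ℂ) : z = ‖z‖ * Complex.exp (z.arg * Complex.I) :=
  (Complex.norm_mul_exp_arg_mul_I z).symm

theorem mem_slitPlane_of_norm_sub_one_lt {z : ℂ} (h : ‖z - 1‖ < 1) : z ∈ Complex.slitPlane := by
  refine Or.inl ?_
  have h1 := Complex.abs_re_le_norm (z - 1)
  rw [Complex.sub_re, Complex.one_re] at h1
  linarith [(abs_le.1 h1).1]

namespace PowerNormalForm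

variable {f : ℂ → ℝ} {V : ℂ → ℂ} {u₀ : ℂ} {m : ℕ}

theorem field_ne_zero (h : PowerNormalForm f V u₀ m) {u : ℂ} (hu : u ∈ h.w.source)
    (hne : u ≠ u₀) : V u ≠ 0 := by
  intro hV
  have h1 := h.field_eq u hu
  rw [hV, eq_comm, sub_eq_zero] at h1
  have h2 := congrArg norm h1
  rw [RCLike.norm_conj, norm_mul _ (h.α u), norm_mul _ (h.β u)] at h2
  have hw : h.w u ≠ 0 := fun hw => hne (h.w.injOn hu h.mem_source (by rw [hw, h.map_center]))
  have hm : (m : ℂ) ≠ 0 := by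
    have := h.one_le
    exact_mod_cast (by omega : m ≠ 0)
  exact (h.norm_lt u hu).ne' (mul_left_cancel₀
    (norm_ne_zero_iff.2 (mul_ne_zero hm (pow_ne_zero _ hw))) h2)

/-- Pushed forward by `w`, the field is a positive multiple of `m conj w ^ (m - 1)`, the gradient of
`Re (w ^ m)`; the positive factor is the Jacobian of `w`. This is the only fact about the field that
the dynamics needs. -/
theorem wirtinger_field (h : PowerNormalForm f V u₀ m) {u : ℂ} (hu : u ∈ h.w.source) :
    wirtinger (h.α u) (h.β u) (V u) =
      (m * (‖h.α u‖ ^ 2 - ‖h.β u‖ ^ 2) : ℝ) * conj (h.w u) ^ (m - 1) := by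
  rw [h.field_eq u hu, wirtinger_apply]
  push_cast
  rw [← Complex.mul_conj', ← Complex.mul_conj']
  simp only [map_sub, map_mul, map_pow, map_natCast, Complex.conj_conj]
  ring

/-- The winding number of the field along small circles. -/
theorem eventually_field_circle (h : PowerNormalForm f V u₀ m) :
    ∀ᶠ r : ℝ in 𝓝[>] 0, (∀ θ : ℝ, u₀ + r * Complex.exp (θ * Complex.I) ∈ h.w.source) ∧
      ∃ ρ η : ℝ → ℝ, (∀ θ, 0 < ρ θ) ∧ Continuous η ∧ η (2 * Real.pi) = η 0 ∧
        ∀ θ : ℝ, V (u₀ + r * Complex.exp (θ * Complex.I)) =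
          ρ θ * Complex.exp (((1 - m : ℤ) * θ + η θ : ℝ) * Complex.I) := by
  have hs := h.w.open_source.mem_nhds h.mem_source
  have hα0 : h.α u₀ ≠ 0 := fun h0 => by
    have := h.norm_lt u₀ h.mem_source
    rw [h0, norm_zero] at this
    exact absurd this (norm_nonneg _).not_gt
  have hlt := h.norm_lt u₀ h.mem_source
  -- Half the gap, so that the Taylor remainder together with the `β` term stays below `‖α‖ r`.
  set δ : ℝ := (‖h.α u₀‖ - ‖h.β u₀‖) / 2 with hδ
  have hδ0 : 0 < δ := by rw [hδ]; linarith
  have hderiv := (hasFDerivAt_iff_isLittleO.1 (h.hasFDerivAt u₀ h.mem_source)).def hδ0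
  have hαc : ∀ᶠ u in 𝓝 u₀, ‖h.α u - h.α u₀‖ < ‖h.α u₀‖ := by
    have h1 := (h.continuousOn_α.continuousAt hs).sub_const (h.α u₀)
    have h2 := h1.norm.eventually (gt_mem_nhds (show ‖h.α u₀ - h.α u₀‖ < ‖h.α u₀‖ by
      simpa using hα0))
    exact h2
  obtain ⟨ε, hε, hball⟩ := Metric.mem_nhds_iff.1 (inter_mem (inter_mem hs hderiv) hαc)
  filter_upwards [Ioo_mem_nhdsGT hε] with r hr
  have hr0 : 0 < r := hr.1
  set E : ℝ → ℂ := fun θ => Complex.exp (θ * Complex.I) with hE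
  have hEn : ∀ θ, ‖E θ‖ = 1 := fun θ => Complex.norm_exp_ofReal_mul_I θ
  have hEc : Continuous E := by simp only [hE]; fun_prop
  have hE0 : ∀ θ, E θ ≠ 0 := fun θ => Complex.exp_ne_zero _
  have hEper : E (2 * Real.pi) = E 0 := by
    simp only [hE]
    push_cast
    rw [Complex.exp_two_pi_mul_I]
    simp
  set c : ℝ → ℂ := fun θ => u₀ + r * E θ with hc
  have hcc : Continuous c := by fun_prop
  have hcper : c (2 * Real.pi) = c 0 := by simp only [hc, hEper]
  have hcb : ∀ θ, c θ ∈ Metric.ball u₀ ε := fun θ => by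
    rw [mem_ball_iff_norm]
    simp only [hc, add_sub_cancel_left, norm_mul, hEn, mul_one, Complex.norm_real]
    rw [Real.norm_of_nonneg hr0.le]
    exact hr.2
  have hcs : ∀ θ, c θ ∈ h.w.source := fun θ => (hball (hcb θ)).1.1
  refine ⟨hcs, ?_⟩
  have hαs : ∀ θ, h.α (c θ) ≠ 0 := fun θ h0 => by
    have := h.norm_lt _ (hcs θ)
    rw [h0, norm_zero] at this
    exact absurd this (norm_nonneg _).not_gt
  have hwne : ∀ θ, h.w (c θ) ≠ 0 := fun θ h0 => by
    have h1 := h.w.injOn (hcs θ) h.mem_source (by rw [h0, h.map_center])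
    have h2 : (r : ℂ) * E θ = 0 := by simpa [hc] using h1
    exact mul_ne_zero (by exact_mod_cast hr0.ne') (hE0 θ) h2
  have hr' : (r : ℂ) ≠ 0 := by exact_mod_cast hr0.ne'
  have hm0 : (m : ℂ) ≠ 0 := by
    have := h.one_le
    exact_mod_cast (by omega : m ≠ 0)
  -- The field on the circle is a positive constant times `A κ₁ κ₂ κ₃ ^ (m - 1) conj (E θ) ^ (m -
  -- 1)`. Each `κ` stays within distance less than `1` of `1`, so its principal argument is
  -- continuous and returns to its initial value; only the last factor winds, by `1 - m`.
  set κ₁ : ℝ → ℂ := fun θ => 1 - m * h.w (c θ) ^ (m - 1) * h.β (c θ) /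
    conj (m * h.w (c θ) ^ (m - 1) * h.α (c θ)) with hκ₁
  set κ₂ : ℝ → ℂ := fun θ => conj (h.α (c θ) / h.α u₀) with hκ₂
  set κ₃ : ℝ → ℂ := fun θ => conj (h.w (c θ) / (h.α u₀ * (r * E θ))) with hκ₃
  have hk0 : ∀ θ, conj (m * h.w (c θ) ^ (m - 1) * h.α (c θ)) ≠ 0 := fun θ => by
    rw [Ne, map_eq_zero]
    exact mul_ne_zero (mul_ne_zero hm0 (pow_ne_zero _ (hwne θ))) (hαs θ)
  have hs₁ : ∀ θ, κ₁ θ ∈ Complex.slitPlane := fun θ => by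
    refine mem_slitPlane_of_norm_sub_one_lt ?_
    simp only [hκ₁]
    rw [sub_sub_cancel_left, norm_neg, norm_div, div_lt_one (norm_pos_iff.2 (hk0 θ)),
      RCLike.norm_conj, norm_mul, norm_mul _ (h.α _)]
    exact mul_lt_mul_of_pos_left (h.norm_lt _ (hcs θ))
      (norm_pos_iff.2 (mul_ne_zero hm0 (pow_ne_zero _ (hwne θ))))
  have hs₂ : ∀ θ, κ₂ θ ∈ Complex.slitPlane := fun θ => by
    refine mem_slitPlane_of_norm_sub_one_lt ?_
    have h1 : κ₂ θ - 1 = conj ((h.α (c θ) - h.α u₀) / h.α u₀) := by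
      rw [sub_div, div_self hα0, map_sub, map_one]
    rw [h1, RCLike.norm_conj, norm_div, div_lt_one (norm_pos_iff.2 hα0)]
    exact (hball (hcb θ)).2
  have hs₃ : ∀ θ, κ₃ θ ∈ Complex.slitPlane := fun θ => by
    refine mem_slitPlane_of_norm_sub_one_lt ?_
    have hden : h.α u₀ * (r * E θ) ≠ 0 := mul_ne_zero hα0 (mul_ne_zero hr' (hE0 θ))
    have h1 : κ₃ θ - 1 = conj ((h.w (c θ) - h.α u₀ * (r * E θ)) / (h.α u₀ * (r * E θ))) := by
      rw [sub_div, div_self hden, map_sub, map_one]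
    have hrE : ‖(r : ℂ) * E θ‖ = r := by
      rw [norm_mul, hEn, mul_one, Complex.norm_real, Real.norm_of_nonneg hr0.le]
    rw [h1, RCLike.norm_conj, norm_div, div_lt_one (norm_pos_iff.2 hden), norm_mul, hrE]
    have h2 := (hball (hcb θ)).1.2
    have h3 : c θ - u₀ = r * E θ := by simp [hc]
    simp only [mem_ofPred_eq, h3, h.map_center, sub_zero, wirtinger_apply, hrE] at h2
    calc _ ≤ ‖h.w (c θ) - (h.α u₀ * (r * E θ) + h.β u₀ * conj (r * E θ))‖ +
          ‖h.β u₀ * conj (r * E θ)‖ := by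
            refine le_trans (le_of_eq ?_) (norm_add_le _ _)
            congr 1
            ring
      _ ≤ δ * r + ‖h.β u₀‖ * r := by
        refine add_le_add h2 (le_of_eq ?_)
        rw [norm_mul, RCLike.norm_conj, hrE]
      _ < ‖h.α u₀‖ * r := by
        rw [← add_mul]
        exact mul_lt_mul_of_pos_right (by rw [hδ]; linarith) hr0
  have hwc : Continuous fun θ => h.w (c θ) :=
    h.w.continuousOn.comp_continuous hcc hcs
  have hαc' : Continuous fun θ => h.α (c θ) := h.continuousOn_α.comp_continuous hcc hcs
  have hβc' : Continuous fun θ => h.β (c θ) := h.continuousOn_β.comp_continuous hcc hcs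
  have hc₁ : Continuous κ₁ := by
    refine continuous_const.sub (Continuous.div (by fun_prop) ?_ hk0)
    exact Complex.continuous_conj.comp (by fun_prop)
  have hc₂ : Continuous κ₂ := Complex.continuous_conj.comp (hαc'.div_const _)
  have hc₃ : Continuous κ₃ := Complex.continuous_conj.comp (hwc.div (by fun_prop)
    fun θ => mul_ne_zero hα0 (mul_ne_zero hr' (hE0 θ)))
  have harg : ∀ κ : ℝ → ℂ, Continuous κ → (∀ θ, κ θ ∈ Complex.slitPlane) →
      Continuous fun θ => (κ θ).arg := fun κ h1 h2 =>
    continuous_iff_continuousAt.2 fun θ => (Complex.continuousAt_arg (h2 θ)).comp h1.continuousAt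
  set A : ℂ := conj (h.α u₀) * conj (h.α u₀) ^ (m - 1) with hA
  refine ⟨fun θ => m * r ^ (m - 1) * ‖A‖ * ‖κ₁ θ‖ * ‖κ₂ θ‖ * ‖κ₃ θ‖ ^ (m - 1),
    fun θ => A.arg + (κ₁ θ).arg + (κ₂ θ).arg + (m - 1 : ℕ) * (κ₃ θ).arg, fun θ => ?_, ?_, ?_,
    fun θ => ?_⟩
  · have hA0 : A ≠ 0 := mul_ne_zero (by simpa using hα0) (pow_ne_zero _ (by simpa using hα0))
    have hmpos : (0 : ℝ) < m := by exact_mod_cast h.one_le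
    have h1 : 0 < ‖A‖ := norm_pos_iff.2 hA0
    have h2 : 0 < ‖κ₁ θ‖ := norm_pos_iff.2 (Complex.slitPlane_ne_zero (hs₁ θ))
    have h3 : 0 < ‖κ₂ θ‖ := norm_pos_iff.2 (Complex.slitPlane_ne_zero (hs₂ θ))
    have h4 : 0 < ‖κ₃ θ‖ := norm_pos_iff.2 (Complex.slitPlane_ne_zero (hs₃ θ))
    positivity
  · exact ((continuous_const.add (harg _ hc₁ hs₁)).add (harg _ hc₂ hs₂)).add
      (continuous_const.mul (harg _ hc₃ hs₃))
  · simp only [hκ₁, hκ₂, hκ₃, hcper, hEper]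
  · have hV : V (c θ) = m * r ^ (m - 1) * A * κ₁ θ * κ₂ θ * κ₃ θ ^ (m - 1) *
        conj (E θ) ^ (m - 1) := by
      have h1 : V (c θ) = conj (m * h.w (c θ) ^ (m - 1) * h.α (c θ)) * κ₁ θ := by
        rw [h.field_eq _ (hcs θ)]
        simp only [hκ₁]
        rw [mul_sub, mul_one, mul_div_cancel₀ _ (hk0 θ)]
      have h2 : conj (h.α (c θ)) = conj (h.α u₀) * κ₂ θ := by
        simp only [hκ₂]
        rw [← map_mul, mul_div_cancel₀ _ hα0]
      have h3 : conj (h.w (c θ)) = conj (h.α u₀) * (r * conj (E θ)) * κ₃ θ := by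
        simp only [hκ₃]
        have hden : h.α u₀ * (r * E θ) ≠ 0 := mul_ne_zero hα0 (mul_ne_zero hr' (hE0 θ))
        conv_lhs => rw [← mul_div_cancel₀ (h.w (c θ)) hden]
        rw [map_mul, map_mul, map_mul, Complex.conj_ofReal]
      rw [h1, map_mul, map_mul, map_pow, map_natCast, h2, h3, hA]
      ring
    have hEconj : conj (E θ) ^ (m - 1) = Complex.exp (((1 - m : ℤ) * θ : ℝ) * Complex.I) := by
      simp only [hE]
      rw [← Complex.exp_conj, ← Complex.exp_nat_mul]
      congr 1
      have h1 : ((m - 1 : ℕ) : ℂ) = m - 1 := by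
        rw [Nat.cast_sub h.one_le, Nat.cast_one]
      rw [h1, map_mul, Complex.conj_ofReal, Complex.conj_I]
      push_cast
      ring
    change V (c θ) = _
    rw [hV, hEconj]
    conv_lhs => rw [eq_norm_mul_exp_arg A, eq_norm_mul_exp_arg (κ₁ θ), eq_norm_mul_exp_arg (κ₂ θ),
      eq_norm_mul_exp_arg (κ₃ θ), mul_pow, ← Complex.exp_nat_mul]
    have hexp : Complex.exp ((((1 - m : ℤ) * θ + (A.arg + (κ₁ θ).arg + (κ₂ θ).arg +
        (m - 1 : ℕ) * (κ₃ θ).arg) : ℝ) : ℂ) * Complex.I) =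
        Complex.exp (A.arg * Complex.I) * Complex.exp ((κ₁ θ).arg * Complex.I) *
        Complex.exp ((κ₂ θ).arg * Complex.I) *
        Complex.exp ((m - 1 : ℕ) * ((κ₃ θ).arg * Complex.I)) *
        Complex.exp (((1 - m : ℤ) * θ : ℝ) * Complex.I) := by
      rw [← Complex.exp_add, ← Complex.exp_add, ← Complex.exp_add, ← Complex.exp_add]
      congr 1
      push_cast
      ring
    rw [hexp]
    push_cast
    ring

end PowerNormalForm

end

section

/-! ### The lowest degree of the Taylor expansion -/

/-- Taylor's theorem on the line through `p` in direction `v`. By induction the coefficients below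
`k` vanish, so the `k`-th one is the limit of `h (p + t v) / t ^ k`. The factor `0 ^ (m - k)` covers
both cases: it is `1` for `k = m` and `0` below. -/
theorem iteratedFDeriv_apply_of_tendsto_div_pow {E : Type*} [NormedAddCommGroup E]
    [NormedSpace ℝ E] {h : E → ℝ} {p v : E} {ε : ℝ} (hε : 0 < ε)
    (hh : ContDiffOn ℝ ∞ h (Metric.ball p ε)) {m : ℕ} {A : ℝ}
    (hlim : Tendsto (fun t : ℝ => h (p + t • v) / t ^ m) (𝓝[≠] 0) (𝓝 A)) {k : ℕ} (hk : k ≤ m) :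
    (k.factorial : ℝ)⁻¹ * iteratedFDeriv ℝ k h p (fun _ => v) = A * 0 ^ (m - k) := by
  set h' : E → ℝ := fun x => h (p + x) with hh'
  set s : Set E := Metric.ball 0 ε with hs
  have hso : IsOpen s := Metric.isOpen_ball
  have hh's : ContDiffOn ℝ ∞ h' s := by
    refine hh.comp (by fun_prop) fun x hx => ?_
    simpa [hs] using hx
  set g : ℝ →L[ℝ] E := ContinuousLinearMap.toSpanSingleton ℝ v with hg
  set S : Set ℝ := g ⁻¹' s with hS
  have hSo : IsOpen S := hso.preimage g.continuous
  have h0S : (0 : ℝ) ∈ S := by simp [hS, hs, hε]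
  have hSc : Convex ℝ S := (convex_ball (0 : E) ε).linear_preimage g.toLinearMap
  have hc : ∀ j, iteratedDerivWithin j (h' ∘ g) S 0 = iteratedFDeriv ℝ j h p (fun _ => v) := by
    intro j
    rw [iteratedDerivWithin_eq_iteratedFDerivWithin,
      g.iteratedFDerivWithin_comp_right hh's hso.uniqueDiffOn hSo.uniqueDiffOn
        (by simpa [hS] using h0S) (i := j) (by exact_mod_cast le_top),
      iteratedFDerivWithin_of_isOpen j hso (by simpa [hS] using h0S), map_zero, hh',
      iteratedFDeriv_comp_add_left, add_zero]
    simp [hg]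
  simp only [← hc]
  induction k using Nat.strong_induction_on with
  | _ k ih =>
    have hz : ∀ j < k, iteratedDerivWithin j (h' ∘ g) S 0 = 0 := fun j hj => by
      have h1 := ih j hj (hj.le.trans hk)
      rw [zero_pow (by omega), mul_zero] at h1
      exact (mul_eq_zero.1 h1).resolve_left (by positivity)
    have hT : ∀ x, taylorWithinEval (h' ∘ g) k S 0 x =
        (k.factorial : ℝ)⁻¹ * iteratedDerivWithin k (h' ∘ g) S 0 * x ^ k := by
      intro x
      rw [taylor_within_apply, Finset.sum_range_succ, Finset.sum_eq_zero fun j hj => by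
        rw [hz j (Finset.mem_range.1 hj), smul_zero]]
      simp
      ring
    have hφ : ContDiffOn ℝ k (h' ∘ g) S :=
      (hh's.comp g.contDiff.contDiffOn fun _ hx => hx).of_le (by exact_mod_cast le_top)
    have h1 := taylor_tendsto hSc h0S hφ
    rw [hSo.nhdsWithin_eq h0S] at h1
    have h2 := (h1.mono_left (nhdsWithin_le_nhds (s := {0}ᶜ))).add_const
      ((k.factorial : ℝ)⁻¹ * iteratedDerivWithin k (h' ∘ g) S 0)
    have h3 : Tendsto (fun t : ℝ => t ^ (m - k)) (𝓝[≠] 0) (𝓝 (0 ^ (m - k))) :=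
      ((continuous_pow (m - k)).tendsto 0).mono_left nhdsWithin_le_nhds
    have h4 := hlim.mul h3
    rw [zero_add] at h2
    refine tendsto_nhds_unique h2 (h4.congr' ?_)
    filter_upwards [self_mem_nhdsWithin] with t ht
    have ht0 : t ≠ 0 := ht
    have h5 : t ^ m = t ^ k * t ^ (m - k) := by rw [← pow_add, Nat.add_sub_cancel' hk]
    rw [hT, h5]
    simp only [Function.comp_apply, hg, hh', ContinuousLinearMap.toSpanSingleton_apply, sub_zero,
      smul_eq_mul]
    field_simp
    ring

namespace PowerNormalForm

variable {f : ℂ → ℝ} {V : ℂ → ℂ} {u₀ : ℂ} {m : ℕ}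

theorem tendsto_div_pow (h : PowerNormalForm f V u₀ m) (v : ℂ) :
    Tendsto (fun t : ℝ => (f (u₀ + t • v) - f u₀) / t ^ m) (𝓝[≠] 0)
      (𝓝 ((wirtinger (h.α u₀) (h.β u₀) v ^ m).re)) := by
  have h1 : HasDerivAt (fun t : ℝ => h.w (u₀ + t • v)) (wirtinger (h.α u₀) (h.β u₀) v) 0 := by
    have h2 : HasDerivAt (fun t : ℝ => u₀ + t • v) v 0 := by
      simpa using ((hasDerivAt_id (0 : ℝ)).smul_const v).const_add u₀
    exact (h.hasFDerivAt u₀ h.mem_source).comp_hasDerivAt_of_eq (0 : ℝ) h2 (by simp)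
  have h2 := (hasDerivAt_iff_tendsto_slope_zero.1 h1).pow m
  have h3 := (Complex.continuous_re.tendsto _).comp h2
  refine h3.congr' ?_
  have hc : Tendsto (fun t : ℝ => u₀ + t • v) (𝓝[≠] 0) (𝓝 u₀) := by
    have : Continuous fun t : ℝ => u₀ + t • v := by fun_prop
    have h5 := this.tendsto 0
    rw [zero_smul, add_zero] at h5
    exact h5.mono_left nhdsWithin_le_nhds
  filter_upwards [hc.eventually (h.w.open_source.mem_nhds h.mem_source)] with t ht
  rw [h.eq_re _ ht]
  simp only [Function.comp_apply, zero_add, zero_smul, add_zero, h.map_center, sub_zero, smul_pow,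
    Complex.smul_re, smul_eq_mul, add_sub_cancel_left, inv_pow, div_eq_inv_mul]

theorem exists_re_wirtinger_pow_ne_zero (h : PowerNormalForm f V u₀ m) :
    ∃ v, (wirtinger (h.α u₀) (h.β u₀) v ^ m).re ≠ 0 := by
  obtain ⟨v, hv⟩ := (wirtingerEquiv _ _ (h.norm_lt u₀ h.mem_source)).surjective 1
  refine ⟨v, ?_⟩
  have hv' : wirtinger (h.α u₀) (h.β u₀) v = 1 := hv
  simp [hv']

theorem isBigO_sub (h : PowerNormalForm f V u₀ m) :
    (fun u => f u - f u₀) =O[𝓝 u₀] fun u => ‖u - u₀‖ ^ m := by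
  have h1 := (h.hasFDerivAt u₀ h.mem_source).isBigO_sub
  rw [h.map_center] at h1
  simp only [sub_zero] at h1
  refine Asymptotics.IsBigO.trans ?_ (h1.norm_norm.pow m)
  refine Asymptotics.IsBigO.of_bound 1 ?_
  filter_upwards [h.w.open_source.mem_nhds h.mem_source] with u hu
  rw [h.eq_re u hu, add_sub_cancel_left, one_mul, norm_pow, norm_norm, ← norm_pow]
  exact Complex.abs_re_le_norm _

end PowerNormalForm

variable {S : Type*} [TopologicalSpace S]

/-- A function on the surface in the complex coordinate given by a chart. -/
def complexCoord (e : OpenPartialHomeomorph S Plane) {E : Type*} (f : S → E) (u : ℂ) : E :=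
  f (e.symm (planeEquiv.symm u))

theorem complexCoord_planeEquiv (e : OpenPartialHomeomorph S Plane) {E : Type*} (f : S → E)
    {z : S} (hz : z ∈ e.source) : complexCoord e f (planeEquiv (e z)) = f z := by
  simp [complexCoord, e.left_inv hz]

theorem PowerNormalForm.isLowestDegree {e : OpenPartialHomeomorph S Plane} {f : S → ℝ} {z : S}
    {m : ℕ} {V : ℂ → ℂ} (h : PowerNormalForm (complexCoord e f) V (planeEquiv (e z)) m)
    (hz : z ∈ e.source) {N : Set Plane} (hN : N ∈ 𝓝 (e z))
    (hf : ContDiffOn ℝ ∞ (fun u => f (e.symm u)) N) : IsLowestDegree f e z m := by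
  obtain ⟨ε, hε, hεN⟩ := Metric.mem_nhds_iff.1 hN
  have hsm : ContDiffOn ℝ ∞ (fun u => f (e.symm u) - f z) (Metric.ball (e z) ε) :=
    (hf.mono hεN).sub contDiffOn_const
  have key : ∀ (v : Plane) {k : ℕ}, k ≤ m → taylorTerm f e z k v =
      ((wirtinger (h.α (planeEquiv (e z))) (h.β (planeEquiv (e z))) (planeEquiv v)) ^ m).re *
        0 ^ (m - k) := by
    intro v k hk
    refine iteratedFDeriv_apply_of_tendsto_div_pow hε hsm ?_ hk
    refine (h.tendsto_div_pow (planeEquiv v)).congr fun t => ?_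
    rw [complexCoord_planeEquiv e f hz, ← map_smul, ← map_add, complexCoord,
      LinearIsometryEquiv.symm_apply_apply]
  constructor
  · obtain ⟨v, hv⟩ := h.exists_re_wirtinger_pow_ne_zero
    refine ⟨planeEquiv.symm v, ?_⟩
    rw [key _ le_rfl]
    simpa using hv
  · rintro k ⟨v, hv⟩
    by_contra hlt
    rw [not_le] at hlt
    rw [key v hlt.le, zero_pow (by omega), mul_zero] at hv
    exact hv rfl

/-- The exponent of the normal form is the same in all charts. -/
theorem PowerNormalForm.degree_le {e e' : OpenPartialHomeomorph S Plane} {f : S → ℝ} {z : S}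
    {m m' : ℕ} {V V' : ℂ → ℂ} (h : PowerNormalForm (complexCoord e f) V (planeEquiv (e z)) m)
    (h' : PowerNormalForm (complexCoord e' f) V' (planeEquiv (e' z)) m')
    (hz : z ∈ e.source) (hz' : z ∈ e'.source)
    (hd : DifferentiableAt ℝ (fun u => e (e'.symm u)) (e' z)) : m ≤ m' := by
  by_contra hlt
  rw [not_le] at hlt
  obtain ⟨v, hv⟩ := h'.exists_re_wirtinger_pow_ne_zero
  have hlim := h'.tendsto_div_pow v
  set c : ℝ → ℂ := fun t => planeEquiv (e (e'.symm (planeEquiv.symm (planeEquiv (e' z) + t • v))))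
    with hc
  -- The line in the chart `e'`, seen in the chart `e`, leaves the center at most linearly because
  -- the transition map is differentiable.
  have hcO : (fun t => c t - planeEquiv (e z)) =O[𝓝 0] fun t : ℝ => t := by
    have h1 : HasFDerivAt (fun u => e (e'.symm u)) _ (e' z) := hd.hasFDerivAt
    have h2 : HasFDerivAt (fun t : ℝ => e' z + t • planeEquiv.symm v)
        ((ContinuousLinearMap.id ℝ ℝ).smulRight (planeEquiv.symm v)) 0 := by
      exact ((hasFDerivAt_id (0 : ℝ)).smul_const _).const_add _
    have h3 : HasFDerivAt (fun u => e (e'.symm u)) (fderiv ℝ (fun u => e (e'.symm u)) (e' z))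
        (e' z + (0 : ℝ) • planeEquiv.symm v) := by simpa using h1
    have h4 := (h3.comp (0 : ℝ) h2).isBigO_sub
    have h5 := (planeEquiv.toContinuousLinearEquiv : Plane →L[ℝ] ℂ).isBigO_comp
      (fun t : ℝ => e (e'.symm (e' z + t • planeEquiv.symm v)) - e z) (𝓝 0)
    refine (h5.congr_left fun t => ?_).trans (h4.congr (fun t => ?_) fun t => ?_)
    · simp only [hc, map_add, LinearIsometryEquiv.symm_apply_apply, map_smul, ← map_sub]
      rfl
    · simp [e'.left_inv hz']
    · simp
  have hct : Tendsto c (𝓝 0) (𝓝 (planeEquiv (e z))) := by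
    have h1 := hcO.trans_tendsto tendsto_id
    simpa using h1.add_const (planeEquiv (e z))
  have hO := (h.isBigO_sub.comp_tendsto hct).trans ((hcO.norm_left).pow m)
  have hsrc : ∀ᶠ t : ℝ in 𝓝 0, e'.symm (planeEquiv.symm (planeEquiv (e' z) + t • v)) ∈ e.source := by
    have h1 : ContinuousAt (fun t : ℝ => e'.symm (planeEquiv.symm (planeEquiv (e' z) + t • v))) 0 := by
      refine ContinuousAt.comp (g := e'.symm) ?_ (by fun_prop)
      simpa using e'.continuousAt_symm (e'.map_source hz')
    exact h1.eventually (e.open_source.mem_nhds (by simpa [e'.left_inv hz'] using hz))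
  have hO' : (fun t : ℝ => complexCoord e' f (planeEquiv (e' z) + t • v) -
      complexCoord e' f (planeEquiv (e' z))) =O[𝓝[≠] 0] fun t : ℝ => t ^ m := by
    refine (hO.mono nhdsWithin_le_nhds).congr' ?_ EventuallyEq.rfl
    filter_upwards [nhdsWithin_le_nhds hsrc] with t ht
    rw [complexCoord_planeEquiv e' f hz', Function.comp_apply, complexCoord_planeEquiv e f hz]
    simp only [hc, complexCoord, LinearIsometryEquiv.symm_apply_apply, e.left_inv ht]
  -- Vanishing to order `m` in `e` forces it along the line in `e'`; with `m' < m` the leading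
  -- coefficient there would be `0`.
  have h0 : Tendsto (fun t : ℝ => (complexCoord e' f (planeEquiv (e' z) + t • v) -
      complexCoord e' f (planeEquiv (e' z))) / t ^ m') (𝓝[≠] 0) (𝓝 0) := by
    have h1 : (fun t : ℝ => (complexCoord e' f (planeEquiv (e' z) + t • v) -
      complexCoord e' f (planeEquiv (e' z))) / t ^ m') =O[𝓝[≠] 0] fun t : ℝ => t ^ (m - m') := by
      refine (hO'.mul (Asymptotics.isBigO_refl (fun t : ℝ => (t ^ m')⁻¹) _)).congr' ?_ ?_
      · exact Eventually.of_forall fun t => (div_eq_mul_inv _ _).symm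
      · filter_upwards [self_mem_nhdsWithin] with t ht
        have ht0 : t ≠ 0 := ht
        have h5 : t ^ m = t ^ m' * t ^ (m - m') := by rw [← pow_add, Nat.add_sub_cancel' hlt.le]
        rw [h5]
        field_simp
    refine h1.trans_tendsto ?_
    have h2 := ((continuous_pow (M := ℝ) (m - m')).tendsto 0).mono_left
      (nhdsWithin_le_nhds (s := {0}ᶜ))
    rwa [zero_pow (by omega)] at h2
  exact hv (tendsto_nhds_unique hlim h0)

end

section

/-! ### Scalar equations and limit sets -/

/-- Global solutions of a scalar autonomous equation with bounded positive right hand side. -/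
theorem exists_global_solution_of_pos {p : ℝ → ℝ} (hp : Continuous p) (h0 : ∀ x, 0 < p x) {C : ℝ}
    (hC : ∀ x, p x ≤ C) (x₀ : ℝ) :
    ∃ x : ℝ → ℝ, x 0 = x₀ ∧ (∀ t, HasDerivAt x (p (x t)) t) ∧ Monotone x ∧
      Tendsto x atTop atTop := by
  have hCpos : 0 < C := (h0 0).trans_le (hC 0)
  -- The time needed to travel from `x₀` to `x`; the solution is its inverse function.
  set T : ℝ → ℝ := fun x => ∫ u in x₀..x, (p u)⁻¹ with hT
  have hpi : Continuous fun u => (p u)⁻¹ := hp.inv₀ fun u => (h0 u).ne'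
  have hTd : ∀ x, HasDerivAt T (p x)⁻¹ x := fun x =>
    (hpi.integral_hasStrictDerivAt x₀ x).hasDerivAt
  have hmono : StrictMono T := strictMono_of_hasDerivAt_pos hTd fun x => inv_pos.2 (h0 x)
  have hT0 : T x₀ = 0 := by simp [hT]
  -- The upper bound on the speed makes `T` grow at least linearly, hence onto, so that the solution
  -- exists for all times.
  have hlow : Monotone fun x => T x - x / C := by
    have hd : ∀ x, HasDerivAt (fun x => T x - x / C) ((p x)⁻¹ - 1 / C) x := fun x =>
      (hTd x).sub ((hasDerivAt_id x).div_const C)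
    refine monotone_of_deriv_nonneg (fun x => (hd x).differentiableAt) fun x => ?_
    rw [(hd x).deriv, one_div, sub_nonneg]
    exact inv_anti₀ (h0 x) (hC x)
  have htop : Tendsto T atTop atTop := by
    refine tendsto_atTop_mono' atTop (f₁ := fun x => x / C - x₀ / C) ?_ ?_
    · filter_upwards [eventually_ge_atTop x₀] with x hx
      have := hlow hx
      simp only [hT0] at this
      linarith
    · exact tendsto_atTop_add_const_right _ _ (tendsto_id.atTop_div_const hCpos)
  have hbot : Tendsto T atBot atBot := by
    refine tendsto_atBot_mono' (f₂ := T) (f₁ := fun x => x / C - x₀ / C) atBot ?_ ?_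
    · filter_upwards [eventually_le_atBot x₀] with x hx
      have := hlow hx
      simp only [hT0] at this
      linarith
    · exact tendsto_atBot_add_const_right _ _ (tendsto_id.atBot_div_const hCpos)
  have hTc : Continuous T := continuous_iff_continuousAt.2 fun x => (hTd x).continuousAt
  set e := hmono.orderIsoOfSurjective T (hTc.surjective htop hbot) with he
  have hTe : ∀ t, T (e.symm t) = t := fun t => e.apply_symm_apply t
  refine ⟨e.symm, ?_, fun t => ?_, e.symm.monotone, e.symm.tendsto_atTop⟩
  · rw [OrderIso.symm_apply_eq]
    exact hT0.symm
  · have h1 := HasDerivAt.of_local_left_inverse (e.symm.continuous.continuousAt (x := t))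
      (hTd (e.symm t)) (inv_ne_zero (h0 _).ne') (Eventually.of_forall hTe)
    rwa [inv_inv] at h1

/-- Decaying solutions of `s' = - q s`. -/
theorem exists_decaying_solution {q : ℝ → ℝ} {s₀ C : ℝ} (hs₀ : 0 < s₀)
    (hq : ContinuousOn q (Ioc 0 s₀)) (h0 : ∀ s ∈ Ioc 0 s₀, 0 < q s)
    (hC : ∀ s ∈ Ioc 0 s₀, q s ≤ C * s) :
    ∃ s : ℝ → ℝ, s 0 = s₀ ∧ (∀ t, 0 ≤ t → s t ∈ Ioc 0 s₀ ∧ HasDerivAt s (-q (s t)) t) ∧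
      Tendsto s atTop (𝓝 0) := by
  set x₀ := -Real.log s₀ with hx₀
  have hexp0 : Real.exp (-x₀) = s₀ := by rw [hx₀, neg_neg, Real.exp_log hs₀]
  have hmem : ∀ x, x₀ ≤ x → Real.exp (-x) ∈ Ioc 0 s₀ := fun x hx =>
    ⟨Real.exp_pos _, hexp0 ▸ Real.exp_le_exp.2 (neg_le_neg hx)⟩
  -- The substitution `s = exp (-x)` turns the equation into `x' = q (exp (-x)) exp x`, whose
  -- right-hand side is at most `C`. The maximum extends it to the whole line; the solution never
  -- enters `x < x₀` for `t ≥ 0`.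
  set p : ℝ → ℝ := fun x => q (Real.exp (-max x x₀)) * Real.exp (max x x₀) with hp
  have hpc : Continuous p :=
    (hq.comp_continuous (by fun_prop) fun x => hmem _ (le_max_right _ _)).mul (by fun_prop)
  obtain ⟨x, hx0, hxd, hxm, hxt⟩ := exists_global_solution_of_pos (p := p) hpc
    (fun x => mul_pos (h0 _ (hmem _ (le_max_right _ _))) (Real.exp_pos _)) (C := C) (fun x => by
      calc p x ≤ C * Real.exp (-max x x₀) * Real.exp (max x x₀) :=
            mul_le_mul_of_nonneg_right (hC _ (hmem _ (le_max_right _ _))) (Real.exp_pos _).le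
        _ = C := by rw [mul_assoc, ← Real.exp_add, neg_add_cancel, Real.exp_zero, mul_one]) x₀
  refine ⟨fun t => Real.exp (-x t), by beta_reduce; rw [hx0, hexp0], fun t ht => ?_, ?_⟩
  · have hxt : x₀ ≤ x t := hx0 ▸ hxm ht
    refine ⟨hmem _ hxt, ?_⟩
    refine (hxd t).neg.exp.congr_deriv ?_
    simp only [hp, max_eq_left hxt]
    rw [mul_neg, mul_left_comm, Pi.neg_apply, ← Real.exp_add, neg_add_cancel, Real.exp_zero, mul_one]
  · exact Real.tendsto_exp_neg_atTop_nhds_zero.comp hxt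

variable {S : Type*} [TopologicalSpace S]

/-- The closed tails are nested and their intersection misses the compact complement of a
neighborhood of `z`, so some tail already misses it. -/
theorem tendsto_of_omegaLimitSet_eq [CompactSpace S] {γ : ℝ → S} {z : S}
    (h : omegaLimitSet γ = {z}) : Tendsto γ atTop (𝓝 z) := by
  refine tendsto_nhds.2 fun O hO hz => ?_
  have hdir : Directed (· ⊇ ·) fun T : ℝ => closure (γ '' Ici T) :=
    (antitone_iff_forall_lt.2 fun a b hab => closure_mono
      (image_mono (Ici_subset_Ici.2 hab.le))).directed_ge
  obtain ⟨T, hT⟩ := hO.isClosed_compl.isCompact.elim_directed_family_closed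
    (fun T : ℝ => closure (γ '' Ici T)) (fun T => isClosed_closure)
    (by
      rw [show (⋂ T : ℝ, closure (γ '' Ici T)) = {z} from h]
      ext x
      simp only [mem_inter_iff, mem_compl_iff, mem_singleton_iff, mem_empty_iff_false, iff_false]
      rintro ⟨h1, rfl⟩
      exact h1 hz) hdir
  filter_upwards [eventually_ge_atTop T] with t ht
  by_contra hc
  have : γ t ∈ Oᶜ ∩ closure (γ '' Ici T) := ⟨hc, subset_closure ⟨t, ht, rfl⟩⟩
  rw [hT] at this
  exact this

theorem omegaLimitSet_eq_of_tendsto [T2Space S] {γ : ℝ → S} {z : S}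
    (h : Tendsto γ atTop (𝓝 z)) : omegaLimitSet γ = {z} := by
  refine Subset.antisymm (fun x hx => ?_) ?_
  · by_contra hne
    obtain ⟨A, B, hA, hB, hxA, hzB, hAB⟩ := t2_separation hne
    obtain ⟨T, hT⟩ := eventually_atTop.1 (h.eventually (hB.mem_nhds hzB))
    obtain ⟨y, hyA, t, ht, rfl⟩ := mem_closure_iff.1 (mem_iInter.1 hx T) A hA hxA
    exact disjoint_left.1 hAB hyA (hT t ht)
  · rintro _ rfl
    refine mem_iInter.2 fun T => mem_closure_of_tendsto h ?_
    filter_upwards [eventually_ge_atTop T] with t ht using ⟨t, ht, rfl⟩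

end

section

/-! ### Stable and unstable sets in an adapted chart -/

theorem mem_starSet_iff {m : ℕ} (hm : m ≠ 0) {ζ : ℂ} :
    ζ ∈ starSet m ↔ ‖ζ‖ < 1 ∧ ζ ^ m = ((‖ζ‖ ^ m : ℝ) : ℂ) := by
  constructor
  · rintro ⟨t, h0, h1, h⟩
    have hn : ‖ζ‖ ^ m = t := by
      rw [← norm_pow, h, Complex.norm_real, Real.norm_of_nonneg h0]
    refine ⟨?_, by rw [h, hn]⟩
    by_contra hc
    have := one_le_pow₀ (n := m) (not_lt.1 hc)
    linarith
  · rintro ⟨h1, h⟩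
    exact ⟨_, by positivity, pow_lt_one₀ (norm_nonneg _) h1 hm, h⟩

variable {S : Type*} [TopologicalSpace S] [ChartedSpace Plane S]

/-- A coordinate `ψ` centered at `z` in which `f` is the real part of a power and the direction
of the vector field `X` is that of the gradient of this real part. -/
structure GradientChart (X : (x : S) → TangentSpace (𝓡 2) x) (f : S → ℝ) (z : S) (m : ℕ) where
  ψ : OpenPartialHomeomorph S ℂ
  lam : S → ℝ
  one_le : 1 ≤ m
  mem_source : z ∈ ψ.source
  map_center : ψ z = 0
  lam_pos : ∀ x ∈ ψ.source, 0 < lam x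
  continuousOn_lam : ContinuousOn lam ψ.source
  eq_re : ∀ x ∈ ψ.source, f x = f z + (ψ x ^ m).re
  hasDeriv_iff : ∀ (γ : ℝ → S) (s : Set ℝ) (t c : ℝ), γ t ∈ ψ.source →
    ContinuousWithinAt γ s t →
    (HasMFDerivWithinAt 𝓘(ℝ, ℝ) (𝓡 2) γ s t
      ((1 : ℝ →L[ℝ] ℝ).smulRight (c • X (γ t))) ↔
      HasDerivWithinAt (fun t => ψ (γ t)) (c * (lam (γ t) * conj (ψ (γ t)) ^ (m - 1))) s t)

namespace GradientChart

variable {X : (x : S) → TangentSpace (𝓡 2) x} {f : S → ℝ} {z : S} {m : ℕ}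

theorem exists_pow_eq_neg_one (hm : 1 ≤ m) : ∃ η : ℂ, ‖η‖ = 1 ∧ η ^ m = -1 := by
  obtain ⟨η, hη⟩ := IsAlgClosed.exists_pow_nat_eq (-1 : ℂ) hm
  refine ⟨η, ?_, hη⟩
  have : ‖η‖ ^ m = 1 := by rw [← norm_pow, hη, norm_neg, norm_one]
  exact (pow_eq_one_iff_of_nonneg (norm_nonneg _) (by lia)).1 this

/-- The chart turned by an `m`-th root of `-1` is adapted to the opposite vector field. -/
theorem exists_neg (h : GradientChart X f z m) :
    ∃ h' : GradientChart (fun x => -X x) (fun x => -f x) z m,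
      h'.ψ.source = h.ψ.source ∧ ∀ x, ‖h'.ψ x‖ = ‖h.ψ x‖ := by
  obtain ⟨η, hη, hηm⟩ := exists_pow_eq_neg_one h.one_le
  have hη0 : η ≠ 0 := by
    rintro rfl
    simp at hη
  have hconj : conj η * η = 1 := by
    rw [mul_comm, Complex.mul_conj, Complex.normSq_eq_norm_sq, hη]
    simp
  -- This identity converts the field `conj ψ ^ (m - 1)`, written in the coordinate `η ψ`, into its
  -- opposite.
  have hpow : conj η ^ (m - 1) = -η := by
    have h1 : conj η ^ (m - 1) * η ^ (m - 1) = 1 := by rw [← mul_pow, hconj, one_pow]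
    have h2 : η ^ (m - 1) * η = -1 := by rw [← pow_succ, Nat.sub_add_cancel h.one_le, hηm]
    calc conj η ^ (m - 1) = - (conj η ^ (m - 1) * (η ^ (m - 1) * η)) := by rw [h2]; ring
      _ = -η := by rw [← mul_assoc, h1, one_mul]
  refine ⟨{
    ψ := h.ψ.transHomeomorph (Homeomorph.mulLeft₀ η hη0)
    lam := h.lam
    one_le := h.one_le
    mem_source := h.mem_source
    map_center := by simp [h.map_center]
    lam_pos := h.lam_pos
    continuousOn_lam := h.continuousOn_lam
    eq_re := fun x hx => ?_
    hasDeriv_iff := fun γ s t c ht hc => ?_ }, rfl, fun x => ?_⟩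
  · simp [h.eq_re x hx, mul_pow, hηm]
    ring
  · have h1 := h.hasDeriv_iff γ s t (-c) ht hc
    rw [neg_smul, ← smul_neg] at h1
    refine h1.trans ?_
    simp only [OpenPartialHomeomorph.transHomeomorph_apply, Homeomorph.coe_mulLeft₀, map_mul,
      mul_pow, hpow, Function.comp_apply]
    refine ⟨fun h2 => ?_, fun h2 => ?_⟩
    · refine (h2.const_mul η).congr_deriv ?_
      push_cast
      ring
    · have h3 := h2.const_mul (conj η)
      simp only [← mul_assoc, hconj, one_mul] at h3
      refine h3.congr_deriv ?_
      push_cast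
      linear_combination (-(c : ℂ) * h.lam (γ t) * conj (h.ψ (γ t)) ^ (m - 1)) * hconj
  · simp [hη]

theorem continuousAt (h : GradientChart X f z m) : ContinuousAt f z := by
  have hs := h.ψ.open_source.mem_nhds h.mem_source
  have hc : ContinuousAt (fun x => f z + (h.ψ x ^ m).re) z :=
    continuousAt_const.add
      (Complex.continuous_re.continuousAt.comp ((h.ψ.continuousAt h.mem_source).pow m))
  exact hc.congr (eventually_of_mem hs fun x hx => (h.eq_re x hx).symm)

/-- The level sets of the conjugate function are invariant, so trajectories that converge to the
center lie on the rays where the power is real. -/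
theorem im_pow_eq_zero (h : GradientChart X f z m) {γ : ℝ → S} {a : ℝ}
    (hγ : IsMIntegralCurveOn γ X (Ici 0)) (ha : 0 ≤ a) (hs : ∀ t, a ≤ t → γ t ∈ h.ψ.source)
    (hlim : Tendsto γ atTop (𝓝 z)) : (h.ψ (γ a) ^ m).im = 0 := by
  have hder : ∀ t, a ≤ t → HasDerivWithinAt (fun t => (h.ψ (γ t) ^ m).im) 0 (Ici 0) t := by
    intro t hat
    have ht : t ∈ Ici (0 : ℝ) := ha.trans hat
    have h1 := (h.hasDeriv_iff γ (Ici 0) t 1 (hs t hat) (hγ t ht).1).1 (by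
      rw [one_smul]; exact hγ t ht)
    have h2 := Complex.imCLM.hasFDerivAt.comp_hasDerivWithinAt t (h1.fun_pow m)
    refine h2.congr_deriv ?_
    simp only [Complex.imCLM_apply]
    -- Along a trajectory `ψ ^ m` moves with velocity `m λ ‖ψ‖ ^ (2 (m - 1))`, which is real.
    rw [show (m : ℂ) * h.ψ (γ t) ^ (m - 1) * ((1 : ℝ) * (h.lam (γ t) * conj (h.ψ (γ t)) ^ (m - 1)))
      = ((m * h.lam (γ t) : ℝ) : ℂ) * (h.ψ (γ t) * conj (h.ψ (γ t))) ^ (m - 1) by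
        rw [mul_pow]; push_cast; ring, Complex.mul_conj, ← Complex.ofReal_pow,
        ← Complex.ofReal_mul, Complex.ofReal_im]
  have hconst : ∀ t, a ≤ t → (h.ψ (γ t) ^ m).im = (h.ψ (γ a) ^ m).im := by
    intro t hat
    refine constant_of_has_deriv_right_zero (f := fun t => (h.ψ (γ t) ^ m).im) (a := a) (b := t)
      (fun u hu => (hder u hu.1).continuousWithinAt.mono fun v hv => ha.trans hv.1)
      (fun u hu => (hder u hu.1).mono (Ici_subset_Ici.2 (ha.trans hu.1))) t ⟨hat, le_rfl⟩
  have hl : Tendsto (fun t => (h.ψ (γ t) ^ m).im) atTop (𝓝 0) := by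
    have h1 : Tendsto (fun t => (h.ψ (γ t) ^ m).im) atTop (𝓝 ((h.ψ z ^ m).im)) :=
      (Complex.continuous_im.tendsto _).comp
        (((h.ψ.continuousAt h.mem_source).tendsto.comp hlim).pow m)
    rwa [h.map_center, zero_pow (by have := h.one_le; lia), Complex.zero_im] at h1
  refine tendsto_nhds_unique (tendsto_const_nhds.congr' ?_) hl
  filter_upwards [eventually_ge_atTop a] with t ht using (hconst t ht).symm

/-- Once `ψ ^ m` is real it equals `f x - f z`, and the sign of this difference selects the
descending rays. -/
theorem pow_eq_of_im_eq_zero (h : GradientChart X f z m) {x : S} (hx : x ∈ h.ψ.source)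
    (him : (h.ψ x ^ m).im = 0) (hle : f x ≤ f z) :
    h.ψ x ^ m = -((‖h.ψ x‖ ^ m : ℝ) : ℂ) ∧ ‖h.ψ x‖ ^ m = f z - f x := by
  have hre : (h.ψ x ^ m).re = f x - f z := by rw [h.eq_re x hx]; ring
  have heq : h.ψ x ^ m = ((f x - f z : ℝ) : ℂ) := Complex.ext hre (by simp [him])
  have hn : ‖h.ψ x‖ ^ m = f z - f x := by
    rw [← norm_pow, heq, Complex.norm_real, Real.norm_of_nonpos (by linarith)]
    ring
  refine ⟨?_, hn⟩
  rw [heq, hn]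
  push_cast
  ring

theorem isMIntegralCurveOn_of_forall {γ : ℝ → S} {s : Set ℝ} (h : GradientChart X f z m)
    (hs : ∀ t ∈ s, γ t ∈ h.ψ.source) (hc : ContinuousOn γ s)
    (hd : ∀ t ∈ s, HasDerivWithinAt (fun t => h.ψ (γ t))
      (h.lam (γ t) * conj (h.ψ (γ t)) ^ (m - 1)) s t) : IsMIntegralCurveOn γ X s := by
  intro t ht
  have h1 := (h.hasDeriv_iff γ s t 1 (hs t ht) (hc t ht)).2 (by
    rw [Complex.ofReal_one, one_mul]; exact hd t ht)
  rwa [one_smul] at h1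

/-- If the trajectory stays in the disk `U` of radius `r`, constancy of `Im (ψ ^ m)` finishes the
proof. It cannot leave `U` and come back: after the last time outside `U` it runs on the rays, where
`‖ψ‖ ^ m = f z - f` is bounded by the initial value of this quantity because `f` increases along the
whole trajectory. -/
theorem mem_rays_of_mem_stableSet [T2Space S] [CompactSpace S] (h : GradientChart X f z m)
    {W : Set S} {r : ℝ}
    (hmono : ∀ γ : ℝ → S, (∀ t ∈ Ici (0 : ℝ), γ t ∈ W) → IsMIntegralCurveOn γ X (Ici 0) →
      MonotoneOn (fun t => f (γ t)) (Ici 0))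
    (hr : 0 < r) (hball : Metric.closedBall 0 r ⊆ h.ψ.target) {x : S} (hxs : x ∈ h.ψ.source)
    (hxr : ‖h.ψ x‖ < r) (hx : x ∈ stableSet X W z) :
    h.ψ x ^ m = -((‖h.ψ x‖ ^ m : ℝ) : ℂ) := by
  obtain ⟨γ, rfl, hW, hγ, hω⟩ := hx
  have hm0 : m ≠ 0 := by have := h.one_le; lia
  have hlim := tendsto_of_omegaLimitSet_eq hω
  have hm := hmono γ hW hγ
  have hle : ∀ t, 0 ≤ t → f (γ t) ≤ f z := fun t ht =>
    ge_of_tendsto (h.continuousAt.tendsto.comp hlim) (by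
      filter_upwards [eventually_ge_atTop t] with u hu using hm ht (ht.trans hu) hu)
  set U := h.ψ.source ∩ h.ψ ⁻¹' Metric.ball 0 r with hU
  have hUo : IsOpen U := h.ψ.isOpen_inter_preimage Metric.isOpen_ball
  set d := f z - f (γ 0) with hd
  have hdr : d < r ^ m := by
    have h1 := h.eq_re _ hxs
    have h2 : -(h.ψ (γ 0) ^ m).re ≤ ‖h.ψ (γ 0) ^ m‖ :=
      (neg_le_abs _).trans (Complex.abs_re_le_norm _)
    rw [norm_pow] at h2
    have h3 := pow_lt_pow_left₀ hxr (norm_nonneg _) hm0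
    linarith
  -- A compact subset of `U`, because `d < r ^ m`. It contains every point of the trajectory after
  -- which the trajectory remains in `U`.
  set K := h.ψ.symm '' (Metric.closedBall 0 r ∩ {ζ | ‖ζ‖ ^ m ≤ d}) with hK
  have hKc : IsClosed K := by
    refine IsCompact.isClosed (IsCompact.image_of_continuousOn ?_
      (h.ψ.continuousOn_symm.mono (inter_subset_left.trans hball)))
    exact (isCompact_closedBall _ _).inter_right
      (isClosed_le (by fun_prop) continuous_const)
  have hKU : K ⊆ U := by
    rintro _ ⟨ζ, ⟨hζ, hζd⟩, rfl⟩
    refine ⟨h.ψ.map_target (hball hζ), ?_⟩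
    rw [mem_preimage, h.ψ.right_inv (hball hζ), mem_ball_zero_iff]
    exact lt_of_pow_lt_pow_left₀ m hr.le (lt_of_le_of_lt hζd hdr)
  have hUK : ∀ a, 0 ≤ a → (∀ t, a ≤ t → γ t ∈ U) → γ a ∈ K := by
    intro a ha hat
    have haU := hat a le_rfl
    have h1 := h.im_pow_eq_zero hγ ha (fun t ht => (hat t ht).1) hlim
    have h2 := (h.pow_eq_of_im_eq_zero haU.1 h1 (hle a ha)).2
    have h3 : f (γ 0) ≤ f (γ a) := hm self_mem_Ici ha ha
    refine ⟨h.ψ (γ a), ⟨?_, ?_⟩, h.ψ.left_inv haU.1⟩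
    · exact Metric.ball_subset_closedBall haU.2
    · change ‖h.ψ (γ a)‖ ^ m ≤ d
      linarith
  have hall : ∀ t, 0 ≤ t → γ t ∈ U := by
    by_contra! hc
    set B := Ici (0 : ℝ) ∩ γ ⁻¹' Uᶜ with hB
    have hBc : IsClosed B :=
      hγ.continuousOn.preimage_isClosed_of_isClosed isClosed_Ici hUo.isClosed_compl
    have hBn : B.Nonempty := hc.imp fun t ht => ⟨ht.1, ht.2⟩
    have hzU : z ∈ U := ⟨h.mem_source, by simp [h.map_center, hr]⟩
    obtain ⟨T, hT⟩ := eventually_atTop.1 (hlim.eventually (hUo.mem_nhds hzU))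
    have hBb : BddAbove B := ⟨T, fun t ht => by
      by_contra hlt
      exact ht.2 (hT t (not_le.1 hlt).le)⟩
    -- The last time outside `U`. Later positions lie in the closed set `K`, hence so does this one,
    -- which contradicts `K ⊆ U`.
    have hs := hBc.csSup_mem hBn hBb
    have hs0 : 0 ≤ sSup B := hs.1
    have hin : ∀ t, sSup B < t → γ t ∈ U := fun t ht => by
      by_contra hn
      exact absurd (le_csSup hBb (⟨hs0.trans ht.le, hn⟩ : t ∈ B)) (not_le.2 ht)
    have hcl : γ (sSup B) ∈ K := by
      have hcont : ContinuousWithinAt γ (Ioi (sSup B)) (sSup B) :=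
        (hγ.continuousOn _ hs.1).mono fun t ht => hs0.trans (le_of_lt ht)
      refine hKc.mem_of_tendsto hcont ?_
      filter_upwards [self_mem_nhdsWithin] with t ht
      exact hUK t (hs0.trans (le_of_lt ht)) fun u hu => hin u (lt_of_lt_of_le ht hu)
    exact hs.2 (hKU hcl)
  exact (h.pow_eq_of_im_eq_zero hxs
    (h.im_pow_eq_zero hγ le_rfl (fun t ht => (hall t ht).1) hlim) (hle 0 le_rfl)).1

/-- Each descending ray is invariant: with `ψ = s ξ` and `‖ξ‖ = 1` the equation reduces to `s' = -λ
s ^ (m - 1)`, whose solution decreases to `0`. As `m ≥ 2`, the right-hand side is at most linear in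
`s`, so `0` is not reached in finite time. -/
theorem mem_stableSet_of_mem_rays [T2Space S] (h : GradientChart X f z m) (hm : 2 ≤ m)
    {W : Set S} {r : ℝ}
    (hball : Metric.closedBall 0 r ⊆ h.ψ.target)
    (hW : h.ψ.source ∩ h.ψ ⁻¹' Metric.ball 0 r ⊆ W) {x : S} (hxs : x ∈ h.ψ.source)
    (hxr : ‖h.ψ x‖ < r) (hx : h.ψ x ^ m = -((‖h.ψ x‖ ^ m : ℝ) : ℂ)) : x ∈ stableSet X W z := by
  have hm1 : m - 1 ≠ 0 := by lia
  by_cases hx0 : h.ψ x = 0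
  · have hxz : x = z := h.ψ.injOn hxs h.mem_source (hx0.trans h.map_center.symm)
    subst hxz
    refine ⟨fun _ => x, rfl, fun t _ => hW ⟨hxs, by simpa using hxr⟩, ?_,
      omegaLimitSet_eq_of_tendsto tendsto_const_nhds⟩
    refine h.isMIntegralCurveOn_of_forall (fun _ _ => hxs) continuousOn_const fun t _ => ?_
    simp only [hx0, map_zero, zero_pow hm1, mul_zero]
    exact hasDerivWithinAt_const _ _ _
  set s₀ := ‖h.ψ x‖ with hs₀
  have hs₀pos : 0 < s₀ := norm_pos_iff.2 hx0
  set ξ : ℂ := h.ψ x / s₀ with hdir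
  have hs₀c : (s₀ : ℂ) ≠ 0 := by exact_mod_cast hs₀pos.ne'
  have hdirn : ‖ξ‖ = 1 := by
    rw [hdir, norm_div, Complex.norm_real, Real.norm_of_nonneg hs₀pos.le, ← hs₀,
      div_self hs₀pos.ne']
  have hdirm : ξ ^ m = -1 := by
    rw [hdir, div_pow, hx]
    push_cast
    rw [neg_div, div_self (pow_ne_zero _ hs₀c)]
  have hdirc : conj ξ ^ (m - 1) = -ξ := by
    have hconj : conj ξ * ξ = 1 := by
      rw [mul_comm, Complex.mul_conj, Complex.normSq_eq_norm_sq, hdirn]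
      simp
    have h1 : conj ξ ^ (m - 1) * ξ ^ (m - 1) = 1 := by rw [← mul_pow, hconj, one_pow]
    have h2 : ξ ^ (m - 1) * ξ = -1 := by rw [← pow_succ, Nat.sub_add_cancel h.one_le, hdirm]
    calc conj ξ ^ (m - 1) = - (conj ξ ^ (m - 1) * (ξ ^ (m - 1) * ξ)) := by rw [h2]; ring
      _ = -ξ := by rw [← mul_assoc, h1, one_mul]
  have hnorm : ∀ s : ℝ, 0 ≤ s → ‖(s : ℂ) * ξ‖ = s := fun s hs => by
    rw [norm_mul, hdirn, mul_one, Complex.norm_real, Real.norm_of_nonneg hs]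
  have hmem : ∀ s ∈ Icc 0 s₀, (s : ℂ) * ξ ∈ h.ψ.target := fun s hs => hball (by
    rw [mem_closedBall_zero_iff, hnorm s hs.1]
    exact hs.2.trans hxr.le)
  have hl : ContinuousOn (fun s : ℝ => h.lam (h.ψ.symm ((s : ℂ) * ξ))) (Icc 0 s₀) :=
    h.continuousOn_lam.comp (h.ψ.continuousOn_symm.comp (by fun_prop) hmem)
      fun s hs => h.ψ.map_target (hmem s hs)
  obtain ⟨C, hC⟩ := isCompact_Icc.exists_bound_of_continuousOn hl
  -- With `C` a bound for `λ` on the ray, the linear bound comes from `s ^ (m - 1) = s ^ (m - 2) s ≤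
  -- s₀ ^ (m - 2) s`.
  obtain ⟨s, hs0, hsd, hst⟩ := exists_decaying_solution (C := C * s₀ ^ (m - 2))
    (q := fun s => h.lam (h.ψ.symm ((s : ℂ) * ξ)) * s ^ (m - 1)) hs₀pos
    ((hl.mono Ioc_subset_Icc_self).mul (by fun_prop))
    (fun s hs => mul_pos (h.lam_pos _ (h.ψ.map_target (hmem s (Ioc_subset_Icc_self hs))))
      (pow_pos hs.1 _))
    (fun s hs => by
      have h1 : h.lam (h.ψ.symm ((s : ℂ) * ξ)) ≤ C :=
        (le_abs_self _).trans (hC s (Ioc_subset_Icc_self hs))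
      have h2 : 0 < h.lam (h.ψ.symm ((s : ℂ) * ξ)) :=
        h.lam_pos _ (h.ψ.map_target (hmem s (Ioc_subset_Icc_self hs)))
      have h3 : s ^ (m - 2) ≤ s₀ ^ (m - 2) := pow_le_pow_left₀ hs.1.le hs.2 _
      have h4 : s ^ (m - 1) = s ^ (m - 2) * s := by rw [← pow_succ]; congr 1; lia
      rw [h4, ← mul_assoc]
      have hs1 := hs.1.le
      gcongr
      exact h2.le.trans h1)
  have hsm : ∀ t ∈ Ici (0 : ℝ), ((s t : ℝ) : ℂ) * ξ ∈ h.ψ.target := fun t ht =>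
    hmem _ (Ioc_subset_Icc_self (hsd t ht).1)
  refine ⟨fun t => h.ψ.symm ((s t : ℂ) * ξ), ?_, fun t ht => hW ⟨h.ψ.map_target (hsm t ht), ?_⟩, ?_,
    omegaLimitSet_eq_of_tendsto ?_⟩
  · beta_reduce
    rw [hs0, hdir, mul_div_cancel₀ _ hs₀c, h.ψ.left_inv hxs]
  · rw [mem_preimage, h.ψ.right_inv (hsm t ht), mem_ball_zero_iff, hnorm _ (hsd t ht).1.1.le]
    exact (hsd t ht).1.2.trans_lt hxr
  · have hsc : ContinuousOn s (Ici 0) := fun t ht => (hsd t ht).2.continuousAt.continuousWithinAt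
    refine h.isMIntegralCurveOn_of_forall (fun t ht => h.ψ.map_target (hsm t ht))
      (h.ψ.continuousOn_symm.comp ((Complex.continuous_ofReal.comp_continuousOn hsc).mul
        continuousOn_const) hsm) fun t ht => ?_
    have h1 : HasDerivWithinAt (fun t => ((s t : ℝ) : ℂ) * ξ) _ (Ici 0) t :=
      ((hsd t ht).2.ofReal_comp.mul_const ξ).hasDerivWithinAt
    refine (h1.congr (fun u hu => h.ψ.right_inv (hsm u hu)) (h.ψ.right_inv (hsm t ht))).congr_deriv ?_
    rw [h.ψ.right_inv (hsm t ht), map_mul, Complex.conj_ofReal, mul_pow, hdirc]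
    push_cast
    ring
  · have h1 : Tendsto (fun t => ((s t : ℝ) : ℂ) * ξ) atTop (𝓝 0) := by
      simpa using ((Complex.continuous_ofReal.tendsto 0).comp hst).mul_const ξ
    have h2 := h.ψ.tendsto_symm h.mem_source
    rw [h.map_center] at h2
    exact h2.comp h1

/-- In the chart the local stable set is the set of `ζ` with `‖ζ‖ < r` and `ζ ^ m` nonpositive;
division by a number `c` with `c ^ m = -r ^ m` turns it into the star. -/
theorem nonempty_homeomorph_starSet [T2Space S] [CompactSpace S] (h : GradientChart X f z m)
    (hm : 2 ≤ m) {W : Set S} {r : ℝ}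
    (hmono : ∀ γ : ℝ → S, (∀ t ∈ Ici (0 : ℝ), γ t ∈ W) → IsMIntegralCurveOn γ X (Ici 0) →
      MonotoneOn (fun t => f (γ t)) (Ici 0))
    (hr : 0 < r) (hball : Metric.closedBall 0 r ⊆ h.ψ.target)
    (hW : h.ψ.source ∩ h.ψ ⁻¹' Metric.ball 0 r ⊆ W) :
    Nonempty (↥(h.ψ.source ∩ h.ψ ⁻¹' Metric.ball 0 r ∩ stableSet X W z) ≃ₜ ↥(starSet m)) := by
  have hm0 : m ≠ 0 := by lia
  obtain ⟨η, hη, hηm⟩ := exists_pow_eq_neg_one h.one_le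
  set c : ℂ := r * η with hc
  have hcn : ‖c‖ = r := by rw [hc, norm_mul, hη, mul_one, Complex.norm_real, Real.norm_of_nonneg hr.le]
  have hc0 : c ≠ 0 := norm_pos_iff.1 (hcn ▸ hr)
  have hcm : c ^ m = -((r ^ m : ℝ) : ℂ) := by rw [hc, mul_pow, hηm]; push_cast; ring
  have hset : h.ψ.source ∩ h.ψ ⁻¹' Metric.ball 0 r ∩ stableSet X W z =
      {x | x ∈ h.ψ.source ∧ ‖h.ψ x‖ < r ∧ h.ψ x ^ m = -((‖h.ψ x‖ ^ m : ℝ) : ℂ)} := by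
    ext x
    simp only [mem_inter_iff, mem_preimage, mem_ball_zero_iff, mem_ofPred_eq]
    constructor
    · rintro ⟨⟨h1, h2⟩, h3⟩
      exact ⟨h1, h2, h.mem_rays_of_mem_stableSet hmono hr hball h1 h2 h3⟩
    · rintro ⟨h1, h2, h3⟩
      exact ⟨⟨h1, h2⟩, h.mem_stableSet_of_mem_rays hm hball hW h1 h2 h3⟩
  rw [hset]
  have hstar : ∀ x ∈ {x | x ∈ h.ψ.source ∧ ‖h.ψ x‖ < r ∧
      h.ψ x ^ m = -((‖h.ψ x‖ ^ m : ℝ) : ℂ)}, h.ψ x / c ∈ starSet m := by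
    rintro x ⟨-, h2, h3⟩
    rw [mem_starSet_iff hm0, norm_div, hcn]
    refine ⟨(div_lt_one hr).2 h2, ?_⟩
    rw [div_pow, h3, hcm, neg_div_neg_eq]
    push_cast
    rw [div_pow]
  have hmt : ∀ ζ ∈ starSet m, c * ζ ∈ h.ψ.target := fun ζ hζ => hball (by
    rw [mem_closedBall_zero_iff, norm_mul, hcn]
    exact mul_le_of_le_one_right hr.le ((mem_starSet_iff hm0).1 hζ).1.le)
  refine ⟨{
    toFun := fun x => ⟨h.ψ x / c, hstar x x.2⟩
    invFun := fun ζ => ⟨h.ψ.symm (c * ζ), h.ψ.map_target (hmt ζ ζ.2), ?_, ?_⟩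
    left_inv := fun x => Subtype.ext ?_
    right_inv := fun ζ => Subtype.ext ?_
    continuous_toFun := ?_
    continuous_invFun := ?_ }⟩
  · rw [h.ψ.right_inv (hmt ζ ζ.2), norm_mul, hcn]
    exact mul_lt_of_lt_one_right hr ((mem_starSet_iff hm0).1 ζ.2).1
  · rw [h.ψ.right_inv (hmt ζ ζ.2), norm_mul, hcn, mul_pow, hcm, ((mem_starSet_iff hm0).1 ζ.2).2]
    push_cast
    ring
  · change h.ψ.symm (c * (h.ψ x / c)) = x
    rw [mul_div_cancel₀ _ hc0, h.ψ.left_inv x.2.1]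
  · change h.ψ (h.ψ.symm (c * ζ)) / c = ζ
    rw [h.ψ.right_inv (hmt ζ ζ.2), mul_div_cancel_left₀ _ hc0]
  · exact Continuous.subtype_mk ((h.ψ.continuousOn.comp_continuous continuous_subtype_val
      fun x => x.2.1).div_const c) _
  · exact Continuous.subtype_mk (h.ψ.continuousOn_symm.comp_continuous (by fun_prop)
      fun ζ : starSet m => hmt (ζ : ℂ) ζ.2) _

end GradientChart

/-- Time reversal `t ↦ -t` exchanges the two notions, so only stable sets need to be analyzed. -/
theorem unstableSet_eq_stableSet_neg (X : (x : S) → TangentSpace (𝓡 2) x) (W : Set S) (z : S) :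
    unstableSet X W z = stableSet (fun x => -X x) W z := by
  have hlim : ∀ γ : ℝ → S, alphaLimitSet γ = omegaLimitSet (fun t => γ (-t)) := by
    intro γ
    have hneg : ∀ T : ℝ, (fun t => γ (-t)) '' Ici T = γ '' Iic (-T) := fun T => by
      rw [← Function.comp_def γ, image_comp, image_neg_eq_neg, neg_Ici]
    simp only [alphaLimitSet, omegaLimitSet, hneg]
    exact (neg_surjective.iInter_comp (g := fun T : ℝ => closure (γ '' Iic T))).symm
  have hcurve : ∀ (Y : (x : S) → TangentSpace (𝓡 2) x) (γ : ℝ → S) (s : Set ℝ),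
      IsMIntegralCurveOn γ Y s →
        IsMIntegralCurveOn (fun t => γ (-t)) (fun x => -Y x) {t | -t ∈ s} := by
    intro Y γ s h
    have h1 := h.comp_mul (-1)
    convert h1 using 1
    · ext t; simp
    · ext x; simp
    · ext t; simp
  ext x
  constructor
  · rintro ⟨γ, h0, h1, h2, h3⟩
    refine ⟨fun t => γ (-t), by simpa using h0, fun t ht => h1 _ (by simpa using ht), ?_,
      (hlim γ) ▸ h3⟩
    convert hcurve X γ _ h2 using 1
    ext t; simp
  · rintro ⟨γ, h0, h1, h2, h3⟩
    refine ⟨fun t => γ (-t), by simpa using h0, fun t ht => h1 _ (by simpa using ht), ?_, ?_⟩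
    · convert hcurve _ γ _ h2 using 1
      · ext x; simp
      · ext t; simp
    · rw [hlim]
      simpa using h3

end

section

variable {S : Type*} [TopologicalSpace S]

/-! ### The metric, the Laplacian and the gradient in charts -/

/-- The part of the complex coordinate domain of a chart that lies in `U`. -/
def complexDomain (e : OpenPartialHomeomorph S Plane) (U : Set S) : Set ℂ :=
  planeEquiv.symm ⁻¹' (e.target ∩ e.symm ⁻¹' U)

theorem planeEquiv_mem_complexDomain {e : OpenPartialHomeomorph S Plane} {U : Set S} {x : S}
    (hx : x ∈ e.source) (hxU : x ∈ U) : planeEquiv (e x) ∈ complexDomain e U := by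
  simp [complexDomain, e.map_source hx, e.left_inv hx, hxU]

variable [ChartedSpace Plane S]

theorem mdifferentiable_of_mem_smoothCharts {e : OpenPartialHomeomorph S Plane}
    (he : e ∈ smoothCharts S) : e.MDifferentiable (𝓡 2) (𝓡 2) :=
  ⟨(contMDiffOn_of_mem_maximalAtlas he).mdifferentiableOn (by simp),
    (contMDiffOn_symm_of_mem_maximalAtlas he).mdifferentiableOn (by simp)⟩

theorem contDiffOn_of_contMDiffOn {e : OpenPartialHomeomorph S Plane} (he : e ∈ smoothCharts S)
    {f : S → ℝ} {U : Set S} (hf : ContMDiffOn (𝓡 2) 𝓘(ℝ, ℝ) ∞ f U) :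
    ContDiffOn ℝ ∞ (fun u => f (e.symm u)) (e.target ∩ e.symm ⁻¹' U) := by
  rw [← contMDiffOn_iff_contDiffOn]
  exact hf.comp ((contMDiffOn_symm_of_mem_maximalAtlas he).mono inter_subset_left)
    fun u hu => hu.2

variable [IsManifold (𝓡 2) ∞ S]

theorem contDiffOn_metricMatrix (g : SurfaceMetric S) {e : OpenPartialHomeomorph S Plane}
    (he : e ∈ smoothCharts S) (i j : Fin 2) :
    ContDiffOn ℝ ∞ (fun u => metricMatrix g e u i j) e.target := by
  have hs := contMDiffOn_symm_of_mem_maximalAtlas he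
  have hvec : ∀ v : Plane, ContMDiffOn (𝓡 2) ((𝓡 2).prod 𝓘(ℝ, Plane)) ∞
      (fun u : Plane => Bundle.TotalSpace.mk' Plane (E := fun x : S => TangentSpace (𝓡 2) x)
        (e.symm u) (mfderiv (𝓡 2) (𝓡 2) e.symm u v)) e.target := by
    intro v
    have h1 := hs.contMDiffOn_tangentMapWithin (m := ∞) (by simp)
      e.open_target.uniqueMDiffOn
    have h2 : ContMDiff (𝓡 2) ((𝓡 2).prod 𝓘(ℝ, Plane)) ∞
        (fun u : Plane => (⟨u, v⟩ : TangentBundle (𝓡 2) Plane)) :=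
      contMDiff_vectorSpace_iff_contDiff.2 contDiff_const
    have h3 := h1.comp h2.contMDiffOn (s := e.target) fun u hu => hu
    refine h3.congr fun u hu => ?_
    simp only [Function.comp_apply, tangentMapWithin]
    rw [mfderivWithin_of_isOpen e.open_target hu]
  have hg : ContMDiffOn (𝓡 2) ((𝓡 2).prod 𝓘(ℝ, Plane →L[ℝ] Plane →L[ℝ] ℝ)) ∞
      (fun u : Plane => Bundle.TotalSpace.mk' (Plane →L[ℝ] Plane →L[ℝ] ℝ)
        (E := fun x : S => TangentSpace (𝓡 2) x →L[ℝ] TangentSpace (𝓡 2) x →L[ℝ] ℝ)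
        (e.symm u) (g.inner (e.symm u))) e.target :=
    g.contMDiff.comp_contMDiffOn hs
  have h4 : ContMDiffOn (𝓡 2) ((𝓡 2).prod 𝓘(ℝ, ℝ)) ∞
      (fun u : Plane => Bundle.TotalSpace.mk' ℝ (E := Bundle.Trivial S ℝ) (e.symm u)
        (g.inner (e.symm u) (mfderiv (𝓡 2) (𝓡 2) e.symm u (basisVec i))
          (mfderiv (𝓡 2) (𝓡 2) e.symm u (basisVec j)))) e.target :=
    ContMDiffOn.clm_bundle_apply₂ (F₁ := Plane) (F₂ := Plane) hg (hvec _) (hvec _)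
  rw [← contMDiffOn_iff_contDiffOn]
  intro u hu
  have h5 := h4 u hu
  simp only [Bundle.contMDiffWithinAt_totalSpace] at h5
  exact h5.2

theorem metricMatrix_symm (g : SurfaceMetric S) (e : OpenPartialHomeomorph S Plane) (u : Plane) :
    metricMatrix g e u 1 0 = metricMatrix g e u 0 1 :=
  g.symm _ _ _

theorem inner_mfderiv_symm (g : SurfaceMetric S) (e : OpenPartialHomeomorph S Plane) (u v w : Plane) :
    g.inner (e.symm u) (mfderiv (𝓡 2) (𝓡 2) e.symm u v) (mfderiv (𝓡 2) (𝓡 2) e.symm u w) =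
      ∑ i, ∑ j, v i * w j * metricMatrix g e u i j := by
  have hv : ∀ v : Plane, v = v 0 • basisVec 0 + v 1 • basisVec 1 := fun v => by
    ext i
    fin_cases i <;> simp [basisVec]
  have hL : ∀ v : Plane, mfderiv (𝓡 2) (𝓡 2) e.symm u v =
      v 0 • mfderiv (𝓡 2) (𝓡 2) e.symm u (basisVec 0) +
        v 1 • mfderiv (𝓡 2) (𝓡 2) e.symm u (basisVec 1) := fun v => by
    have h1 := congrArg (fun x : Plane => mfderiv (𝓡 2) (𝓡 2) e.symm u x) (hv v)
    refine h1.trans ?_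
    exact ((mfderiv (𝓡 2) (𝓡 2) e.symm u).map_add _ _).trans
      (congrArg₂ _ ((mfderiv (𝓡 2) (𝓡 2) e.symm u).map_smul _ _)
        ((mfderiv (𝓡 2) (𝓡 2) e.symm u).map_smul _ _))
  rw [hL v, hL w]
  simp only [map_add, map_smul, add_apply, smul_apply, smul_eq_mul, Fin.sum_univ_two, metricMatrix,
    Matrix.of_apply]
  ring

theorem metricMatrix_pos (g : SurfaceMetric S) {e : OpenPartialHomeomorph S Plane}
    (he : e ∈ smoothCharts S) {u : Plane} (hu : u ∈ e.target) {v : Plane} (hv : v ≠ 0) :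
    0 < ∑ i, ∑ j, v i * v j * metricMatrix g e u i j := by
  rw [← inner_mfderiv_symm]
  refine g.pos _ _ fun h0 => hv ?_
  have h1 := (mdifferentiable_of_mem_smoothCharts he).comp_symm_deriv hu
  have h2 := congrArg (fun L : Plane →L[ℝ] Plane => L v) h1
  refine h2.symm.trans ?_
  change mfderiv (𝓡 2) (𝓡 2) e (e.symm u) (mfderiv (𝓡 2) (𝓡 2) e.symm u v) = 0
  rw [h0]
  exact map_zero _

theorem metricMatrix_diag_pos (g : SurfaceMetric S) {e : OpenPartialHomeomorph S Plane}
    (he : e ∈ smoothCharts S) {u : Plane} (hu : u ∈ e.target) (i : Fin 2) :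
    0 < metricMatrix g e u i i := by
  have h := metricMatrix_pos g he hu (v := basisVec i) (by simp [basisVec])
  fin_cases i <;> simpa [Fin.sum_univ_two, basisVec] using h

theorem metricMatrix_det_pos (g : SurfaceMetric S) {e : OpenPartialHomeomorph S Plane}
    (he : e ∈ smoothCharts S) {u : Plane} (hu : u ∈ e.target) : 0 < (metricMatrix g e u).det := by
  have h0 := metricMatrix_diag_pos g he hu 0
  -- On this vector the quadratic form takes the value `g₀₀ · det`.
  set v : Plane := !₂[-metricMatrix g e u 0 1, metricMatrix g e u 0 0] with hv
  have h := metricMatrix_pos g he hu (v := v) (fun hv0 => by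
    have := congrArg (fun v : Plane => v 1) hv0
    simp [hv] at this
    exact h0.ne' this)
  simp only [Fin.sum_univ_two, metricMatrix_symm] at h
  rw [Matrix.det_fin_two, metricMatrix_symm]
  have hv0 : v 0 = -metricMatrix g e u 0 1 := by simp [hv]
  have hv1 : v 1 = metricMatrix g e u 0 0 := by simp [hv]
  rw [hv0, hv1] at h
  refine pos_of_mul_pos_right (a := metricMatrix g e u 0 0) ?_ h0.le
  linarith

theorem areaDensity_pos (g : SurfaceMetric S) {e : OpenPartialHomeomorph S Plane}
    (he : e ∈ smoothCharts S) {u : Plane} (hu : u ∈ e.target) : 0 < areaDensity g e u :=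
  Real.sqrt_pos.2 (metricMatrix_det_pos g he hu)

theorem contDiffOn_areaDensity (g : SurfaceMetric S) {e : OpenPartialHomeomorph S Plane}
    (he : e ∈ smoothCharts S) : ContDiffOn ℝ ∞ (areaDensity g e) e.target := by
  unfold areaDensity
  refine ContDiffOn.sqrt ?_ fun u hu => (metricMatrix_det_pos g he hu).ne'
  simp only [Matrix.det_fin_two]
  exact ((contDiffOn_metricMatrix g he 0 0).mul (contDiffOn_metricMatrix g he 1 1)).sub
    ((contDiffOn_metricMatrix g he 0 1).mul (contDiffOn_metricMatrix g he 1 0))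

theorem areaDensity_mul_self (g : SurfaceMetric S) {e : OpenPartialHomeomorph S Plane}
    (he : e ∈ smoothCharts S) {u : Plane} (hu : u ∈ e.target) :
    areaDensity g e u * areaDensity g e u = metricMatrix g e u 0 0 * metricMatrix g e u 1 1 -
      metricMatrix g e u 0 1 * metricMatrix g e u 0 1 := by
  rw [areaDensity, Real.mul_self_sqrt (metricMatrix_det_pos g he hu).le, Matrix.det_fin_two,
    metricMatrix_symm]

/-- The entry `√(det g) gⁱʲ` of the conformal class of the metric. -/
def conformalMatrix (g : SurfaceMetric S) (e : OpenPartialHomeomorph S Plane) (i j : Fin 2)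
    (u : Plane) : ℝ :=
  areaDensity g e u * (metricMatrix g e u)⁻¹ i j

theorem conformalMatrix_eq (g : SurfaceMetric S) {e : OpenPartialHomeomorph S Plane}
    (he : e ∈ smoothCharts S) {u : Plane} (hu : u ∈ e.target) :
    conformalMatrix g e 0 0 u = metricMatrix g e u 1 1 / areaDensity g e u ∧
    conformalMatrix g e 0 1 u = -metricMatrix g e u 0 1 / areaDensity g e u ∧
    conformalMatrix g e 1 0 u = -metricMatrix g e u 0 1 / areaDensity g e u ∧
    conformalMatrix g e 1 1 u = metricMatrix g e u 0 0 / areaDensity g e u := by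
  have h1 := metricMatrix_det_pos g he hu
  have h2 := areaDensity_pos g he hu
  have h3 : (metricMatrix g e u).det = areaDensity g e u * areaDensity g e u :=
    (Real.mul_self_sqrt h1.le).symm
  simp only [conformalMatrix, Matrix.inv_def, Ring.inverse_eq_inv', Matrix.adjugate_fin_two,
    Matrix.smul_apply, Matrix.of_apply, Matrix.cons_val', Matrix.cons_val_zero,
    Matrix.cons_val_one, Matrix.cons_val_fin_one, smul_eq_mul, h3, metricMatrix_symm]
  refine ⟨?_, ?_, ?_, ?_⟩ <;> field_simp

theorem contDiffOn_conformalMatrix (g : SurfaceMetric S) {e : OpenPartialHomeomorph S Plane}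
    (he : e ∈ smoothCharts S) (i j : Fin 2) :
    ContDiffOn ℝ ∞ (conformalMatrix g e i j) e.target := by
  have hσ := contDiffOn_areaDensity g he
  have hne : ∀ u ∈ e.target, areaDensity g e u ≠ 0 := fun u hu => (areaDensity_pos g he hu).ne'
  fin_cases i <;> fin_cases j
  · exact ((contDiffOn_metricMatrix g he 1 1).div hσ hne).congr fun u hu =>
      (conformalMatrix_eq g he hu).1
  · exact ((contDiffOn_metricMatrix g he 0 1).neg.div hσ hne).congr fun u hu =>
      (conformalMatrix_eq g he hu).2.1
  · exact ((contDiffOn_metricMatrix g he 0 1).neg.div hσ hne).congr fun u hu =>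
      (conformalMatrix_eq g he hu).2.2.1
  · exact ((contDiffOn_metricMatrix g he 0 0).div hσ hne).congr fun u hu =>
      (conformalMatrix_eq g he hu).2.2.2

theorem laplaceBeltrami_eq (g : SurfaceMetric S) (e : OpenPartialHomeomorph S Plane) (h : Plane → ℝ)
    (u : Plane) : laplaceBeltrami g e h u = (areaDensity g e u)⁻¹ *
      ∑ i, pderiv i (fun w => ∑ j, conformalMatrix g e i j w * pderiv j h w) u := by
  simp only [laplaceBeltrami, conformalMatrix, Finset.mul_sum, mul_assoc]

theorem fderiv_comp_planeEquiv_symm (F : Plane → ℝ) (w v : ℂ) :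
    fderiv ℝ (fun u => F (planeEquiv.symm u)) w v =
      fderiv ℝ F (planeEquiv.symm w) (planeEquiv.symm v) := by
  have := planeEquiv.symm.toContinuousLinearEquiv.comp_right_fderiv (f := F) (x := w)
  exact congrArg (fun L : ℂ →L[ℝ] ℝ => L v) this

theorem pderiv_zero_planeEquiv_symm (F : Plane → ℝ) (w : ℂ) :
    pderiv 0 F (planeEquiv.symm w) = fderiv ℝ (fun u => F (planeEquiv.symm u)) w 1 := by
  rw [fderiv_comp_planeEquiv_symm, ← planeEquiv_basisVec_zero, planeEquiv.symm_apply_apply, pderiv]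

theorem pderiv_one_planeEquiv_symm (F : Plane → ℝ) (w : ℂ) :
    pderiv 1 F (planeEquiv.symm w) = fderiv ℝ (fun u => F (planeEquiv.symm u)) w Complex.I := by
  rw [fderiv_comp_planeEquiv_symm, ← planeEquiv_basisVec_one, planeEquiv.symm_apply_apply, pderiv]

/-- The coefficients of the Laplace-Beltrami operator in the complex coordinate of a chart. -/
def conformalCoeff (g : SurfaceMetric S) (e : OpenPartialHomeomorph S Plane) (i j : Fin 2)
    (u : ℂ) : ℝ :=
  conformalMatrix g e i j (planeEquiv.symm u)

/-- In dimension two the matrix `√(det g) gⁱʲ` has determinant one, so the Laplace equation depends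
only on the conformal class and the planar theory applies. -/
theorem HarmonicOnSurface.isDivFormHarmonic {g : SurfaceMetric S} {f : S → ℝ} {U : Set S}
    (h : HarmonicOnSurface g f U) (hU : IsOpen U) {e : OpenPartialHomeomorph S Plane}
    (he : e ∈ smoothCharts S) :
    IsDivFormHarmonic (conformalCoeff g e 0 0) (conformalCoeff g e 0 1) (conformalCoeff g e 1 1)
      (complexCoord e f) (complexDomain e U) := by
  have hop : IsOpen (e.target ∩ e.symm ⁻¹' U) := e.symm.isOpen_inter_preimage hU
  have hmaps : MapsTo planeEquiv.symm (complexDomain e U) e.target := fun u hu => hu.1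
  have hsm : ContDiff ℝ ∞ planeEquiv.symm := planeEquiv.symm.contDiff
  have hc : ∀ i j, ContDiffOn ℝ ∞ (conformalCoeff g e i j) (complexDomain e U) := fun i j =>
    (contDiffOn_conformalMatrix g he i j).comp hsm.contDiffOn hmaps
  refine ⟨hop.preimage planeEquiv.symm.continuous, hc 0 0, hc 0 1, hc 1 1,
    (contDiffOn_of_contMDiffOn he h.1).comp hsm.contDiffOn fun u hu => hu,
    fun u hu => ?_, fun u hu => ?_, fun u hu => ?_⟩
  · obtain ⟨h1, h2, -, h4⟩ := conformalMatrix_eq g he hu.1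
    simp only [conformalCoeff, h1, h2, h4]
    have h5 := areaDensity_mul_self g he hu.1
    have h6 := (areaDensity_pos g he hu.1).ne'
    field_simp
    linarith
  · obtain ⟨h1, -, -, h4⟩ := conformalMatrix_eq g he hu.1
    simp only [conformalCoeff, h1, h4]
    exact add_pos (div_pos (metricMatrix_diag_pos g he hu.1 1) (areaDensity_pos g he hu.1))
      (div_pos (metricMatrix_diag_pos g he hu.1 0) (areaDensity_pos g he hu.1))
  · have h1 := h.2 e he _ hu.1 hu.2
    rw [laplaceBeltrami_eq, mul_eq_zero] at h1
    have h2 := h1.resolve_left (inv_ne_zero (areaDensity_pos g he hu.1).ne')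
    rw [Fin.sum_univ_two, pderiv_zero_planeEquiv_symm, pderiv_one_planeEquiv_symm] at h2
    simp only [Fin.sum_univ_two, pderiv_zero_planeEquiv_symm, pderiv_one_planeEquiv_symm] at h2
    rw [← h2]
    congr 1
    -- The two off-diagonal entries are known to agree only over the chart target, which suffices
    -- for a derivative.
    have h3 : (fun u => conformalCoeff g e 0 1 u * fderiv ℝ (complexCoord e f) u 1 +
        conformalCoeff g e 1 1 u * fderiv ℝ (complexCoord e f) u Complex.I) =ᶠ[𝓝 u]
        fun u => conformalMatrix g e 1 0 (planeEquiv.symm u) * fderiv ℝ (complexCoord e f) u 1 +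
        conformalMatrix g e 1 1 (planeEquiv.symm u) * fderiv ℝ (complexCoord e f) u Complex.I := by
      filter_upwards [(hop.preimage planeEquiv.symm.continuous).mem_nhds hu] with v hv
      obtain ⟨-, h4, h5, -⟩ := conformalMatrix_eq g he hv.1
      rw [conformalCoeff, conformalCoeff, h4, ← h5]
    rw [h3.fderiv_eq]
    rfl

/-- The gradient in the complex coordinate of a chart. -/
theorem planeEquiv_coordField_gradientField (g : SurfaceMetric S) {f : S → ℝ}
    {e : OpenPartialHomeomorph S Plane} (he : e ∈ smoothCharts S) {u : Plane} (hu : u ∈ e.target)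
    (hf : MDifferentiableAt (𝓡 2) 𝓘(ℝ, ℝ) f (e.symm u)) :
    planeEquiv (coordField (gradientField g f) e u) = ((areaDensity g e u)⁻¹ : ℝ) *
      fluxField (conformalCoeff g e 0 0) (conformalCoeff g e 0 1) (conformalCoeff g e 1 1)
        (complexCoord e f) (planeEquiv u) := by
  have hm := mdifferentiable_of_mem_smoothCharts he
  set V : Plane := coordField (gradientField g f) e u with hV
  -- Returning to the surface permits use of the defining property of the gradient; the metric
  -- matrix is then inverted explicitly.
  have hJ : mfderiv (𝓡 2) (𝓡 2) e.symm u V = gradientField g f (e.symm u) := by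
    have h1 := hm.symm_comp_deriv (e.map_target hu)
    rw [e.right_inv hu] at h1
    exact congrArg (fun L : TangentSpace (𝓡 2) (e.symm u) →L[ℝ] TangentSpace (𝓡 2) (e.symm u) =>
      L (gradientField g f (e.symm u))) h1
  have hp : ∀ i, pderiv i (fun w => f (e.symm w)) u =
      ∑ k, ∑ j, V k * basisVec i j * metricMatrix g e u k j := by
    intro i
    rw [← inner_mfderiv_symm, hJ, inner_gradientField, pderiv, ← mfderiv_eq_fderiv]
    have h2 := mfderiv_comp u hf (hm.mdifferentiableAt_symm hu)
    exact congrArg (fun L : Plane →L[ℝ] ℝ => L (basisVec i)) h2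
  have h0 := hp 0
  have h1 := hp 1
  obtain ⟨c1, c2, -, c4⟩ := conformalMatrix_eq g he hu
  have hσ := areaDensity_mul_self g he hu
  have hσ0 := (areaDensity_pos g he hu).ne'
  have q0 : fderiv ℝ (complexCoord e f) (planeEquiv u) 1 = pderiv 0 (fun w => f (e.symm w)) u := by
    have := pderiv_zero_planeEquiv_symm (fun w => f (e.symm w)) (planeEquiv u)
    rw [planeEquiv.symm_apply_apply] at this
    exact this.symm
  have q1 : fderiv ℝ (complexCoord e f) (planeEquiv u) Complex.I =
      pderiv 1 (fun w => f (e.symm w)) u := by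
    have := pderiv_one_planeEquiv_symm (fun w => f (e.symm w)) (planeEquiv u)
    rw [planeEquiv.symm_apply_apply] at this
    exact this.symm
  simp only [Fin.sum_univ_two, basisVec, metricMatrix_symm, PiLp.single_apply, if_true,
    Fin.isValue, one_ne_zero, zero_ne_one, if_false, mul_one, mul_zero, zero_mul, add_zero,
    zero_add] at h0 h1
  rw [planeEquiv_apply, fluxField, q0, q1, h0, h1]
  simp only [conformalCoeff, planeEquiv.symm_apply_apply, c1, c2, c4]
  have e0 : V 0 = (areaDensity g e u)⁻¹ * (metricMatrix g e u 1 1 / areaDensity g e u *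
      (V 0 * metricMatrix g e u 0 0 + V 1 * metricMatrix g e u 0 1) +
      -metricMatrix g e u 0 1 / areaDensity g e u *
      (V 0 * metricMatrix g e u 0 1 + V 1 * metricMatrix g e u 1 1)) := by
    field_simp
    rw [pow_two, hσ]
    ring
  have e1 : V 1 = (areaDensity g e u)⁻¹ * (-metricMatrix g e u 0 1 / areaDensity g e u *
      (V 0 * metricMatrix g e u 0 0 + V 1 * metricMatrix g e u 0 1) +
      metricMatrix g e u 0 0 / areaDensity g e u *
      (V 0 * metricMatrix g e u 0 1 + V 1 * metricMatrix g e u 1 1)) := by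
    field_simp
    rw [pow_two, hσ]
    ring
  conv_lhs => rw [e0, e1]
  push_cast
  ring

end

section

/-! ### Trajectories in coordinates -/

theorem OpenPartialHomeomorph.hasDerivWithinAt_comp_wirtinger_iff (w : OpenPartialHomeomorph ℂ ℂ)
    {α β : ℂ} (hlt : ‖β‖ < ‖α‖) {ζ : ℝ → ℂ} {s : Set ℝ} {t : ℝ} (ht : ζ t ∈ w.source)
    (hc : ContinuousWithinAt ζ s t) (hw : HasFDerivAt w (wirtinger α β) (ζ t)) {v : ℂ} :
    HasDerivWithinAt ζ v s t ↔
      HasDerivWithinAt (fun t => w (ζ t)) (wirtinger α β v) s t := by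
  refine ⟨fun h => hw.comp_hasDerivWithinAt t h, fun h => ?_⟩
  rw [← coe_wirtingerEquiv α β hlt] at hw h
  have h1 : HasFDerivAt w.symm ((wirtingerEquiv α β hlt).symm : ℂ →L[ℝ] ℂ) (w (ζ t)) :=
    w.hasFDerivAt_symm (w.map_source ht) (by rwa [w.left_inv ht])
  have h2 := h1.comp_hasDerivWithinAt t h
  simp only [ContinuousLinearEquiv.coe_coe, ContinuousLinearEquiv.symm_apply_apply] at h2
  refine h2.congr_of_eventuallyEq ?_ (w.left_inv ht).symm
  filter_upwards [hc.eventually (w.open_source.mem_nhds ht)] with u hu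
  exact (w.left_inv hu).symm

variable {S : Type*} [TopologicalSpace S] [ChartedSpace Plane S]

/-- Both the chart and its inverse are differentiable. Continuity of the curve keeps it in the chart
domain near `t`, so that it can be recovered from its coordinates. -/
theorem hasMFDerivWithinAt_curve_iff {e : OpenPartialHomeomorph S Plane} (he : e ∈ smoothCharts S)
    {γ : ℝ → S} {s : Set ℝ} {t : ℝ} (ht : γ t ∈ e.source) (hc : ContinuousWithinAt γ s t)
    (v : TangentSpace (𝓡 2) (γ t)) :
    HasMFDerivWithinAt 𝓘(ℝ, ℝ) (𝓡 2) γ s t ((1 : ℝ →L[ℝ] ℝ).smulRight v) ↔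
      HasDerivWithinAt (fun t => planeEquiv (e (γ t)))
        (planeEquiv (mfderiv (𝓡 2) (𝓡 2) e (γ t) v)) s t := by
  have hm := mdifferentiable_of_mem_smoothCharts he
  set L : Plane →L[ℝ] Plane := mfderiv (𝓡 2) (𝓡 2) e (γ t) with hL
  set V : Plane := v with hV
  have hflat : HasDerivWithinAt (fun t => planeEquiv (e (γ t))) (planeEquiv (L V)) s t ↔
      HasDerivWithinAt (fun t => e (γ t)) (L V) s t := by
    constructor <;> intro h
    · have := planeEquiv.symm.toContinuousLinearEquiv.toContinuousLinearMap.hasFDerivAt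
        |>.comp_hasDerivWithinAt t h
      simpa [Function.comp_def] using this
    · exact planeEquiv.toContinuousLinearEquiv.toContinuousLinearMap.hasFDerivAt
        |>.comp_hasDerivWithinAt t h
  refine Iff.trans ?_ hflat.symm
  constructor
  · intro h
    have h1 := (hm.mdifferentiableAt ht).hasMFDerivAt.comp_hasMFDerivWithinAt t h
    have h2 : HasFDerivWithinAt (fun t => e (γ t)) (L.comp ((1 : ℝ →L[ℝ] ℝ).smulRight V)) s t :=
      h1.hasFDerivWithinAt
    refine h2.hasDerivWithinAt.congr_deriv ?_
    simp
  · intro h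
    have h1 : HasMFDerivWithinAt 𝓘(ℝ, ℝ) (𝓡 2) (fun t => e (γ t)) s t
        ((1 : ℝ →L[ℝ] ℝ).smulRight (L V)) :=
      h.hasFDerivWithinAt.hasMFDerivWithinAt
    have h2 := (hm.mdifferentiableAt_symm (e.map_source ht)).hasMFDerivAt.comp_hasMFDerivWithinAt
      t h1
    have h3 := h2.congr_of_eventuallyEq (f₁ := γ) (by
      filter_upwards [hc.eventually (e.open_source.mem_nhds ht)] with u hu
      exact (e.left_inv hu).symm) (e.left_inv ht).symm
    refine h3.congr_mfderiv ?_
    have h4 := hm.symm_comp_deriv ht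
    set J : Plane →L[ℝ] Plane := mfderiv (𝓡 2) (𝓡 2) e.symm (e (γ t)) with hJ
    have h5 : J.comp L = ContinuousLinearMap.id ℝ Plane := h4
    have h6 : J (L V) = V := congrArg (fun A : Plane →L[ℝ] Plane => A V) h5
    have h7 : J.comp ((1 : ℝ →L[ℝ] ℝ).smulRight (L V)) = (1 : ℝ →L[ℝ] ℝ).smulRight V := by
      ext1
      simp [h6]
    exact h7

/-- The speed factor combines the area density, which converts flux into gradient, with the Jacobian
from `PowerNormalForm.wirtinger_field`; both are positive and continuous. -/
theorem exists_gradientChart [IsManifold (𝓡 2) ∞ S] {g : SurfaceMetric S} {f : S → ℝ} {U : Set S}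
    (h : HarmonicOnSurface g f U) (hU : IsOpen U) {e : OpenPartialHomeomorph S Plane}
    (he : e ∈ smoothCharts S) {z : S} (hz : z ∈ e.source) (hzU : z ∈ U) {m : ℕ}
    (p : PowerNormalForm (complexCoord e f) (fluxField (conformalCoeff g e 0 0)
      (conformalCoeff g e 0 1) (conformalCoeff g e 1 1) (complexCoord e f)) (planeEquiv (e z)) m) :
    Nonempty (GradientChart (gradientField g f) f z m) := by
  set ψ : OpenPartialHomeomorph S ℂ :=
    ((e.transHomeomorph planeEquiv.toHomeomorph).trans p.w).restr U with hψ
  have hsrc : ∀ x ∈ ψ.source, x ∈ e.source ∧ planeEquiv (e x) ∈ p.w.source ∧ x ∈ U := by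
    intro x hx
    simp only [hψ, OpenPartialHomeomorph.restr_source, hU.interior_eq,
      OpenPartialHomeomorph.trans_source, OpenPartialHomeomorph.transHomeomorph_source] at hx
    exact ⟨hx.1.1, hx.1.2, hx.2⟩
  have hmem : z ∈ ψ.source := by
    simp only [hψ, OpenPartialHomeomorph.restr_source, hU.interior_eq,
      OpenPartialHomeomorph.trans_source, OpenPartialHomeomorph.transHomeomorph_source]
    exact ⟨⟨hz, p.mem_source⟩, hzU⟩
  have hψe : ∀ x, ψ x = p.w (planeEquiv (e x)) := fun x => rfl
  have hm0 : (0 : ℝ) < m := by exact_mod_cast p.one_le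
  have hce : ContinuousOn (fun x => planeEquiv (e x)) ψ.source :=
    planeEquiv.continuous.comp_continuousOn (e.continuousOn.mono fun x hx => (hsrc x hx).1)
  have hmaps : MapsTo (fun x => planeEquiv (e x)) ψ.source p.w.source := fun x hx => (hsrc x hx).2.1
  refine ⟨{
    ψ := ψ
    lam := fun x => (areaDensity g e (e x))⁻¹ *
      (m * (‖p.α (planeEquiv (e x))‖ ^ 2 - ‖p.β (planeEquiv (e x))‖ ^ 2))
    one_le := p.one_le
    mem_source := hmem
    map_center := (hψe z).trans p.map_center
    lam_pos := fun x hx => ?_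
    continuousOn_lam := ?_
    eq_re := fun x hx => ?_
    hasDeriv_iff := fun γ s t c ht hc => ?_ }⟩
  · obtain ⟨h1, h2, h3⟩ := hsrc x hx
    refine mul_pos (inv_pos.2 (areaDensity_pos g he (e.map_source h1))) (mul_pos hm0 (sub_pos.2 ?_))
    exact pow_lt_pow_left₀ (p.norm_lt _ h2) (norm_nonneg _) two_ne_zero
  · refine ContinuousOn.mul (ContinuousOn.inv₀ ((contDiffOn_areaDensity g he).continuousOn.comp
      (e.continuousOn.mono fun x hx => (hsrc x hx).1) fun x hx => e.map_source (hsrc x hx).1)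
      fun x hx => (areaDensity_pos g he (e.map_source (hsrc x hx).1)).ne') ?_
    exact continuousOn_const.mul (((p.continuousOn_α.comp hce hmaps).norm.pow 2).sub
      ((p.continuousOn_β.comp hce hmaps).norm.pow 2))
  · have h1 := p.eq_re _ (hsrc x hx).2.1
    rwa [complexCoord_planeEquiv e f (hsrc x hx).1, complexCoord_planeEquiv e f hz] at h1
  · obtain ⟨h1, h2, h3⟩ := hsrc _ ht
    have hce' : ContinuousWithinAt (fun t => planeEquiv (e (γ t))) s t :=
      planeEquiv.continuous.continuousAt.comp_continuousWithinAt
        ((e.continuousAt h1).comp_continuousWithinAt hc)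
    refine ((hasMFDerivWithinAt_curve_iff he h1 hc _).trans
      (p.w.hasDerivWithinAt_comp_wirtinger_iff (ζ := fun t => planeEquiv (e (γ t)))
        (p.norm_lt _ h2) h2 hce' (p.hasFDerivAt _ h2))).trans ?_
    have hd : MDifferentiableAt (𝓡 2) 𝓘(ℝ, ℝ) f (e.symm (e (γ t))) := by
      rw [e.left_inv h1]
      exact (h.1.contMDiffAt (hU.mem_nhds h3)).mdifferentiableAt (by simp)
    have h4 := planeEquiv_coordField_gradientField g he (e.map_source h1) hd
    rw [coordField, e.left_inv h1] at h4
    have h5 : planeEquiv (mfderiv (𝓡 2) (𝓡 2) e (γ t) (c • gradientField g f (γ t))) =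
        ((c * (areaDensity g e (e (γ t)))⁻¹ : ℝ) : ℂ) * fluxField (conformalCoeff g e 0 0)
          (conformalCoeff g e 0 1) (conformalCoeff g e 1 1) (complexCoord e f)
            (planeEquiv (e (γ t))) := by
      have h6 := (mfderiv (𝓡 2) (𝓡 2) e (γ t)).map_smul c (gradientField g f (γ t))
      refine (congrArg planeEquiv h6).trans ?_
      refine (planeEquiv.map_smul c _).trans ?_
      refine (congrArg (c • ·) h4).trans ?_
      rw [Complex.real_smul]
      push_cast
      ring
    rw [h5, ← Complex.real_smul, map_smul, p.wirtinger_field h2, Complex.real_smul, ← hψe]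
    refine iff_of_eq (congrArg (fun v => HasDerivWithinAt (fun t => ψ (γ t)) v s t) ?_)
    push_cast
    ring

end

section

variable {S : Type*} [TopologicalSpace S] [ChartedSpace Plane S]

/-! ### Critical points of harmonic functions on the surface -/

theorem IsMIntegralCurveOn.monotoneOn {X : (x : S) → TangentSpace (𝓡 2) x} {f : S → ℝ} {W : Set S}
    (hf : ∀ x ∈ W, MDifferentiableAt (𝓡 2) 𝓘(ℝ, ℝ) f x)
    (hX : ∀ x ∈ W, (0 : ℝ) ≤ mfderiv (𝓡 2) 𝓘(ℝ, ℝ) f x (X x)) {γ : ℝ → S}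
    (hW : ∀ t ∈ Ici (0 : ℝ), γ t ∈ W) (hγ : IsMIntegralCurveOn γ X (Ici 0)) :
    MonotoneOn (fun t => f (γ t)) (Ici 0) := by
  have hd : ∀ t ∈ Ici (0 : ℝ), HasDerivWithinAt (fun t => f (γ t))
      (mfderiv (𝓡 2) 𝓘(ℝ, ℝ) f (γ t) (X (γ t)) : ℝ) (Ici 0) t := by
    intro t ht
    have h1 := (hf _ (hW t ht)).hasMFDerivAt.comp_hasMFDerivWithinAt t (hγ t ht)
    set L : Plane →L[ℝ] ℝ := mfderiv (𝓡 2) 𝓘(ℝ, ℝ) f (γ t) with hL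
    set V : Plane := X (γ t) with hV
    have h2 : HasFDerivWithinAt (fun t => f (γ t)) (L.comp ((1 : ℝ →L[ℝ] ℝ).smulRight V))
        (Ici 0) t := h1.hasFDerivWithinAt
    have h3 : HasDerivWithinAt (fun t => f (γ t)) (L V) (Ici 0) t := by
      refine h2.hasDerivWithinAt.congr_deriv ?_
      simp
    exact h3
  refine monotoneOn_of_hasDerivWithinAt_nonneg (convex_Ici 0)
    (fun t ht => (hd t ht).continuousWithinAt) (fun t ht => (hd t (interior_subset ht)).mono
      interior_subset) fun t ht => hX _ (hW t (interior_subset ht))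

namespace GradientChart

variable {X : (x : S) → TangentSpace (𝓡 2) x} {f : S → ℝ} {z : S} {m : ℕ}

theorem exists_radius (h : GradientChart X f z m) {W : Set S} (hW : W ∈ 𝓝 z) :
    ∃ R > 0, ∀ r ≤ R, Metric.closedBall 0 r ⊆ h.ψ.target ∧
      h.ψ.source ∩ h.ψ ⁻¹' Metric.ball 0 r ⊆ W := by
  have h1 := h.ψ.tendsto_symm h.mem_source hW
  have h2 := h.ψ.open_target.mem_nhds (h.ψ.map_source h.mem_source)
  rw [h.map_center] at h1 h2
  obtain ⟨R, hR, hRs⟩ := Metric.nhds_basis_closedBall.mem_iff.1 (inter_mem h1 h2)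
  refine ⟨R, hR, fun r hr => ⟨fun ζ hζ => (hRs (Metric.closedBall_subset_closedBall hr hζ)).2,
    fun x hx => ?_⟩⟩
  have h3 := (hRs (Metric.closedBall_subset_closedBall hr
    (Metric.ball_subset_closedBall hx.2))).1
  rwa [mem_preimage, h.ψ.left_inv hx.1] at h3

/-- One disk serves both sets: the rotated chart for the opposite field has the same domain and the
same norm. -/
theorem exists_isOpen_homeomorph_starSet [T2Space S] [CompactSpace S] (h : GradientChart X f z m)
    (hm : 2 ≤ m) {W : Set S} (hW : W ∈ 𝓝 z) (hf : ∀ x ∈ W, MDifferentiableAt (𝓡 2) 𝓘(ℝ, ℝ) f x)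
    (hX : ∀ x ∈ W, (0 : ℝ) ≤ mfderiv (𝓡 2) 𝓘(ℝ, ℝ) f x (X x)) {V : Set S} (hV : V ∈ 𝓝 z) :
    ∃ U : Set S, IsOpen U ∧ z ∈ U ∧ U ⊆ V ∧
      Nonempty (↥(U ∩ stableSet X W z) ≃ₜ ↥(starSet m)) ∧
      Nonempty (↥(U ∩ unstableSet X W z) ≃ₜ ↥(starSet m)) := by
  obtain ⟨h', hs, hn⟩ := h.exists_neg
  obtain ⟨R, hR, hRs⟩ := h.exists_radius (inter_mem hV hW)
  obtain ⟨R', hR', hRs'⟩ := h'.exists_radius hW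
  have hpos := lt_min hR hR'
  obtain ⟨h1, h2⟩ := hRs _ (min_le_left R R')
  obtain ⟨h3, h4⟩ := hRs' _ (min_le_right R R')
  have hU : h'.ψ.source ∩ h'.ψ ⁻¹' Metric.ball 0 (min R R') =
      h.ψ.source ∩ h.ψ ⁻¹' Metric.ball 0 (min R R') := by
    ext x
    simp only [mem_inter_iff, mem_preimage, mem_ball_zero_iff, hs, hn]
  refine ⟨h.ψ.source ∩ h.ψ ⁻¹' Metric.ball 0 (min R R'),
    h.ψ.isOpen_inter_preimage Metric.isOpen_ball, ⟨h.mem_source, ?_⟩,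
    fun x hx => (h2 hx).1, ?_, ?_⟩
  · rw [mem_preimage, h.map_center]
    exact Metric.mem_ball_self hpos
  · exact h.nonempty_homeomorph_starSet hm (fun γ hW hγ => hγ.monotoneOn hf hX hW) hpos h1
      fun x hx => (h2 hx).2
  · rw [unstableSet_eq_stableSet_neg, ← hU]
    refine h'.nonempty_homeomorph_starSet hm (fun γ hW hγ => hγ.monotoneOn
      (fun x hx => (hf x hx).neg) (fun x hx => ?_) hW) hpos h3 h4
    set L : Plane →L[ℝ] ℝ := mfderiv (𝓡 2) 𝓘(ℝ, ℝ) f x with hL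
    set L' : Plane →L[ℝ] ℝ := mfderiv (𝓡 2) 𝓘(ℝ, ℝ) (-f) x with hL'
    set v : Plane := X x with hv
    have h5 : L' = -L := mfderiv_neg
    have h6 : (0 : ℝ) ≤ L v := hX x hx
    have h7 : (0 : ℝ) ≤ L' (-v) := by rw [h5]; simpa using h6
    exact h7

end GradientChart

variable [IsManifold (𝓡 2) ∞ S] {g : SurfaceMetric S} {f : S → ℝ} {U : Set S} {z : S}

theorem mfderiv_gradientField_nonneg (g : SurfaceMetric S) (f : S → ℝ) (x : S) :
    (0 : ℝ) ≤ mfderiv (𝓡 2) 𝓘(ℝ, ℝ) f x (gradientField g f x) := by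
  have h1 := inner_gradientField g f x (gradientField g f x)
  by_cases h0 : gradientField g f x = 0
  · set L : Plane →L[ℝ] ℝ := mfderiv (𝓡 2) 𝓘(ℝ, ℝ) f x with hL
    have h2 : (0 : ℝ) ≤ L 0 := (map_zero L).ge
    rw [h0]
    exact h2
  · exact (le_of_lt (g.pos x _ h0)).trans (le_of_eq h1)

namespace HarmonicOnSurface

theorem mdifferentiableAt (h : HarmonicOnSurface g f U) (hU : IsOpen U) {x : S} (hx : x ∈ U) :
    MDifferentiableAt (𝓡 2) 𝓘(ℝ, ℝ) f x :=
  (h.1.contMDiffAt (hU.mem_nhds hx)).mdifferentiableAt (by simp)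

theorem exists_powerNormalForm (h : HarmonicOnSurface g f U) (hU : IsOpen U) (hzU : z ∈ U)
    (hne : ¬ ∀ᶠ x in 𝓝 z, f x = f z) {e : OpenPartialHomeomorph S Plane}
    (he : e ∈ smoothCharts S) (hz : z ∈ e.source) :
    ∃ m, Nonempty (PowerNormalForm (complexCoord e f) (fluxField (conformalCoeff g e 0 0)
      (conformalCoeff g e 0 1) (conformalCoeff g e 1 1) (complexCoord e f))
      (planeEquiv (e z)) m) := by
  refine (h.isDivFormHarmonic hU he).exists_powerNormalForm (planeEquiv_mem_complexDomain hz hzU)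
    fun hc => hne ?_
  have h1 : Tendsto (fun x => planeEquiv (e x)) (𝓝 z) (𝓝 (planeEquiv (e z))) :=
    planeEquiv.continuous.continuousAt.comp (e.continuousAt hz)
  filter_upwards [h1.eventually hc, e.open_source.mem_nhds hz] with x hx hxs
  rwa [complexCoord_planeEquiv e f hxs, complexCoord_planeEquiv e f hz] at hx

variable {e : OpenPartialHomeomorph S Plane} {m : ℕ}

theorem gradientField_ne_zero (h : HarmonicOnSurface g f U) (hU : IsOpen U)
    (he : e ∈ smoothCharts S) {x : S} (hx : x ∈ e.source) (hxU : x ∈ U)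
    (hV : fluxField (conformalCoeff g e 0 0) (conformalCoeff g e 0 1) (conformalCoeff g e 1 1)
      (complexCoord e f) (planeEquiv (e x)) ≠ 0) : gradientField g f x ≠ 0 := by
  intro h0
  have h1 := planeEquiv_coordField_gradientField g he (e.map_source hx) (f := f) (by
    rw [e.left_inv hx]; exact h.mdifferentiableAt hU hxU)
  have h2 : coordField (gradientField g f) e (e x) = 0 := by
    rw [coordField, e.left_inv hx, h0]
    exact map_zero (mfderiv (𝓡 2) (𝓡 2) e x)
  rw [h2, map_zero, eq_comm, mul_eq_zero] at h1
  refine h1.elim (fun h3 => ?_) hV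
  exact (areaDensity_pos g he (e.map_source hx)).ne' (inv_eq_zero.1 (by exact_mod_cast h3))

/-- For `m = 1` the flux at the center is `conj α - β`, which is nonzero as `‖β‖ < ‖α‖`. -/
theorem two_le_of_gradientField_eq_zero (h : HarmonicOnSurface g f U) (hU : IsOpen U) (hzU : z ∈ U)
    (he : e ∈ smoothCharts S) (hz : z ∈ e.source) (h0 : gradientField g f z = 0)
    (p : PowerNormalForm (complexCoord e f) (fluxField (conformalCoeff g e 0 0)
      (conformalCoeff g e 0 1) (conformalCoeff g e 1 1) (complexCoord e f))
      (planeEquiv (e z)) m) : 2 ≤ m := by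
  by_contra hlt
  obtain rfl : m = 1 := by have := p.one_le; lia
  refine h.gradientField_ne_zero hU he hz hzU ?_ h0
  rw [p.field_eq _ p.mem_source]
  intro h1
  have h2 := congrArg norm (sub_eq_zero.1 h1)
  simp only [Nat.cast_one, Nat.sub_self, pow_zero, one_mul, RCLike.norm_conj] at h2
  exact (p.norm_lt _ p.mem_source).ne' h2

theorem eventually_gradientField_ne_zero (h : HarmonicOnSurface g f U) (hU : IsOpen U)
    (hzU : z ∈ U) (he : e ∈ smoothCharts S) (hz : z ∈ e.source)
    (p : PowerNormalForm (complexCoord e f) (fluxField (conformalCoeff g e 0 0)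
      (conformalCoeff g e 0 1) (conformalCoeff g e 1 1) (complexCoord e f))
      (planeEquiv (e z)) m) : ∀ᶠ x in 𝓝[≠] z, gradientField g f x ≠ 0 := by
  have h1 : ContinuousAt (fun x => planeEquiv (e x)) z :=
    planeEquiv.continuous.continuousAt.comp (e.continuousAt hz)
  filter_upwards [nhdsWithin_le_nhds (h1.eventually (p.w.open_source.mem_nhds p.mem_source)),
    nhdsWithin_le_nhds (e.open_source.mem_nhds hz), nhdsWithin_le_nhds (hU.mem_nhds hzU),
    self_mem_nhdsWithin] with x hx1 hx2 hx3 hx4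
  refine h.gradientField_ne_zero hU he hx2 hx3 (p.field_ne_zero hx1 fun hc => hx4 ?_)
  exact e.injOn hx2 hz (planeEquiv.injective hc)

/-- The gradient is the flux divided by the area density, and this positive factor does not affect
the angle. -/
theorem hasIndexInChart (h : HarmonicOnSurface g f U) (hU : IsOpen U)
    (hzU : z ∈ U) (he : e ∈ smoothCharts S) (hz : z ∈ e.source)
    (p : PowerNormalForm (complexCoord e f) (fluxField (conformalCoeff g e 0 0)
      (conformalCoeff g e 0 1) (conformalCoeff g e 1 1) (complexCoord e f))
      (planeEquiv (e z)) m) : HasIndexInChart (gradientField g f) e z (1 - (m : ℤ)) := by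
  have hN : e.target ∩ e.symm ⁻¹' U ∈ 𝓝 (e z) :=
    (e.symm.isOpen_inter_preimage hU).mem_nhds ⟨e.map_source hz, by simp [e.left_inv hz, hzU]⟩
  obtain ⟨ε, hε, hεN⟩ := Metric.mem_nhds_iff.1 hN
  have hnorm : ∀ θ, ‖circlePt θ‖ = 1 := fun θ => by
    rw [← planeEquiv.norm_map, planeEquiv_circlePt, Complex.norm_exp_ofReal_mul_I]
  filter_upwards [p.eventually_field_circle, Ioo_mem_nhdsGT hε] with r hr hrε
  obtain ⟨-, ρ, η, hρ, hη, hper, hV⟩ := hr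
  have hmem : ∀ θ, e z + r • circlePt θ ∈ e.target ∩ e.symm ⁻¹' U := fun θ => hεN (by
    rw [mem_ball_iff_norm, add_sub_cancel_left, norm_smul, hnorm, mul_one, Real.norm_of_nonneg
      hrε.1.le]
    exact hrε.2)
  refine hasWindingNumber_of_planeEquiv_eq
    (ρ := fun θ => (areaDensity g e (e z + r • circlePt θ))⁻¹ * ρ θ)
    (fun θ => mul_pos (inv_pos.2 (areaDensity_pos g he (hmem θ).1)) (hρ θ)) hη hper fun θ => ?_
  rw [planeEquiv_coordField_gradientField g he (hmem θ).1
    (h.mdifferentiableAt hU (hmem θ).2), map_add, map_smul, planeEquiv_circlePt,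
    Complex.real_smul, hV θ]
  push_cast
  ring

theorem isLowestDegree (h : HarmonicOnSurface g f U) (hU : IsOpen U)
    (hzU : z ∈ U) (he : e ∈ smoothCharts S) (hz : z ∈ e.source) {V : ℂ → ℂ}
    (p : PowerNormalForm (complexCoord e f) V (planeEquiv (e z)) m) : IsLowestDegree f e z m :=
  p.isLowestDegree hz ((e.symm.isOpen_inter_preimage hU).mem_nhds
    ⟨e.map_source hz, by simp [e.left_inv hz, hzU]⟩) (contDiffOn_of_contMDiffOn he h.1)

/-- The structure of a harmonic function near a critical point. -/
theorem critical_point (h : HarmonicOnSurface g f U) (hU : IsOpen U) (hzU : z ∈ U)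
    (hne : ¬ ∀ᶠ x in 𝓝 z, f x = f z) (h0 : gradientField g f z = 0) :
    ∃ m : ℕ, 2 ≤ m ∧ (∀ e ∈ smoothCharts S, z ∈ e.source → IsLowestDegree f e z m) ∧
      (∀ᶠ x in 𝓝[≠] z, gradientField g f x ≠ 0) ∧
      Nonempty (GradientChart (gradientField g f) f z m) ∧
      ∀ e ∈ smoothCharts S, z ∈ e.source →
        HasIndexInChart (gradientField g f) e z (1 - (m : ℤ)) := by
  have he₀ : chartAt Plane z ∈ smoothCharts S := IsManifold.chart_mem_maximalAtlas z
  have hz₀ := mem_chart_source Plane z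
  obtain ⟨m, ⟨p⟩⟩ := h.exists_powerNormalForm hU hzU hne he₀ hz₀
  have hdiff : ∀ e ∈ smoothCharts S, ∀ e' ∈ smoothCharts S, z ∈ e.source → z ∈ e'.source →
      DifferentiableAt ℝ (fun u => e (e'.symm u)) (e' z) := by
    intro e he e' he' hz hz'
    have h1 := (mdifferentiable_of_mem_smoothCharts he').mdifferentiableAt_symm (e'.map_source hz')
    have h2 : MDifferentiableAt (𝓡 2) (𝓡 2) e (e'.symm (e' z)) := by
      rw [e'.left_inv hz']
      exact (mdifferentiable_of_mem_smoothCharts he).mdifferentiableAt hz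
    exact (h2.comp (e' z) h1).differentiableAt
  have hp : ∀ e ∈ smoothCharts S, z ∈ e.source → Nonempty (PowerNormalForm (complexCoord e f)
      (fluxField (conformalCoeff g e 0 0) (conformalCoeff g e 0 1) (conformalCoeff g e 1 1)
        (complexCoord e f)) (planeEquiv (e z)) m) := by
    intro e he hz
    obtain ⟨m', ⟨p'⟩⟩ := h.exists_powerNormalForm hU hzU hne he hz
    -- Every chart has its own normal form; comparing vanishing orders in both directions shows that
    -- the exponents agree.
    have : m = m' := le_antisymm (p.degree_le p' hz₀ hz (hdiff _ he₀ _ he hz₀ hz))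
      (p'.degree_le p hz hz₀ (hdiff _ he _ he₀ hz hz₀))
    exact this ▸ ⟨p'⟩
  refine ⟨m, h.two_le_of_gradientField_eq_zero hU hzU he₀ hz₀ h0 p, fun e he hz => ?_,
    h.eventually_gradientField_ne_zero hU hzU he₀ hz₀ p,
    exists_gradientChart h hU he₀ hz₀ hzU p, fun e he hz => ?_⟩
  · obtain ⟨p'⟩ := hp e he hz
    exact h.isLowestDegree hU hzU he hz p'
  · obtain ⟨p'⟩ := hp e he hz
    exact h.hasIndexInChart hU hzU he hz p'

end HarmonicOnSurface

end

section

/-! ### Connectedness of the punctured surface -/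

/-- Removing a closed set that does not separate its neighborhood does not separate. -/
theorem IsPreconnected.diff_of_diff_isPreconnected {X : Type*} [TopologicalSpace X] {C K N : Set X}
    (hC : IsPreconnected C) (hK : IsClosed K) (hN : IsOpen N) (hKN : K ⊆ N) (hNC : N ⊆ C)
    (h : IsPreconnected (N \ K)) : IsPreconnected (C \ K) := by
  rw [isPreconnected_iff_subset_of_disjoint] at h ⊢
  -- If `N \ K` lies on the side of `u`, then `K` can be filled in on that side: `(u \ K) ∪ N` and
  -- `v \ K` would separate `C` itself.
  have key : ∀ u v : Set X, IsOpen u → IsOpen v → C \ K ⊆ u ∪ v → C \ K ∩ (u ∩ v) = ∅ →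
      N \ K ⊆ u → C \ K ⊆ u ∨ C \ K ⊆ v := by
    intro u v hu hv huv hd hNu
    have h1 := isPreconnected_iff_subset_of_disjoint.1 hC (u \ K ∪ N) (v \ K)
      ((hu.sdiff hK).union hN) (hv.sdiff hK) (fun x hx => ?_) ?_
    · refine h1.imp (fun h2 x hx => ?_) fun h2 x hx => (h2 hx.1).1
      exact (h2 hx.1).elim (fun h3 => h3.1) fun h3 => hNu ⟨h3, hx.2⟩
    · by_cases hxK : x ∈ K
      · exact Or.inl (Or.inr (hKN hxK))
      · exact (huv ⟨hx, hxK⟩).elim (fun h2 => Or.inl (Or.inl ⟨h2, hxK⟩)) fun h2 => Or.inr ⟨h2, hxK⟩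
    · refine eq_empty_of_forall_notMem fun x hx => ?_
      have hxu : x ∈ u := hx.2.1.elim (fun h3 => h3.1) fun h3 => hNu ⟨h3, hx.2.2.2⟩
      have : x ∈ C \ K ∩ (u ∩ v) := ⟨⟨hx.1, hx.2.2.2⟩, hxu, hx.2.2.1⟩
      rw [hd] at this
      exact this
  intro u v hu hv huv hd
  refine (h u v hu hv ((sdiff_subset_sdiff_left hNC).trans huv) ?_).elim (key u v hu hv huv hd)
    fun h1 => (key v u hv hu (by rwa [union_comm]) (by rwa [inter_comm v u]) h1).symm
  refine eq_empty_of_forall_notMem fun x hx => ?_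
  have : x ∈ C \ K ∩ (u ∩ v) := ⟨sdiff_subset_sdiff_left hNC hx.1, hx.2⟩
  rw [hd] at this
  exact this

/-- Polar coordinates exhibit the annulus as a continuous image of an interval times the unit
sphere, which is connected in dimension above one. -/
theorem isPreconnected_ball_diff_closedBall {E : Type*} [NormedAddCommGroup E] [NormedSpace ℝ E]
    (hE : 1 < Module.rank ℝ E) {a : ℝ} (ha : 0 ≤ a) (b : ℝ) :
    IsPreconnected (Metric.ball (0 : E) b \ Metric.closedBall 0 a) := by
  have h1 : IsPreconnected (Ioo a b ×ˢ Metric.sphere (0 : E) 1) :=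
    isPreconnected_Ioo.prod (isPreconnected_sphere hE 0 1)
  have h2 := h1.image (fun p : ℝ × E => p.1 • p.2) (by fun_prop)
  convert h2 using 1
  ext x
  simp only [Set.mem_sdiff, mem_ball_zero_iff, mem_closedBall_zero_iff, not_le, mem_image, mem_prod,
    mem_Ioo, mem_sphere_zero_iff_norm, Prod.exists]
  constructor
  · rintro ⟨hb, hxa⟩
    have hx : ‖x‖ ≠ 0 := (ha.trans_lt hxa).ne'
    refine ⟨‖x‖, ‖x‖⁻¹ • x, ⟨⟨hxa, hb⟩, ?_⟩, ?_⟩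
    · rw [norm_smul, norm_inv, norm_norm, inv_mul_cancel₀ hx]
    · rw [smul_smul, mul_inv_cancel₀ hx, one_smul]
  · rintro ⟨r, v, ⟨⟨h3, h4⟩, h5⟩, rfl⟩
    rw [norm_smul, h5, mul_one, Real.norm_of_nonneg (ha.trans h3.le)]
    exact ⟨h4, h3⟩

variable {S : Type*} [TopologicalSpace S]

/-- A closed disk or a point of a surface, as the image of a closed ball in a chart. -/
def IsCell (K : Set S) : Prop :=
  ∃ (e : OpenPartialHomeomorph S Plane) (a : ℝ), 0 ≤ a ∧ Metric.closedBall (0 : Plane) a ⊆ e.target ∧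
    K = e.symm '' Metric.closedBall (0 : Plane) a

theorem IsCell.isClosed [T2Space S] {K : Set S} (h : IsCell K) : IsClosed K := by
  obtain ⟨e, a, -, ht, rfl⟩ := h
  exact ((isCompact_closedBall _ _).image_of_continuousOn (e.continuousOn_symm.mono ht)).isClosed

/-- By compactness a slightly larger ball still lies in the chart and in `C`; the cell does not
separate it, since what remains is an annulus. -/
theorem IsCell.isPreconnected_diff [T2Space S] {K C : Set S} (h : IsCell K) (hCo : IsOpen C)
    (hC : IsPreconnected C) (hKC : K ⊆ C) : IsPreconnected (C \ K) := by
  have hK := h.isClosed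
  obtain ⟨e, a, ha, ht, rfl⟩ := h
  have hrank : 1 < Module.rank ℝ Plane := by
    rw [← Module.finrank_eq_rank, finrank_euclideanSpace_fin]
    norm_num
  obtain ⟨δ, hδ, hδs⟩ := (isCompact_closedBall (0 : Plane) a).exists_thickening_subset_open
    (e.symm.isOpen_inter_preimage hCo) fun u hu => ⟨ht hu, hKC ⟨u, hu, rfl⟩⟩
  rw [thickening_closedBall hδ ha] at hδs
  have hbt : Metric.ball (0 : Plane) (δ + a) ⊆ e.target := fun u hu => (hδs hu).1
  refine hC.diff_of_diff_isPreconnected hK (N := e.symm '' Metric.ball 0 (δ + a))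
    (e.symm.isOpen_image_of_subset_source Metric.isOpen_ball hbt)
    (image_mono (Metric.closedBall_subset_ball (by linarith))) ?_ ?_
  · rintro _ ⟨u, hu, rfl⟩
    exact (hδs hu).2
  · rw [← (e.symm.injOn.mono hbt).image_sdiff_subset
      (Metric.closedBall_subset_ball (by linarith))]
    exact (isPreconnected_ball_diff_closedBall hrank ha _).image _
      (e.continuousOn_symm.mono (sdiff_subset.trans hbt))

theorem isPreconnected_diff_biUnion_of_isCell [T2Space S] {ι : Type*} {K : ι → Set S} (s : Finset ι)
    (hK : ∀ i ∈ s, IsCell (K i)) (hd : ∀ i ∈ s, ∀ j ∈ s, i ≠ j → Disjoint (K i) (K j)) {C : Set S}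
    (hCo : IsOpen C) (hC : IsPreconnected C) (hKC : ∀ i ∈ s, K i ⊆ C) :
    IsOpen (C \ ⋃ i ∈ s, K i) ∧ IsPreconnected (C \ ⋃ i ∈ s, K i) := by
  classical
  induction s using Finset.induction_on with
  | empty => simpa using ⟨hCo, hC⟩
  | insert i s hi ih =>
    obtain ⟨h1, h2⟩ := ih (fun j hj => hK j (Finset.mem_insert_of_mem hj))
      (fun j hj k hk => hd j (Finset.mem_insert_of_mem hj) k (Finset.mem_insert_of_mem hk))
      (fun j hj => hKC j (Finset.mem_insert_of_mem hj))
    have hKi := hK i (Finset.mem_insert_self i s)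
    have heq : C \ ⋃ j ∈ insert i s, K j = (C \ ⋃ j ∈ s, K j) \ K i := by
      rw [Finset.set_biUnion_insert, union_comm, sdiff_sdiff]
    rw [heq]
    refine ⟨h1.sdiff hKi.isClosed, hKi.isPreconnected_diff h1 h2 fun x hx => ⟨hKC i
      (Finset.mem_insert_self i s) hx, ?_⟩⟩
    simp only [mem_iUnion, not_exists]
    intro j hj hxj
    exact disjoint_left.1 (hd i (Finset.mem_insert_self i s) j (Finset.mem_insert_of_mem hj)
      (by rintro rfl; exact hi hj)) hx hxj

variable [ChartedSpace Plane S]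

theorem isCell_singleton (x : S) : IsCell ({x} : Set S) := by
  set e := (chartAt Plane x).transHomeomorph (Homeomorph.addRight (-chartAt Plane x x)) with he
  have hx : x ∈ e.source := mem_chart_source Plane x
  have hx0 : e x = 0 := by simp [he]
  refine ⟨e, 0, le_rfl, ?_, ?_⟩
  · rw [Metric.closedBall_zero, singleton_subset_iff, ← hx0]
    exact e.map_source hx
  · rw [Metric.closedBall_zero, image_singleton, ← hx0, e.left_inv hx]

theorem IsSmoothClosedDisk.isCell {D : Set S} (h : IsSmoothClosedDisk D) : IsCell D := by
  obtain ⟨e, -, h1, h2⟩ := h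
  exact ⟨e, 1, zero_le_one, h1, h2⟩

theorem isOpen_puncturedSurface [T2Space S] (P : Finset S) {l : ℕ} {D : Fin l → Set S}
    (hD : ∀ j, IsSmoothClosedDisk (D j)) : IsOpen (puncturedSurface P D) :=
  (P.finite_toSet.isClosed.union (isClosed_iUnion_of_finite fun j => (hD j).isCell.isClosed)).isOpen_compl

/-- The disks are removed first, then the points, the pole being treated as one more puncture. -/
theorem isPreconnected_puncturedSurface_diff_singleton [T2Space S] [PreconnectedSpace S]
    (P : Finset S) {l : ℕ} {D : Fin l → Set S} (hD : ∀ j, IsSmoothClosedDisk (D j))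
    (hDD : ∀ i j, i ≠ j → Disjoint (D i) (D j)) (hPD : ∀ p ∈ P, ∀ j, p ∉ D j) {y : S}
    (hy : y ∈ puncturedSurface P D) : IsPreconnected (puncturedSurface P D \ {y}) := by
  classical
  obtain ⟨h1, h2⟩ := isPreconnected_diff_biUnion_of_isCell (K := D) Finset.univ
    (fun j _ => (hD j).isCell) (fun i _ j _ => hDD i j) isOpen_univ isPreconnected_univ
    (fun _ _ => subset_univ _)
  obtain ⟨-, h3⟩ := isPreconnected_diff_biUnion_of_isCell (K := fun x : S => {x}) (insert y P)
    (fun x _ => isCell_singleton x) (fun i _ j _ hij => by simpa using hij) h1 h2 (by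
      intro x hx
      simp only [singleton_subset_iff, Set.mem_sdiff, mem_univ, true_and, Finset.mem_univ, iUnion_true,
        mem_iUnion, not_exists]
      rcases Finset.mem_insert.1 hx with rfl | hx
      · intro j hj
        exact hy (Or.inr (mem_iUnion.2 ⟨j, hj⟩))
      · exact hPD x hx)
  convert h3 using 1
  ext x
  simp only [puncturedSurface, Set.mem_sdiff, mem_compl_iff, mem_union, Finset.mem_coe, mem_iUnion,
    mem_singleton_iff, mem_univ, true_and, Finset.mem_univ, iUnion_true, Finset.mem_insert,
    exists_prop, exists_eq_right']
  tauto

theorem neBot_nhdsWithin_compl_singleton (x : S) : (𝓝[≠] x).NeBot := by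
  set e := chartAt Plane x
  have hx : x ∈ e.source := mem_chart_source Plane x
  have h1 : Tendsto e.symm (𝓝[≠] (e x)) (𝓝[≠] x) := by
    refine tendsto_nhdsWithin_iff.2 ⟨(e.tendsto_symm hx).mono_left nhdsWithin_le_nhds, ?_⟩
    filter_upwards [self_mem_nhdsWithin, nhdsWithin_le_nhds
      (e.open_target.mem_nhds (e.map_source hx))] with u hu hut hux
    exact hu (by rw [← e.right_inv hut, hux]; rfl)
  exact h1.neBot

end

section

/-! ### Green's functions are not locally constant -/

theorem integral_pderiv_eq_zero {V : Plane → ℝ} (hV : ContDiff ℝ ∞ V) (hc : HasCompactSupport V)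
    (i : Fin 2) : ∫ u, pderiv i V u = 0 := by
  have hint : Integrable (fun u => fderiv ℝ V u (basisVec i)) :=
    ((hV.continuous_fderiv (by simp)).clm_apply continuous_const).integrable_of_hasCompactSupport
      (hc.fderiv_apply ℝ _)
  have h := integral_mul_fderiv_eq_neg_fderiv_mul_of_integrable (μ := (volume : Measure Plane))
    (f := fun _ : Plane => (1 : ℝ)) (g := V) (v := basisVec i) (by simp) (by simpa using hint)
    (by simpa using hV.continuous.integrable_of_hasCompactSupport hc)
    (fun x _ => differentiableAt_const _) (fun x _ => hV.differentiable (by simp) x)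
  simpa [pderiv] using h

variable {S : Type*}

theorem notMem_of_mem_puncturedSurface {P : Finset S} {l : ℕ} {D : Fin l → Set S} {x : S} (hx : x ∈ puncturedSurface P D) : x ∉ P :=
  fun h => hx (Or.inl h)

variable [TopologicalSpace S]

theorem extendAcross_of_notMem {P : Finset S} {G : S → ℝ} {x : S} (hx : x ∉ P) : extendAcross P G x = G x := by
  rw [extendAcross, if_neg hx]

variable [ChartedSpace Plane S] [IsManifold (𝓡 2) ∞ S]
variable {g : SurfaceMetric S}

/-- The integral of the Laplacian of a test function vanishes. -/
theorem integral_laplaceBeltrami_mul_areaDensity {e : OpenPartialHomeomorph S Plane}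
    (he : e ∈ smoothCharts S) {ψ : Plane → ℝ} (hψ : ContDiff ℝ ∞ ψ) (hc : HasCompactSupport ψ)
    (hs : tsupport ψ ⊆ e.target) :
    ∫ u, laplaceBeltrami g e ψ u * areaDensity g e u = 0 := by
  set V : Fin 2 → Plane → ℝ := fun i w => ∑ j, conformalMatrix g e i j w * pderiv j ψ w with hVdef
  have hpc : ∀ j, ContDiff ℝ ∞ (pderiv j ψ) := fun j =>
    (hψ.fderiv_right (m := ∞) (by simp)).clm_apply contDiff_const
  have hz : ∀ u ∉ tsupport ψ, ∀ j, pderiv j ψ u = 0 := fun u hu j => by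
    have h1 : fderiv ℝ ψ u = 0 := image_eq_zero_of_notMem_tsupport
      fun h => hu (tsupport_fderiv_subset ℝ h)
    rw [pderiv, h1]
    rfl
  have hVz : ∀ i, ∀ u ∉ tsupport ψ, V i u = 0 := fun i u hu => by
    simp [hVdef, hz u hu]
  have hVs : ∀ i, tsupport (V i) ⊆ tsupport ψ := fun i =>
    closure_minimal (fun u hu => by
      by_contra h
      exact hu (hVz i u h)) (isClosed_tsupport ψ)
  have hV : ∀ i, ContDiff ℝ ∞ (V i) := fun i => by
    -- The coefficients are smooth only over the chart target; off the support of `ψ` the field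
    -- vanishes, and the two open sets cover the plane.
    refine contDiff_of_contDiffOn_union_of_isOpen (s := e.target) (t := (tsupport ψ)ᶜ) ?_ ?_ ?_
      e.open_target (isClosed_tsupport ψ).isOpen_compl
    · exact ContDiffOn.sum fun j _ => (contDiffOn_conformalMatrix g he i j).mul (hpc j).contDiffOn
    · exact (contDiffOn_const (c := (0 : ℝ))).congr fun u hu => hVz i u hu
    · exact eq_univ_of_forall fun u => by
        by_cases hu : u ∈ tsupport ψ
        · exact Or.inl (hs hu)
        · exact Or.inr hu
  have hVc : ∀ i, HasCompactSupport (V i) := fun i =>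
    hc.of_isClosed_subset (isClosed_tsupport _) (hVs i)
  have heq : ∀ u, laplaceBeltrami g e ψ u * areaDensity g e u = ∑ i, pderiv i (V i) u := by
    intro u
    rw [laplaceBeltrami_eq]
    by_cases hu : u ∈ e.target
    · have := (areaDensity_pos g he hu).ne'
      field_simp
      rfl
    · have hu' : u ∉ tsupport ψ := fun h => hu (hs h)
      have h0 : ∀ i, pderiv i (V i) u = 0 := fun i => by
        have h1 : fderiv ℝ (V i) u = 0 := image_eq_zero_of_notMem_tsupport
          fun h => hu' (hVs i (tsupport_fderiv_subset ℝ h))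
        rw [pderiv, h1]
        rfl
      have h2 : ∑ i, pderiv i (fun w => ∑ j, conformalMatrix g e i j w * pderiv j ψ w) u = 0 :=
        Finset.sum_eq_zero fun i _ => h0 i
      rw [h2, mul_zero, zero_mul]
  simp_rw [heq]
  rw [integral_finsetSum]
  · exact Finset.sum_eq_zero fun i _ => integral_pderiv_eq_zero (hV i) (hVc i) i
  · intro i _
    exact (((hV i).continuous_fderiv (by simp)).clm_apply
      continuous_const).integrable_of_hasCompactSupport ((hVc i).fderiv_apply ℝ _)

/-- A Green's function is not constant off its pole. -/
theorem IsGreenFunction.not_const {M : Set S} {y : S} {G : S → ℝ} (h : IsGreenFunction g M y G)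
    (hM : IsOpen M) (c : ℝ) : ¬ ∀ x ∈ M \ {y}, G x = c := by
  intro hc
  set e := (chartAt Plane y).restr M with he_def
  have he : e ∈ smoothCharts S :=
    restr_mem_maximalAtlas (contDiffGroupoid ∞ (𝓡 2)) (IsManifold.chart_mem_maximalAtlas y) hM
  have hsrc : e.source = (chartAt Plane y).source ∩ M := by
    rw [he_def, OpenPartialHomeomorph.restr_source, hM.interior_eq]
  have hy : y ∈ e.source := by
    rw [hsrc]
    exact ⟨mem_chart_source Plane y, h.pole_mem⟩
  have hsM : e.source ⊆ M := hsrc ▸ inter_subset_right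
  -- A test function equal to `1` at the pole: its pairing with the distributional Laplacian is
  -- `-1`, while a constant would give `0`.
  obtain ⟨ψ, h1, h2, h3, -, h5⟩ := exists_contDiff_tsupport_subset (n := ⊤)
    (e.open_target.mem_nhds (e.map_source hy))
  have h6 := h.distributional e he hsM ψ h3 h2 h1
  rw [if_pos hy, h5] at h6
  have h7 : (fun u => G (e.symm u) * laplaceBeltrami g e ψ u * areaDensity g e u) =ᵐ[volume]
      fun u => c * (laplaceBeltrami g e ψ u * areaDensity g e u) := by
    have hne : ∀ᵐ u : Plane, u ≠ e y := by
      rw [ae_iff]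
      simp
    filter_upwards [hne] with u hu
    by_cases hut : u ∈ e.target
    · rw [hc _ ⟨hsM (e.map_target hut), fun h8 => hu ?_⟩, mul_assoc]
      rw [← e.right_inv hut, h8]
    · have hzero : laplaceBeltrami g e ψ u = 0 := by
        have hp : ∀ j, (pderiv j ψ) =ᶠ[𝓝 u] 0 := fun j => by
          filter_upwards [(isClosed_tsupport ψ).isOpen_compl.mem_nhds fun h => hut (h1 h)]
            with w hw
          have h1 : fderiv ℝ ψ w = 0 := image_eq_zero_of_notMem_tsupport
            fun h => hw (tsupport_fderiv_subset ℝ h)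
          rw [pderiv, h1]
          rfl
        rw [laplaceBeltrami_eq]
        refine mul_eq_zero_of_right _ (Finset.sum_eq_zero fun i _ => ?_)
        have h8 : (fun w => ∑ j, conformalMatrix g e i j w * pderiv j ψ w) =ᶠ[𝓝 u]
            fun _ => (0 : ℝ) := by
          filter_upwards [hp 0, hp 1] with w hw0 hw1
          simp [Fin.sum_univ_two, hw0, hw1]
        rw [pderiv, h8.fderiv_eq]
        simp
      simp [hzero]
  rw [integral_congr_ae h7, integral_const_mul,
    integral_laplaceBeltrami_mul_areaDensity he h3 h2 h1, mul_zero] at h6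
  norm_num at h6

theorem HarmonicOnSurface.congr {f f' : S → ℝ} {U : Set S} (h : HarmonicOnSurface g f U)
    (hU : IsOpen U) (hff : ∀ x ∈ U, f' x = f x) : HarmonicOnSurface g f' U := by
  refine ⟨h.1.congr hff, fun e he u hu huU => ?_⟩
  rw [← h.2 e he u hu huU, laplaceBeltrami_eq, laplaceBeltrami_eq]
  congr 1
  refine Finset.sum_congr rfl fun i _ => ?_
  have h1 : (fun w => f' (e.symm w)) =ᶠ[𝓝 u] fun w => f (e.symm w) :=
    ((e.continuousAt_symm hu).eventually (hU.mem_nhds huU)).mono fun w hw => hff _ hw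
  have h2 : (fun w => ∑ j, conformalMatrix g e i j w * pderiv j (fun w => f' (e.symm w)) w) =ᶠ[𝓝 u]
      fun w => ∑ j, conformalMatrix g e i j w * pderiv j (fun w => f (e.symm w)) w :=
    h1.eventually_nhds.mono fun w hw => Finset.sum_congr rfl fun j _ => by
      rw [pderiv, pderiv, EventuallyEq.fderiv_eq hw]
  rw [pderiv, pderiv, h2.fderiv_eq]

theorem HarmonicOnSurface.mono {f : S → ℝ} {U U' : Set S} (h : HarmonicOnSurface g f U)
    (hU : U' ⊆ U) : HarmonicOnSurface g f U' :=
  ⟨h.1.mono hU, fun e he u hu huU => h.2 e he u hu (hU huU)⟩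

/-- Unique continuation on a connected open set. -/
theorem HarmonicOnSurface.eq_const_of_eventually_eq {f : S → ℝ} {U : Set S}
    (h : HarmonicOnSurface g f U) (hU : IsOpen U) (hUc : IsPreconnected U) {x : S} (hx : x ∈ U)
    {c : ℝ} (hc : ∀ᶠ x' in 𝓝 x, f x' = c) : ∀ x' ∈ U, f x' = c := by
  have hA : IsOpen {x | ∀ᶠ x' in 𝓝 x, f x' = c} := isOpen_setOfPred_eventually_nhds
  suffices hsub : U ⊆ {x | ∀ᶠ x' in 𝓝 x, f x' = c} from
    fun x' hx' => (show ∀ᶠ x'' in 𝓝 x', f x'' = c from hsub hx').self_of_nhds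
  -- The set where `f` is locally equal to `c` is open; local unique continuation shows that it is
  -- closed in `U`.
  refine hUc.subset_of_closure_inter_subset hA ⟨x, hx, hc⟩ ?_
  rintro x₀ ⟨hcl, hx₀⟩
  set e := chartAt Plane x₀ with he_def
  have he : e ∈ smoothCharts S := IsManifold.chart_mem_maximalAtlas x₀
  have hes : x₀ ∈ e.source := mem_chart_source Plane x₀
  obtain ⟨O, hO, hOu⟩ := (h.isDivFormHarmonic hU he).exists_nhds_unique_continuation
    (planeEquiv_mem_complexDomain hes hx₀)
  have hcont : ContinuousAt (fun x => planeEquiv (e x)) x₀ :=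
    planeEquiv.continuous.continuousAt.comp (e.continuousAt hes)
  obtain ⟨x₁, ⟨hx₁, hx₁s⟩, hx₁A⟩ := mem_closure_iff_nhds.1 hcl _
    (inter_mem (hcont hO) (e.open_source.mem_nhds hes))
  have hback : Tendsto (fun u : ℂ => e.symm (planeEquiv.symm u)) (𝓝 (planeEquiv (e x₁)))
      (𝓝 x₁) := by
    have h1 : ContinuousAt (fun u : ℂ => e.symm (planeEquiv.symm u)) (planeEquiv (e x₁)) := by
      refine ContinuousAt.comp (g := e.symm) ?_ planeEquiv.symm.continuous.continuousAt
      rw [planeEquiv.symm_apply_apply]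
      exact e.continuousAt_symm (e.map_source hx₁s)
    have h2 := h1.tendsto
    rwa [planeEquiv.symm_apply_apply, e.left_inv hx₁s] at h2
  have h1 : ∀ᶠ u in 𝓝 (planeEquiv (e x₀)),
      complexCoord e f u = complexCoord e f (planeEquiv (e x₀)) := by
    refine hOu _ hx₁ ((hback.eventually hx₁A).mono fun u hu => ?_)
    rw [complexCoord_planeEquiv e f hx₁s, hx₁A.self_of_nhds]
    exact hu
  have h2 : ∀ᶠ x in 𝓝 x₀, f x = f x₀ := by
    filter_upwards [hcont.eventually h1, e.open_source.mem_nhds hes] with x hx hxs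
    rwa [complexCoord_planeEquiv e f hxs, complexCoord_planeEquiv e f hes] at hx
  obtain ⟨x₂, hx₂, hx₂A⟩ := mem_closure_iff_nhds.1 hcl _ h2
  have h3 : f x₀ = c := hx₂.symm.trans hx₂A.self_of_nhds
  filter_upwards [h2] with x hx using hx.trans h3

variable [T2Space S] {P : Finset S} {l : ℕ} {D : Fin l → Set S} {y : S} {G : S → ℝ}

/-- The extended function is harmonic on the punctured surface without the pole. -/
theorem IsGreenFunction.harmonicOnSurface_extendAcross
    (h : IsGreenFunction g (puncturedSurface P D) y G) (hD : ∀ j, IsSmoothClosedDisk (D j)) :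
    HarmonicOnSurface g (extendAcross P G) (puncturedSurface P D \ {y}) :=
  h.harmonic.congr ((isOpen_puncturedSurface P hD).sdiff isClosed_singleton) fun _ hx =>
    extendAcross_of_notMem (notMem_of_mem_puncturedSurface hx.1)

/-- The extended function is harmonic near each point of the domain of the extended field. -/
theorem IsGreenFunction.exists_harmonicOnSurface
    (h : IsGreenFunction g (puncturedSurface P D) y G) (hD : ∀ j, IsSmoothClosedDisk (D j))
    (hPD : ∀ p ∈ P, ∀ j, p ∉ D j) {z : S}
    (hz : z ∈ fieldDomain g (puncturedSurface P D) P y G) :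
    ∃ U, IsOpen U ∧ z ∈ U ∧ U \ {z} ⊆ puncturedSurface P D \ {y} ∧
      U ⊆ fieldDomain g (puncturedSurface P D) P y G ∧
      HarmonicOnSurface g (extendAcross P G) U := by
  have hMo := (isOpen_puncturedSurface P hD).sdiff (isClosed_singleton (x := y))
  rcases hz with hz | ⟨hzP, H, ⟨U₀, hU₀, hzU₀, hH⟩, hHG⟩
  · exact ⟨_, hMo, hz, sdiff_subset, subset_union_left, h.harmonicOnSurface_extendAcross hD⟩
  have hzy : z ≠ y := by
    rintro rfl
    exact h.pole_mem (Or.inl hzP)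
  have hmem : z ∈ (((P : Set S) \ {z}) ∪ (⋃ j, D j) ∪ {y})ᶜ := by
    simp only [mem_compl_iff, mem_union, Set.mem_sdiff, mem_singleton_iff, not_true_eq_false, and_false,
      mem_iUnion, false_or, not_or, not_exists]
    exact ⟨hPD z hzP, hzy⟩
  have hop : IsOpen (((P : Set S) \ {z}) ∪ (⋃ j, D j) ∪ {y})ᶜ :=
    (((P.finite_toSet.sdiff).isClosed.union (isClosed_iUnion_of_finite fun j =>
      (hD j).isCell.isClosed)).union isClosed_singleton).isOpen_compl
  obtain ⟨O, hO, hOo, hzO⟩ := eventually_nhds_iff.1 (eventually_nhdsWithin_iff.1 hHG)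
  set U := U₀ ∩ (((P : Set S) \ {z}) ∪ (⋃ j, D j) ∪ {y})ᶜ ∩ O with hU
  have hUo : IsOpen U := (hU₀.inter hop).inter hOo
  have hUM : U \ {z} ⊆ puncturedSurface P D \ {y} := by
    rintro x ⟨⟨⟨-, hx⟩, -⟩, hxz⟩
    simp only [mem_compl_iff, mem_union, Set.mem_sdiff, not_or] at hx
    refine ⟨fun hx' => hx'.elim (fun h1 => hx.1.1 ⟨h1, hxz⟩) hx.1.2, hx.2⟩
  have hfH : ∀ x ∈ U, extendAcross P G x = H x := by
    intro x hx
    by_cases hxz : x = z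
    · subst hxz
      -- At the puncture itself the extension is defined as a limit, which exists and equals `H`
      -- there by continuity.
      have hcont : ContinuousAt H x := (hH.1.contMDiffAt (hU₀.mem_nhds hzU₀)).continuousAt
      have hlim : Tendsto G (𝓝[≠] x) (𝓝 (H x)) :=
        (hcont.tendsto.mono_left nhdsWithin_le_nhds).congr' hHG
      have := neBot_nhdsWithin_compl_singleton x
      rw [extendAcross, if_pos hzP]
      exact hlim.limUnder_eq
    · rw [extendAcross_of_notMem (notMem_of_mem_puncturedSurface (hUM ⟨hx, hxz⟩).1)]
      exact (hO x hx.2 hxz).symm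
  refine ⟨U, hUo, ⟨⟨hzU₀, hmem⟩, hzO⟩, hUM, fun x hx => ?_,
    (hH.mono fun x hx => hx.1.1).congr hUo hfH⟩
  by_cases hxz : x = z
  · exact Or.inr ⟨hxz ▸ hzP, hxz ▸ ⟨H, ⟨U₀, hU₀, hzU₀, hH⟩, hHG⟩⟩
  · exact Or.inl (hUM ⟨hx, hxz⟩)

/-- Local constancy would spread over the whole connected surface off the pole. Since `z` may be a
removable puncture, the continuation starts at a nearby point other than `z`. -/
theorem IsGreenFunction.not_eventually_const [PreconnectedSpace S]
    (h : IsGreenFunction g (puncturedSurface P D) y G) (hD : ∀ j, IsSmoothClosedDisk (D j))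
    (hDD : ∀ i j, i ≠ j → Disjoint (D i) (D j)) (hPD : ∀ p ∈ P, ∀ j, p ∉ D j) {z : S}
    (hz : z ∈ fieldDomain g (puncturedSurface P D) P y G) (c : ℝ) :
    ¬ ∀ᶠ x in 𝓝 z, extendAcross P G x = c := by
  intro hc
  obtain ⟨U, hUo, hzU, hUM, -, -⟩ := h.exists_harmonicOnSurface hD hPD hz
  have hM := isOpen_puncturedSurface P hD
  obtain ⟨O, hO, hOo, hzO⟩ := eventually_nhds_iff.1 hc
  have := neBot_nhdsWithin_compl_singleton z
  obtain ⟨x, ⟨hxU, hxO⟩, hxz⟩ : ((U ∩ O) ∩ {z}ᶜ).Nonempty :=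
    (inter_mem (nhdsWithin_le_nhds (inter_mem (hUo.mem_nhds hzU) (hOo.mem_nhds hzO)))
      self_mem_nhdsWithin : (U ∩ O) ∩ {z}ᶜ ∈ 𝓝[≠] z) |> (𝓝[≠] z).nonempty_of_mem
  refine h.not_const hM c fun x' hx' => ?_
  rw [← extendAcross_of_notMem (P := P) (G := G) (notMem_of_mem_puncturedSurface hx'.1)]
  refine (h.harmonicOnSurface_extendAcross hD).eq_const_of_eventually_eq
    (hM.sdiff isClosed_singleton)
    (isPreconnected_puncturedSurface_diff_singleton P hD hDD hPD h.pole_mem) (hUM ⟨hxU, hxz⟩)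
    ?_ x' hx'
  filter_upwards [hOo.mem_nhds hxO] with w hw using hO w hw

end

end

/-! ### The critical points of the Green's function -/

theorem propositionL
    {S : Type*} [TopologicalSpace S] [ChartedSpace Plane S] [IsManifold (𝓡 2) ∞ S]
    [T2Space S] [CompactSpace S] [ConnectedSpace S]
    (g : SurfaceMetric S) (hg : HasConstantCurvature g)
    (P : Finset S) {l : ℕ} (D : Fin l → Set S)
    (hD : ∀ j, IsSmoothClosedDisk (D j))
    (hDD : ∀ i j, i ≠ j → Disjoint (D i) (D j))
    (hPD : ∀ p ∈ P, ∀ j, p ∉ D j)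
    (y : S) (G : S → ℝ) (hG : IsGreenFunction g (puncturedSurface P D) y G)
    (z : S) (hz : z ∈ fieldDomain g (puncturedSurface P D) P y G)
    (hz0 : gradientField g (extendAcross P G) z = 0) :
    ∃ m : ℕ, 2 ≤ m ∧
      (∀ e ∈ smoothCharts S, z ∈ e.source → IsLowestDegree (extendAcross P G) e z m) ∧
      (∀ᶠ x in 𝓝[≠] z, gradientField g (extendAcross P G) x ≠ 0) ∧
      (∀ V ∈ 𝓝 z, ∃ U : Set S, IsOpen U ∧ z ∈ U ∧ U ⊆ V ∧
        Nonempty (↥(U ∩ stableSet (gradientField g (extendAcross P G))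
          (fieldDomain g (puncturedSurface P D) P y G) z) ≃ₜ ↥(starSet m)) ∧
        Nonempty (↥(U ∩ unstableSet (gradientField g (extendAcross P G))
          (fieldDomain g (puncturedSurface P D) P y G) z) ≃ₜ ↥(starSet m))) ∧
      (∀ e ∈ smoothCharts S, z ∈ e.source →
        HasIndexInChart (gradientField g (extendAcross P G)) e z (1 - (m : ℤ))) := by
  obtain ⟨U, hU, hzU, -, hUW, hharm⟩ := hG.exists_harmonicOnSurface hD hPD hz
  obtain ⟨m, hm, hdeg, hiso, ⟨p⟩, hind⟩ := hharm.critical_point hU hzU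
    (hG.not_eventually_const hD hDD hPD hz _) hz0
  refine ⟨m, hm, hdeg, hiso, fun V hV => ?_, hind⟩
  -- Differentiability is needed on the entire domain of the field, not only near `z`, because
  -- monotonicity is used along whole trajectories.
  refine p.exists_isOpen_homeomorph_starSet hm (mem_of_superset (hU.mem_nhds hzU) hUW)
    (fun x hx => ?_) (fun x _ => mfderiv_gradientField_nonneg g _ x) hV
  obtain ⟨U', hU', hxU', -, -, hharm'⟩ := hG.exists_harmonicOnSurface hD hPD hx
  exact hharm'.mdifferentiableAt hU' hxU'
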